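/- Let $\mathsf{L}_\omega$ be the language of higher-order arithmetic (all finite types over the type $0$ of natural numbers, $1 = 0\to 0$, $2 = 1 \to 0$; constants $0,1,+,\times$, the combinators $\Pi,\Sigma$ and the recursors; atomic formulas $s =_0 t$ and $s <_0 t$; equality at higher types is defined pointwise). Let $\mathsf{RCA}_0^\omega$ be Kohlenbach's base theory in classical logic: the axioms of a (discretely) ordered semi-ring for the numbers, the axioms for $\Pi$, $\Sigma$ and the recursor $\mathbf{R}_0$, extensionality at all types, induction for quantifier-free formulas, and the quantifier-free choice scheme $\mathsf{QF\text{-}AC}^{1,0}$. Let $\mathsf{ACA}_0^\omega = \mathsf{RCA}_0^\omega + (\mu^2)$, where $(\mu^2)$ states that there is a functional $\mu$ such that, for every $f:\mathbb{N}\to\mathbb{N}$, $\mu(f)$ is the least zero of $f$ if $f$ has a zero, and $\mu(f)=0$ otherwise. Let $\mathsf{WKL}$ be weak König's lemma. Real numbers are given by fast-converging Cauchy sequences of rationals, and $f:[0,1]\to\mathbb{R}$ by an object of type $1\to1$ that maps equal reals in $[0,1]$ to equal reals; $f\in C([0,1])$ means that $f$ is in addition $\varepsilon$-$\delta$-continuous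 on $[0,1]$. Let $A(f)$ be any formula of $\mathsf{L}_\omega$ whose only free variable is $f$, of type $1\to1$, for instance one that expresses Ekeland's weak variational principle for the potential $f$. Write $\mathsf{FVP}^\omega_{\mathsf{tot}}$ for the sentence $(\forall f:[0,1]\to\mathbb{R})A(f)$ and $\mathsf{FVP}^\omega_{\mathsf{tot},\mathsf{cont}}$ for the sentence $(\forall f\in C([0,1]))A(f)$. **Theorem.** Suppose that (a$'$) $\mathsf{ACA}_0^\omega$ proves $\mathsf{FVP}^\omega_{\mathsf{tot}}$, and (b$'$) $\mathsf{RCA}_0^\omega+\mathsf{WKL}$ proves $\mathsf{FVP}^\omega_{\mathsf{tot},\mathsf{cont}}$. Then $\mathsf{RCA}_0^\omega+\mathsf{WKL}$ already proves $\mathsf{FVP}^\omega_{\mathsf{tot}}$. Hence $\mathsf{FVP}^\omega_{\mathsf{tot}}$ does not imply $\mathsf{ACA}_0$, even over $\mathsf{RCA}_0^\omega+\mathsf{WKL}$: there is an instance $\varphi$ of arithmetical comprehension (for formulas of second-order arithmetic with number and function parameters) such that $\mathsf{RCA}_0^\omega+\mathsf{WKL}$ does not prove $\mathsf{FVP}^\omega_{\mathsf{tot}}\to\varphi$.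 -/

import Mathlib

namespace HOA

/-! ## The language of higher-order arithmetic -/

/-- The finite types: `nat` is the type `0`, and `arr σ τ` is `σ → τ`. -/
inductive Ty : Type
  | nat : Ty
  | arr : Ty → Ty → Ty

/-- The type `1` of functions from numbers to numbers. -/
abbrev Ty.one : Ty := .arr .nat .nat

/-- The type `2` of functionals from type `1` objects to numbers. -/
abbrev Ty.two : Ty := .arr .one .nat

/-- A list of the types of the variables that may occur free (de Bruijn indices). -/
abbrev Ctx : Type := List Ty

/-- `Var Γ σ` is the type of variables of type `σ` declared in `Γ`. -/
inductive Var : Ctx → Ty → Type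
  | vz {Γ : Ctx} {σ : Ty} : Var (σ :: Γ) σ
  | vs {Γ : Ctx} {σ τ : Ty} : Var Γ σ → Var (τ :: Γ) σ

/-- The constants: `0`, `1`, `+`, `×`, the combinators `Π` (alias `K`) and `Σ` (alias `S`),
and the recursors. -/
inductive Con : Ty → Type
  | zero : Con .nat
  | one : Con .nat
  | add : Con (.arr .nat (.arr .nat .nat))
  | mul : Con (.arr .nat (.arr .nat .nat))
  | k (σ τ : Ty) : Con (.arr σ (.arr τ σ))
  | s (ρ σ τ : Ty) : Con (.arr (.arr ρ (.arr σ τ)) (.arr (.arr ρ σ) (.arr ρ τ)))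
  | recursor (σ : Ty) : Con (.arr (.arr .nat (.arr σ σ)) (.arr σ (.arr .nat σ)))

/-- Terms, with their types. -/
inductive Tm (Γ : Ctx) : Ty → Type
  | var {σ : Ty} : Var Γ σ → Tm Γ σ
  | con {σ : Ty} : Con σ → Tm Γ σ
  | app {σ τ : Ty} : Tm Γ (.arr σ τ) → Tm Γ σ → Tm Γ τ

/-- Formulas. The atomic formulas are `s = t` and `s < t` for terms of type `0`; the logic is
classical, so the other connectives and `∃` are defined from `⊥`, `→` and `∀` below. -/
inductive Fm : Ctx → Type
  | bot {Γ : Ctx} : Fm Γ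
  | eq {Γ : Ctx} : Tm Γ .nat → Tm Γ .nat → Fm Γ
  | lt {Γ : Ctx} : Tm Γ .nat → Tm Γ .nat → Fm Γ
  | imp {Γ : Ctx} : Fm Γ → Fm Γ → Fm Γ
  | all {Γ : Ctx} (σ : Ty) : Fm (σ :: Γ) → Fm Γ

/-- Closed formulas. -/
abbrev Sentence : Type := Fm []

/-! ## Renaming and substitution -/

abbrev Ren (Γ Δ : Ctx) : Type := ∀ σ : Ty, Var Γ σ → Var Δ σ

abbrev Sub (Γ Δ : Ctx) : Type := ∀ σ : Ty, Var Γ σ → Tm Δ σ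

def Ren.lift {Γ Δ : Ctx} (r : Ren Γ Δ) (τ : Ty) : Ren (τ :: Γ) (τ :: Δ)
  | _, .vz => .vz
  | _, .vs x => .vs (r _ x)

def Tm.rename {Γ Δ : Ctx} (r : Ren Γ Δ) : {σ : Ty} → Tm Γ σ → Tm Δ σ
  | _, .var x => .var (r _ x)
  | _, .con c => .con c
  | _, .app s t => .app (s.rename r) (t.rename r)

def Fm.rename : {Γ Δ : Ctx} → Ren Γ Δ → Fm Γ → Fm Δ
  | _, _, _, .bot => .bot
  | _, _, r, .eq s t => .eq (s.rename r) (t.rename r)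
  | _, _, r, .lt s t => .lt (s.rename r) (t.rename r)
  | _, _, r, .imp φ ψ => .imp (φ.rename r) (ψ.rename r)
  | _, _, r, .all σ φ => .all σ (φ.rename (r.lift σ))

/-- Weakening of a term by a fresh variable. -/
def Tm.wk {Γ : Ctx} {σ τ : Ty} (t : Tm Γ σ) : Tm (τ :: Γ) σ :=
  t.rename fun _ x => .vs x

/-- Weakening of a formula by a fresh variable. -/
def Fm.wk {Γ : Ctx} {τ : Ty} (φ : Fm Γ) : Fm (τ :: Γ) :=
  φ.rename fun _ x => .vs x

def Sub.lift {Γ Δ : Ctx} (s : Sub Γ Δ) (τ : Ty) : Sub (τ :: Γ) (τ :: Δ)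
  | _, .vz => .var .vz
  | _, .vs x => (s _ x).wk

def Tm.subst {Γ Δ : Ctx} (s : Sub Γ Δ) : {σ : Ty} → Tm Γ σ → Tm Δ σ
  | _, .var x => s _ x
  | _, .con c => .con c
  | _, .app t u => .app (t.subst s) (u.subst s)

def Fm.subst : {Γ Δ : Ctx} → Sub Γ Δ → Fm Γ → Fm Δ
  | _, _, _, .bot => .bot
  | _, _, s, .eq t u => .eq (t.subst s) (u.subst s)
  | _, _, s, .lt t u => .lt (t.subst s) (u.subst s)
  | _, _, s, .imp φ ψ => .imp (φ.subst s) (ψ.subst s)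
  | _, _, s, .all σ φ => .all σ (φ.subst (s.lift σ))

/-- The substitution of `t` for the last variable and of `s x` for every other variable `x`. -/
def Sub.cons {Γ Δ : Ctx} {τ : Ty} (t : Tm Δ τ) (s : Sub Γ Δ) : Sub (τ :: Γ) Δ
  | _, .vz => t
  | _, .vs x => s _ x

/-- The substitution of `t` for the last variable; the others are unchanged. -/
def Sub.single {Γ : Ctx} {τ : Ty} (t : Tm Γ τ) : Sub (τ :: Γ) Γ :=
  Sub.cons t fun _ x => .var x

/-- The substitution of `n + 1` for the last variable `n`; the others are unchanged. -/
def Sub.next {Γ : Ctx} : Sub (.nat :: Γ) (.nat :: Γ) :=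
  Sub.cons (.app (.app (.con .add) (.var .vz)) (.con .one)) fun _ x => .var (.vs x)

/-- The substitution of `Y(x)` for the last variable `y`, where the last two variables are `x`, `y`
before and `Y`, `x` after; the others are unchanged. -/
def Sub.choice {Γ : Ctx} : Sub (.nat :: .one :: Γ) (.one :: .two :: Γ) :=
  Sub.cons (.app (.var (.vs .vz)) (.var .vz))
    (Sub.cons (.var .vz) fun _ x => .var (.vs (.vs x)))

/-- The renaming that inserts a fresh variable before the last one. -/
def Ren.skip {Γ : Ctx} {σ τ : Ty} : Ren (σ :: Γ) (σ :: τ :: Γ)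
  | _, .vz => .vz
  | _, .vs x => .vs (.vs x)

/-- The renaming of closed expressions into an arbitrary context. -/
def Ren.nil {Γ : Ctx} : Ren [] Γ := fun _ x => nomatch x

/-- `φ[t]`: the term `t` for the last variable of `φ`. -/
def Fm.inst {Γ : Ctx} {τ : Ty} (φ : Fm (τ :: Γ)) (t : Tm Γ τ) : Fm Γ :=
  φ.subst (Sub.single t)

/-! ## Defined connectives -/

def Fm.not {Γ : Ctx} (φ : Fm Γ) : Fm Γ := .imp φ .bot

def Fm.and {Γ : Ctx} (φ ψ : Fm Γ) : Fm Γ := .not (.imp φ (.not ψ))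

def Fm.or {Γ : Ctx} (φ ψ : Fm Γ) : Fm Γ := .imp (.not φ) ψ

def Fm.iff {Γ : Ctx} (φ ψ : Fm Γ) : Fm Γ := .and (.imp φ ψ) (.imp ψ φ)

def Fm.ex {Γ : Ctx} (σ : Ty) (φ : Fm (σ :: Γ)) : Fm Γ := .not (.all σ (.not φ))

/-- The universal closure. -/
def Fm.close : (Γ : Ctx) → Fm Γ → Sentence
  | [], φ => φ
  | σ :: Γ, φ => Fm.close Γ (.all σ φ)

/-- Quantifier-free formulas; variables of any type may occur. -/
def Fm.QF : {Γ : Ctx} → Fm Γ → Prop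
  | _, .bot => True
  | _, .eq _ _ => True
  | _, .lt _ _ => True
  | _, .imp φ ψ => φ.QF ∧ ψ.QF
  | _, .all _ _ => False

/-! ## Provability -/

/-- Classical natural deduction over the set `T` of axioms. `Prf T Δ φ` says that `φ` is derivable
from the assumptions `Δ`, where `φ` and `Δ` live in the same context of free variables. -/
inductive Prf (T : Set Sentence) : {Γ : Ctx} → List (Fm Γ) → Fm Γ → Prop
  | ax {Γ : Ctx} {Δ : List (Fm Γ)} {φ : Sentence} :
      φ ∈ T → Prf T Δ (φ.rename Ren.nil)
  | hyp {Γ : Ctx} {Δ : List (Fm Γ)} {φ : Fm Γ} : φ ∈ Δ → Prf T Δ φ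
  | impI {Γ : Ctx} {Δ : List (Fm Γ)} {φ ψ : Fm Γ} : Prf T (φ :: Δ) ψ → Prf T Δ (.imp φ ψ)
  | impE {Γ : Ctx} {Δ : List (Fm Γ)} {φ ψ : Fm Γ} :
      Prf T Δ (.imp φ ψ) → Prf T Δ φ → Prf T Δ ψ
  | raa {Γ : Ctx} {Δ : List (Fm Γ)} {φ : Fm Γ} : Prf T (.not φ :: Δ) .bot → Prf T Δ φ
  | allI {Γ : Ctx} {Δ : List (Fm Γ)} {σ : Ty} {φ : Fm (σ :: Γ)} :
      Prf T (Δ.map Fm.wk) φ → Prf T Δ (.all σ φ)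
  | allE {Γ : Ctx} {Δ : List (Fm Γ)} {σ : Ty} {φ : Fm (σ :: Γ)} (t : Tm Γ σ) :
      Prf T Δ (.all σ φ) → Prf T Δ (φ.inst t)

/-- The theory with the axioms `T` proves the sentence `φ`. -/
def Proves (T : Set Sentence) (φ : Sentence) : Prop := Prf T [] φ

/-! ## Notation for terms -/

abbrev v0 {Γ : Ctx} {σ : Ty} : Tm (σ :: Γ) σ := .var .vz

abbrev v1 {Γ : Ctx} {σ τ : Ty} : Tm (τ :: σ :: Γ) σ := .var (.vs .vz)

abbrev v2 {Γ : Ctx} {σ τ ρ : Ty} : Tm (ρ :: τ :: σ :: Γ) σ := .var (.vs (.vs .vz))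

def zero {Γ : Ctx} : Tm Γ .nat := .con .zero

def one {Γ : Ctx} : Tm Γ .nat := .con .one

def add {Γ : Ctx} (s t : Tm Γ .nat) : Tm Γ .nat := .app (.app (.con .add) s) t

def mul {Γ : Ctx} (s t : Tm Γ .nat) : Tm Γ .nat := .app (.app (.con .mul) s) t

def succ {Γ : Ctx} (t : Tm Γ .nat) : Tm Γ .nat := add t one

def two {Γ : Ctx} : Tm Γ .nat := succ one

/-- `s ≤ t` for numbers. -/
def le {Γ : Ctx} (s t : Tm Γ .nat) : Fm Γ := .not (.lt t s)

/-- Equality at an arbitrary type, defined pointwise from equality of numbers. -/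
def eqT : {Γ : Ctx} → (σ : Ty) → Tm Γ σ → Tm Γ σ → Fm Γ
  | _, .nat, s, t => .eq s t
  | _, .arr σ τ, s, t => .all σ (eqT τ (.app s.wk v0) (.app t.wk v0))

/-- `λx. x` and `λx. y` for a variable `y` other than `x`, from the combinators. -/
def Var.lam {Γ : Ctx} {σ : Ty} : {τ : Ty} → Var (σ :: Γ) τ → Tm Γ (.arr σ τ)
  | _, .vz => .app (.app (.con (.s σ (.arr σ σ) σ)) (.con (.k σ (.arr σ σ)))) (.con (.k σ σ))
  | τ, .vs y => .app (.con (.k τ σ)) (.var y)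

/-- `λ`-abstraction of the last variable, from the combinators. -/
def Tm.lam {Γ : Ctx} {σ : Ty} : {τ : Ty} → Tm (σ :: Γ) τ → Tm Γ (.arr σ τ)
  | _, .var x => x.lam
  | τ, .con c => .app (.con (.k τ σ)) (.con c)
  | τ, .app (σ := ρ) s t => .app (.app (.con (.s σ ρ τ)) s.lam) t.lam

/-! ## The base theory -/

/-- The axioms of `RCA₀^ω`. -/
inductive RCAAx : Sentence → Prop
  -- equality of numbers
  | eq_refl : RCAAx (.close [.nat] (.eq v0 v0))
  | eq_symm : RCAAx (.close [.nat, .nat] (.imp (.eq v0 v1) (.eq v1 v0)))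
  | eq_trans : RCAAx (.close [.nat, .nat, .nat] (.imp (.eq v0 v1) (.imp (.eq v1 v2) (.eq v0 v2))))
  | lt_congr_left : RCAAx (.close [.nat, .nat, .nat]
      (.imp (.eq v0 v1) (.imp (.lt v0 v2) (.lt v1 v2))))
  | lt_congr_right : RCAAx (.close [.nat, .nat, .nat]
      (.imp (.eq v0 v1) (.imp (.lt v2 v0) (.lt v2 v1))))
  -- the numbers form a (discretely) ordered commutative semi-ring
  | add_zero : RCAAx (.close [.nat] (.eq (add v0 zero) v0))
  | add_comm : RCAAx (.close [.nat, .nat] (.eq (add v0 v1) (add v1 v0)))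
  | add_assoc : RCAAx (.close [.nat, .nat, .nat]
      (.eq (add (add v0 v1) v2) (add v0 (add v1 v2))))
  | mul_zero : RCAAx (.close [.nat] (.eq (mul v0 zero) zero))
  | mul_one : RCAAx (.close [.nat] (.eq (mul v0 one) v0))
  | mul_comm : RCAAx (.close [.nat, .nat] (.eq (mul v0 v1) (mul v1 v0)))
  | mul_assoc : RCAAx (.close [.nat, .nat, .nat]
      (.eq (mul (mul v0 v1) v2) (mul v0 (mul v1 v2))))
  | mul_add : RCAAx (.close [.nat, .nat, .nat]
      (.eq (mul v0 (add v1 v2)) (add (mul v0 v1) (mul v0 v2))))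
  | lt_irrefl : RCAAx (.close [.nat] (.not (.lt v0 v0)))
  | lt_trans : RCAAx (.close [.nat, .nat, .nat] (.imp (.lt v0 v1) (.imp (.lt v1 v2) (.lt v0 v2))))
  | lt_total : RCAAx (.close [.nat, .nat] (.or (.lt v0 v1) (.or (.eq v0 v1) (.lt v1 v0))))
  | add_lt_add : RCAAx (.close [.nat, .nat, .nat]
      (.imp (.lt v0 v1) (.lt (add v0 v2) (add v1 v2))))
  | mul_lt_mul : RCAAx (.close [.nat, .nat, .nat]
      (.imp (.lt zero v2) (.imp (.lt v0 v1) (.lt (mul v0 v2) (mul v1 v2)))))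
  | not_lt_zero : RCAAx (.close [.nat] (.not (.lt v0 zero)))
  | lt_succ : RCAAx (.close [.nat, .nat] (.iff (.lt v0 (succ v1)) (.or (.lt v0 v1) (.eq v0 v1))))
  -- the combinators
  | k (σ τ : Ty) : RCAAx (.close [σ, τ] (eqT σ (.app (.app (.con (.k σ τ)) v0) v1) v0))
  | s (ρ σ τ : Ty) : RCAAx (.close [ρ, .arr ρ σ, .arr ρ (.arr σ τ)]
      (eqT τ (.app (.app (.app (.con (.s ρ σ τ)) v2) v1) v0) (.app (.app v2 v0) (.app v1 v0))))
  -- primitive recursion: `R₀(f, m, 0) = m` and `R₀(f, m, n + 1) = f(n, R₀(f, m, n))`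
  | rec_zero : RCAAx (.close [.nat, .arr .nat .one]
      (.eq (.app (.app (.app (.con (.recursor .nat)) v1) v0) zero) v0))
  | rec_succ : RCAAx (.close [.nat, .nat, .arr .nat .one]
      (.eq (.app (.app (.app (.con (.recursor .nat)) v2) v1) (succ v0))
        (.app (.app v2 v0) (.app (.app (.app (.con (.recursor .nat)) v2) v1) v0))))
  -- extensionality
  | ext (ρ τ : Ty) : RCAAx (.close [ρ, ρ, .arr ρ τ]
      (.imp (eqT ρ v0 v1) (eqT τ (.app v2 v0) (.app v2 v1))))
  -- induction for quantifier-free `A(n)`; `A(n + 1)` is `A` with `n + 1` for `n`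
  | ind {Γ : Ctx} (A : Fm (.nat :: Γ)) : A.QF → RCAAx (.close Γ
      (.imp (A.inst zero)
        (.imp (.all .nat (.imp A (A.subst Sub.next)))
          (.all .nat A))))
  -- choice for quantifier-free `A(x, y)`, where `x` has type `1` and `y` has type `0`;
  -- the conclusion is `∃ Y, ∀ x, A(x, Y(x))`
  | qfac {Γ : Ctx} (A : Fm (.nat :: .one :: Γ)) : A.QF → RCAAx (.close Γ
      (.imp (.all .one (.ex .nat A))
        (.ex .two (.all .one (A.subst Sub.choice)))))

/-- The theory `RCA₀^ω`. -/
def RCA : Set Sentence := {φ | RCAAx φ}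

/-- The sentence `(μ²)`: there is `μ` such that for all `f`, if `f` has a zero then `μ(f)` is
its least zero, and if `f` has no zero then `μ(f) = 0`. -/
def muTwo : Sentence :=
  .ex .two (.all .one (.and
    (.imp (.ex .nat (.eq (.app v1 v0) zero))
      (.and (.eq (.app v0 (.app v1 v0)) zero)
        (.all .nat (.imp (.lt v0 (.app v2 v1)) (.not (.eq (.app v1 v0) zero))))))
    (.imp (.all .nat (.not (.eq (.app v1 v0) zero))) (.eq (.app v1 v0) zero))))

/-- The theory `ACA₀^ω`, that is, `RCA₀^ω + (μ²)`. -/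
def ACAomega : Set Sentence := RCA ∪ {muTwo}

/-! ## Primitive recursive functions as terms -/

/-- The value at `n` of the function `g` with `g(0) = base` and `g(i + 1) = step`, where in `step`
the variable `v1` stands for `i` and `v0` for `g(i)`. -/
def primRec {Γ : Ctx} (base : Tm Γ .nat) (step : Tm (.nat :: .nat :: Γ) .nat) (n : Tm Γ .nat) :
    Tm Γ .nat :=
  .app (.app (.app (.con (.recursor .nat)) step.lam.lam) base) n

def pred {Γ : Ctx} (n : Tm Γ .nat) : Tm Γ .nat := primRec zero v1 n

/-- Truncated subtraction. -/
def monus {Γ : Ctx} (s t : Tm Γ .nat) : Tm Γ .nat := primRec s (pred v0) t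

/-- `|s - t|`. -/
def absDiff {Γ : Ctx} (s t : Tm Γ .nat) : Tm Γ .nat := add (monus s t) (monus t s)

/-- `1` if `s < t`, and `0` otherwise. -/
def ltInd {Γ : Ctx} (s t : Tm Γ .nat) : Tm Γ .nat := monus one (monus one (monus t s))

/-- `2 ^ n`. -/
def pow2 {Γ : Ctx} (n : Tm Γ .nat) : Tm Γ .nat := primRec one (mul two v0) n

/-- `n` modulo `2`. -/
def parity {Γ : Ctx} (n : Tm Γ .nat) : Tm Γ .nat := primRec zero (monus one v0) n

/-- `n / 2`, rounded down. -/
def half {Γ : Ctx} (n : Tm Γ .nat) : Tm Γ .nat := primRec zero (add v0 (parity v1)) n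

/-- The triangular number `n (n + 1) / 2`. -/
def tri {Γ : Ctx} (n : Tm Γ .nat) : Tm Γ .nat := primRec zero (add v0 (succ v1)) n

/-- The greatest `r` with `tri r ≤ z`. -/
def triRoot {Γ : Ctx} (z : Tm Γ .nat) : Tm Γ .nat :=
  primRec zero (add v0 (ltInd (tri (succ v0)) (succ (succ v1)))) z

/-- The Cantor pairing function. -/
def pair {Γ : Ctx} (a b : Tm Γ .nat) : Tm Γ .nat := add (tri (add a b)) b

def unpairRight {Γ : Ctx} (z : Tm Γ .nat) : Tm Γ .nat := monus z (tri (triRoot z))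

def unpairLeft {Γ : Ctx} (z : Tm Γ .nat) : Tm Γ .nat := monus (triRoot z) (unpairRight z)

/-! ## Rational numbers

The number `pair a b` codes the rational `(a / 2) / (b + 1)` if `a` is even, and
`-((a + 1) / 2) / (b + 1)` if `a` is odd. The value of the code `q` is thus
`(posNum q - negNum q) / den q`. -/

def posNum {Γ : Ctx} (q : Tm Γ .nat) : Tm Γ .nat :=
  mul (monus one (parity (unpairLeft q))) (half (unpairLeft q))

def negNum {Γ : Ctx} (q : Tm Γ .nat) : Tm Γ .nat :=
  mul (parity (unpairLeft q)) (succ (half (unpairLeft q)))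

def den {Γ : Ctx} (q : Tm Γ .nat) : Tm Γ .nat := succ (unpairRight q)

/-- The common denominator `den q * den r` of `q` and `r`. -/
def cden {Γ : Ctx} (q r : Tm Γ .nat) : Tm Γ .nat := mul (den q) (den r)

/-- The first of two numbers `a`, `b` with `q - r = (a - b) / cden q r`. -/
def diffPos {Γ : Ctx} (q r : Tm Γ .nat) : Tm Γ .nat :=
  add (mul (posNum q) (den r)) (mul (negNum r) (den q))

/-- The second of two numbers `a`, `b` with `q - r = (a - b) / cden q r`. -/
def diffNeg {Γ : Ctx} (q r : Tm Γ .nat) : Tm Γ .nat :=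
  add (mul (negNum q) (den r)) (mul (posNum r) (den q))

/-- The numerator of `|q - r|` over `cden q r`. -/
def distNum {Γ : Ctx} (q r : Tm Γ .nat) : Tm Γ .nat := absDiff (diffPos q r) (diffNeg q r)

/-! ## Real numbers

Every `x` of type `1` represents a real number, namely the limit of the sequence of rationals
`hat x 0`, `hat x 1`, …, in which consecutive terms satisfy `|hat x n - hat x (n + 1)| < 2 ^ (-n-1)`
and which is `x` itself if `x` has this property. -/

/-- `n` if `|x(k) - x(k + 1)| < 2 ^ (-k-1)` for all `k < n`; otherwise the least `k < n` for which
this fails. -/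
def hatIndex {Γ : Ctx} (x : Tm Γ .one) (n : Tm Γ .nat) : Tm Γ .nat :=
  primRec zero
    (add v0 (mul (monus one (monus v1 v0))
      (ltInd (mul (distNum (.app x.wk.wk v1) (.app x.wk.wk (succ v1))) (pow2 (succ v1)))
        (cden (.app x.wk.wk v1) (.app x.wk.wk (succ v1))))))
    n

/-- The `n`-th rational approximation of the real number represented by `x`. -/
def hat {Γ : Ctx} (x : Tm Γ .one) (n : Tm Γ .nat) : Tm Γ .nat := .app x (hatIndex x n)

/-- `x = y` for reals: `|hat x n - hat y n| ≤ 2 ^ (-n+1)` for all `n`. -/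
def realEq {Γ : Ctx} (x y : Tm Γ .one) : Fm Γ :=
  .all .nat (le (mul (distNum (hat x.wk v0) (hat y.wk v0)) (pow2 v0))
    (mul two (cden (hat x.wk v0) (hat y.wk v0))))

/-- `x < y` for reals: `hat y n - hat x n > 2 ^ (-n+1)` for some `n`. -/
def realLt {Γ : Ctx} (x y : Tm Γ .one) : Fm Γ :=
  .ex .nat (.lt
    (add (mul (diffNeg (hat y.wk v0) (hat x.wk v0)) (pow2 v0))
      (mul two (cden (hat y.wk v0) (hat x.wk v0))))
    (mul (diffPos (hat y.wk v0) (hat x.wk v0)) (pow2 v0)))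

/-- `|x - y| < 2 ^ (-k)` for reals: `|hat x n - hat y n| + 2 ^ (-n+1) < 2 ^ (-k)` for some `n`. -/
def realNear {Γ : Ctx} (x y : Tm Γ .one) (k : Tm Γ .nat) : Fm Γ :=
  .ex .nat (.lt
    (mul (add (mul (distNum (hat x.wk v0) (hat y.wk v0)) (pow2 v0))
      (mul two (cden (hat x.wk v0) (hat y.wk v0)))) (pow2 k.wk))
    (mul (cden (hat x.wk v0) (hat y.wk v0)) (pow2 v0)))

/-- The real number `0`. -/
def realZero {Γ : Ctx} : Tm Γ .one := (pair zero zero).lam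

/-- The real number `1`. -/
def realOne {Γ : Ctx} : Tm Γ .one := (pair two zero).lam

/-- `x ∈ [0,1]`. -/
def inUnit {Γ : Ctx} (x : Tm Γ .one) : Fm Γ :=
  .and (.not (realLt x realZero)) (.not (realLt realOne x))

/-- `f : [0,1] → ℝ`: equal reals in `[0,1]` have equal images. -/
def isFunction {Γ : Ctx} (f : Tm Γ (.arr .one .one)) : Fm Γ :=
  .all .one (.all .one (.imp (inUnit v1) (.imp (inUnit v0)
    (.imp (realEq v1 v0) (realEq (.app f.wk.wk v1) (.app f.wk.wk v0))))))

/-- `ε`-`δ`-continuity on `[0,1]`: for all `x ∈ [0,1]` and all `k` there is `N` such that for all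
`y ∈ [0,1]`, if `|x - y| < 2 ^ (-N)` then `|f(x) - f(y)| < 2 ^ (-k)`. -/
def isContinuous {Γ : Ctx} (f : Tm Γ (.arr .one .one)) : Fm Γ :=
  .all .one (.imp (inUnit v0) (.all .nat (.ex .nat (.all .one (.imp (inUnit v0)
    (.imp (realNear (.var (.vs (.vs (.vs .vz)))) v0 v1)
      (realNear (.app f.wk.wk.wk.wk (.var (.vs (.vs (.vs .vz))))) (.app f.wk.wk.wk.wk v0) v2)))))))

/-- The sentence `(∀ f : [0,1] → ℝ) A(f)`. -/
def forallFunctions (A : Fm [.arr .one .one]) : Sentence :=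
  .all (.arr .one .one) (.imp (isFunction v0) A)

/-- The sentence `(∀ f ∈ C([0,1])) A(f)`. -/
def forallContinuous (A : Fm [.arr .one .one]) : Sentence :=
  .all (.arr .one .one) (.imp (.and (isFunction v0) (isContinuous v0)) A)

/-! ## Weak König's lemma and arithmetical comprehension

A finite binary sequence is coded by the positive number whose binary expansion is a leading `1`
followed by the sequence. So the sequences of length `n` have the codes `s` with
`2 ^ n ≤ s < 2 ^ (n + 1)`, and `s` is extended to `2 s` and to `2 s + 1`. -/

/-- The code of the initial segment of length `n` of the binary sequence `b`. -/
def initSeg {Γ : Ctx} (b : Tm Γ .one) (n : Tm Γ .nat) : Tm Γ .nat :=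
  primRec one (add (mul two v0) (.app b.wk.wk v1)) n

/-- `T` is a binary tree; the sequence with the code `s` belongs to `T` if `T(s) = 0`. -/
def isTree {Γ : Ctx} (T : Tm Γ .one) : Fm Γ :=
  .all .nat (.imp (.lt zero v0)
    (.imp (.or (.eq (.app T.wk (mul two v0)) zero) (.eq (.app T.wk (succ (mul two v0))) zero))
      (.eq (.app T.wk v0) zero)))

/-- `T` contains sequences of every length. -/
def isInfinite {Γ : Ctx} (T : Tm Γ .one) : Fm Γ :=
  .all .nat (.ex .nat (.and (le (pow2 v1) v0) (.and (.lt v0 (pow2 (succ v1)))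
    (.eq (.app T.wk.wk v0) zero))))

/-- Weak König's lemma: every infinite binary tree has a path. -/
def WKL : Sentence :=
  .all .one (.imp (isTree v0) (.imp (isInfinite v0)
    (.ex .one (.all .nat (.and (le (.app v1 v0) one) (.eq (.app v2 (initSeg v1 v0)) zero))))))

/-- The theory `RCA₀^ω + WKL`. -/
def RCAWKL : Set Sentence := RCA ∪ {WKL}

/-- The numerical terms of second-order arithmetic: they are built from number variables, `0`, `1`,
`+`, `×` and the application of function variables. -/
inductive ArithTm {Γ : Ctx} : Tm Γ .nat → Prop
  | var (x : Var Γ .nat) : ArithTm (.var x)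
  | zero : ArithTm zero
  | one : ArithTm one
  | add {s t : Tm Γ .nat} : ArithTm s → ArithTm t → ArithTm (add s t)
  | mul {s t : Tm Γ .nat} : ArithTm s → ArithTm t → ArithTm (mul s t)
  | app (f : Var Γ .one) {t : Tm Γ .nat} : ArithTm t → ArithTm (.app (.var f) t)

/-- The arithmetical formulas of second-order arithmetic: only numbers are quantified over. -/
inductive Arith : {Γ : Ctx} → Fm Γ → Prop
  | bot {Γ : Ctx} : Arith (.bot : Fm Γ)
  | eq {Γ : Ctx} {s t : Tm Γ .nat} : ArithTm s → ArithTm t → Arith (.eq s t)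
  | lt {Γ : Ctx} {s t : Tm Γ .nat} : ArithTm s → ArithTm t → Arith (.lt s t)
  | imp {Γ : Ctx} {φ ψ : Fm Γ} : Arith φ → Arith ψ → Arith (.imp φ ψ)
  | all {Γ : Ctx} {φ : Fm (.nat :: Γ)} : Arith φ → Arith (.all .nat φ)

/-- Arithmetical comprehension, which gives `ACA₀` over the base theory: for every arithmetical
formula `A(n)`, possibly with number and function parameters, there is `g` of type `1` such that
`g(n) = 0 ↔ A(n)` for all `n`. -/
inductive ACA : Sentence → Prop
  | compr {Γ : Ctx} (A : Fm (.nat :: Γ)) : Arith A → ACA (.close Γ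
      (.ex .one (.all .nat (.iff (.eq (.app v1 v0) zero) (A.rename Ren.skip)))))

end HOA

/-! The first claim is an argument by excluded middle inside an arbitrary model of `RCA₀^ω + WKL`.
If (μ²) holds there, the model satisfies `ACA₀^ω` and hypothesis (a′) applies. If (μ²) fails, every
f : [0,1] → ℝ of the model is continuous, and hypothesis (b′) covers all of them. A Henkin
completeness theorem (`completeness`), sharpened to models whose equality is identity
(`completeness_normal`), turns this into provability.

That a discontinuous f yields μ is Grilliot's trick (`models_muTwo_of_discontinuous`,
`isCont_of_not_muTwo`). If f is discontinuous at x, quantifier-free choice gives rationals s(n) that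
converge fast to x and whose values under f stay away from f(x). For g of type 1 let y follow x
until the least zero i of g shows up, and stay at s(i) from then on. So y = x if g has no zero, and
y = s(i) otherwise, and one rational approximation of f(y) decides whether g has a zero.
Quantifier-free choice applied to "f(y) is near f(x), or g(n) = 0" gives a functional that finds
zeros, hence μ. The model may be nonstandard: inequalities are handled in the ordered field of
fractions of its numbers, and every induction must be over a quantifier-free formula.

For the second claim it is enough that `RCA₀^ω + WKL` fails to prove some instance of arithmetical
comprehension, because it proves the principle itself. By cone avoidance, an infinite binary tree in
a countable Turing ideal that omits K has a path whose adjunction still omits K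
(`exists_path_avoiding`). Iteration, from the computable functions and a K that decides a
non-computable range, gives an ideal with paths through all its infinite trees in which that range
has no characteristic function (`exists_ideal_hasPath`). This ideal is the type 1 part of a model
with standard numbers: a functional is admitted if it preserves distinguished sequences, and those
of type 0 are the members of the ideal. Quantifier-free truth along distinguished sequences stays in
the ideal, so taking least witnesses validates quantifier-free choice (`herStr_choice`). -/

namespace HOA

/-! ## Structures for the language -/

/-- A many-sorted structure for the language, possibly with a non-standard equality of numbers. -/
structure Str where
  D : Ty → Type
  app {σ τ : Ty} : D (.arr σ τ) → D σ → D τ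
  con {σ : Ty} : Con σ → D σ
  eq : D .nat → D .nat → Prop
  lt : D .nat → D .nat → Prop

/-- Assignments of values to the variables of a context. -/
abbrev Env (M : Str) (Γ : Ctx) : Type := ∀ σ : Ty, Var Γ σ → M.D σ

namespace Env

variable {M : Str}

def nil : Env M [] := fun _ x => nomatch x

def cons {Γ : Ctx} {τ : Ty} (d : M.D τ) (ρ : Env M Γ) : Env M (τ :: Γ)
  | _, .vz => d
  | _, .vs x => ρ _ x

@[simp] theorem cons_vz {Γ : Ctx} {τ : Ty} (d : M.D τ) (ρ : Env M Γ) : cons d ρ τ .vz = d := rfl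

@[simp] theorem cons_vs {Γ : Ctx} {σ τ : Ty} (d : M.D τ) (ρ : Env M Γ) (x : Var Γ σ) :
    cons d ρ σ (.vs x) = ρ σ x := rfl

theorem ext_nil (ρ ρ' : Env M []) : ρ = ρ' := by
  funext σ x; cases x

theorem eq_cons {Γ : Ctx} {τ : Ty} (ρ : Env M (τ :: Γ)) :
    ρ = cons (ρ τ .vz) (fun σ x => ρ σ (.vs x)) := by
  funext σ x; cases x <;> rfl

end Env

/-- The value of a term. -/
def Tm.eval {M : Str} {Γ : Ctx} (ρ : Env M Γ) : {σ : Ty} → Tm Γ σ → M.D σ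
  | _, .var x => ρ _ x
  | _, .con c => M.con c
  | _, .app s t => M.app (s.eval ρ) (t.eval ρ)

/-- Satisfaction of a formula. -/
def Fm.sat {M : Str} : {Γ : Ctx} → Env M Γ → Fm Γ → Prop
  | _, _, .bot => False
  | _, ρ, .eq s t => M.eq (s.eval ρ) (t.eval ρ)
  | _, ρ, .lt s t => M.lt (s.eval ρ) (t.eval ρ)
  | _, ρ, .imp φ ψ => φ.sat ρ → ψ.sat ρ
  | _, ρ, .all σ φ => ∀ d : M.D σ, φ.sat (Env.cons d ρ)

/-- Truth of a sentence. -/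
def Str.Models (M : Str) (φ : Sentence) : Prop := φ.sat (M := M) Env.nil

section Satisfaction

variable {M : Str} {Γ Δ : Ctx}

@[simp] theorem Tm.eval_var (ρ : Env M Γ) {σ : Ty} (x : Var Γ σ) :
    (Tm.var x).eval ρ = ρ σ x := rfl

@[simp] theorem Tm.eval_con (ρ : Env M Γ) {σ : Ty} (c : Con σ) :
    (Tm.con c : Tm Γ σ).eval ρ = M.con c := rfl

@[simp] theorem Tm.eval_app (ρ : Env M Γ) {σ τ : Ty} (s : Tm Γ (.arr σ τ)) (t : Tm Γ σ) :
    (Tm.app s t).eval ρ = M.app (s.eval ρ) (t.eval ρ) := rfl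

theorem Tm.eval_rename (r : Ren Γ Δ) (ρ : Env M Δ) {σ : Ty} (t : Tm Γ σ) :
    (t.rename r).eval ρ = t.eval (fun σ x => ρ σ (r σ x)) := by
  induction t with
  | var x => rfl
  | con c => rfl
  | app s t hs ht => simp only [Tm.rename, Tm.eval_app, hs, ht]

@[simp] theorem Tm.eval_wk {τ : Ty} (d : M.D τ) (ρ : Env M Γ) {σ : Ty} (t : Tm Γ σ) :
    t.wk.eval (Env.cons d ρ) = t.eval ρ := Tm.eval_rename _ _ _

theorem Tm.eval_subst (s : Sub Γ Δ) (ρ : Env M Δ) {σ : Ty} (t : Tm Γ σ) :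
    (t.subst s).eval ρ = t.eval (fun σ x => (s σ x).eval ρ) := by
  induction t with
  | var x => rfl
  | con c => rfl
  | app s t hs ht => simp only [Tm.subst, Tm.eval_app, hs, ht]

theorem Fm.sat_rename (φ : Fm Γ) {Δ : Ctx} (r : Ren Γ Δ) (ρ : Env M Δ) :
    (φ.rename r).sat ρ ↔ φ.sat (fun σ x => ρ σ (r σ x)) := by
  induction φ generalizing Δ with
  | bot => rfl
  | eq s t => simp only [Fm.rename, Fm.sat, Tm.eval_rename]
  | lt s t => simp only [Fm.rename, Fm.sat, Tm.eval_rename]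
  | imp φ ψ h1 h2 => simp only [Fm.rename, Fm.sat, h1, h2]
  | all σ φ ih =>
    simp only [Fm.rename, Fm.sat, ih]
    refine forall_congr' fun d => iff_of_eq (congrArg (fun ρ => φ.sat ρ) ?_)
    funext τ x
    cases x <;> rfl

theorem Fm.sat_wk {τ : Ty} (d : M.D τ) (ρ : Env M Γ) (φ : Fm Γ) :
    φ.wk.sat (Env.cons d ρ) ↔ φ.sat ρ := Fm.sat_rename _ _ _

theorem Fm.sat_subst (φ : Fm Γ) {Δ : Ctx} (s : Sub Γ Δ) (ρ : Env M Δ) :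
    (φ.subst s).sat ρ ↔ φ.sat (fun σ x => (s σ x).eval ρ) := by
  induction φ generalizing Δ with
  | bot => rfl
  | eq t u => simp only [Fm.subst, Fm.sat, Tm.eval_subst]
  | lt t u => simp only [Fm.subst, Fm.sat, Tm.eval_subst]
  | imp φ ψ h1 h2 => simp only [Fm.subst, Fm.sat, h1, h2]
  | all σ φ ih =>
    simp only [Fm.subst, Fm.sat, ih]
    refine forall_congr' fun d => iff_of_eq (congrArg (fun ρ => φ.sat ρ) ?_)
    funext τ x
    cases x with
    | vz => rfl
    | vs x => exact Tm.eval_wk _ _ _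

theorem Fm.sat_inst {τ : Ty} (φ : Fm (τ :: Γ)) (t : Tm Γ τ) (ρ : Env M Γ) :
    (φ.inst t).sat ρ ↔ φ.sat (Env.cons (t.eval ρ) ρ) := by
  refine (Fm.sat_subst _ _ _).trans (iff_of_eq (congrArg (fun ρ => φ.sat ρ) ?_))
  funext τ x
  cases x <;> rfl

@[simp] theorem Fm.sat_bot (ρ : Env M Γ) : (Fm.bot : Fm Γ).sat ρ ↔ False := Iff.rfl

@[simp] theorem Fm.sat_eq (ρ : Env M Γ) (s t : Tm Γ .nat) :
    (Fm.eq s t).sat ρ ↔ M.eq (s.eval ρ) (t.eval ρ) := Iff.rfl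

@[simp] theorem Fm.sat_lt (ρ : Env M Γ) (s t : Tm Γ .nat) :
    (Fm.lt s t).sat ρ ↔ M.lt (s.eval ρ) (t.eval ρ) := Iff.rfl

@[simp] theorem Fm.sat_imp (ρ : Env M Γ) (φ ψ : Fm Γ) :
    (Fm.imp φ ψ).sat ρ ↔ (φ.sat ρ → ψ.sat ρ) := Iff.rfl

@[simp] theorem Fm.sat_all (ρ : Env M Γ) (σ : Ty) (φ : Fm (σ :: Γ)) :
    (Fm.all σ φ).sat ρ ↔ ∀ d : M.D σ, φ.sat (Env.cons d ρ) := Iff.rfl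

@[simp] theorem Fm.sat_not (ρ : Env M Γ) (φ : Fm Γ) : φ.not.sat ρ ↔ ¬ φ.sat ρ := Iff.rfl

@[simp] theorem Fm.sat_and (ρ : Env M Γ) (φ ψ : Fm Γ) :
    (φ.and ψ).sat ρ ↔ φ.sat ρ ∧ ψ.sat ρ := by
  simp [Fm.and]

@[simp] theorem Fm.sat_or (ρ : Env M Γ) (φ ψ : Fm Γ) :
    (φ.or ψ).sat ρ ↔ φ.sat ρ ∨ ψ.sat ρ := by
  simp [Fm.or, or_iff_not_imp_left]

@[simp] theorem Fm.sat_iff (ρ : Env M Γ) (φ ψ : Fm Γ) :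
    (φ.iff ψ).sat ρ ↔ (φ.sat ρ ↔ ψ.sat ρ) := by
  simp [Fm.iff, iff_def]

@[simp] theorem Fm.sat_ex (ρ : Env M Γ) (σ : Ty) (φ : Fm (σ :: Γ)) :
    (Fm.ex σ φ).sat ρ ↔ ∃ d : M.D σ, φ.sat (Env.cons d ρ) := by
  simp [Fm.ex]

theorem Fm.models_close : ∀ {Γ : Ctx} (φ : Fm Γ),
    M.Models (Fm.close Γ φ) ↔ ∀ ρ : Env M Γ, φ.sat ρ
  | [], φ => ⟨fun h ρ => Env.ext_nil Env.nil ρ ▸ h, fun h => h _⟩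
  | σ :: Γ, φ => by
    refine (Fm.models_close (Fm.all σ φ)).trans ⟨fun h ρ => ?_, fun h ρ d => h _⟩
    rw [Env.eq_cons ρ]
    exact h _ _

/-- Derivable formulas are true. -/
theorem Prf.sound {T : Set Sentence} (hT : ∀ φ ∈ T, M.Models φ) {Γ : Ctx} {Δ : List (Fm Γ)}
    {φ : Fm Γ} (h : Prf T Δ φ) : ∀ ρ : Env M Γ, (∀ ψ ∈ Δ, ψ.sat ρ) → φ.sat ρ := by
  induction h with
  | ax hφ =>
    intro ρ _
    refine (Fm.sat_rename _ _ _).2 ?_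
    rw [Env.ext_nil (M := M) (fun σ x => ρ σ (Ren.nil σ x)) Env.nil]
    exact hT _ hφ
  | hyp h => exact fun ρ hρ => hρ _ h
  | impI _ ih => exact fun ρ hρ h => ih ρ (by simpa using ⟨h, hρ⟩)
  | impE _ _ h1 h2 => exact fun ρ hρ => h1 ρ hρ (h2 ρ hρ)
  | raa _ ih =>
    intro ρ hρ
    by_contra h
    exact ih ρ (by simpa using ⟨h, hρ⟩)
  | allI _ ih =>
    intro ρ hρ d
    refine ih _ fun ψ hψ => ?_
    obtain ⟨χ, hχ, rfl⟩ := List.mem_map.1 hψ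
    exact (Fm.sat_wk _ _ _).2 (hρ χ hχ)
  | allE t _ ih => exact fun ρ hρ => (Fm.sat_inst _ _ _).2 (ih ρ hρ _)

theorem Proves.sound {T : Set Sentence} (hT : ∀ φ ∈ T, M.Models φ) {φ : Sentence}
    (h : Proves T φ) : M.Models φ :=
  Prf.sound hT h _ (by simp)

end Satisfaction

/-! ## Composition of renamings and substitutions -/

section Substitution

variable {Γ Δ Θ : Ctx}

theorem Tm.rename_rename (r : Ren Γ Δ) (r' : Ren Δ Θ) {σ : Ty} (t : Tm Γ σ) :
    (t.rename r).rename r' = t.rename fun σ x => r' σ (r σ x) := by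
  induction t with
  | var x => rfl
  | con c => rfl
  | app s t hs ht => simp only [Tm.rename, hs, ht]

theorem Tm.rename_subst (r : Ren Γ Δ) (s : Sub Δ Θ) {σ : Ty} (t : Tm Γ σ) :
    (t.rename r).subst s = t.subst fun σ x => s σ (r σ x) := by
  induction t with
  | var x => rfl
  | con c => rfl
  | app s t hs ht => simp only [Tm.rename, Tm.subst, hs, ht]

theorem Tm.subst_rename (s : Sub Γ Δ) (r : Ren Δ Θ) {σ : Ty} (t : Tm Γ σ) :
    (t.subst s).rename r = t.subst fun σ x => (s σ x).rename r := by
  induction t with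
  | var x => rfl
  | con c => rfl
  | app s t hs ht => simp only [Tm.rename, Tm.subst, hs, ht]

theorem Tm.subst_subst (s : Sub Γ Δ) (s' : Sub Δ Θ) {σ : Ty} (t : Tm Γ σ) :
    (t.subst s).subst s' = t.subst fun σ x => (s σ x).subst s' := by
  induction t with
  | var x => rfl
  | con c => rfl
  | app s t hs ht => simp only [Tm.subst, hs, ht]

theorem Tm.rename_id {σ : Ty} (t : Tm Γ σ) : t.rename (fun _ x => x) = t := by
  induction t with
  | var x => rfl
  | con c => rfl
  | app s t hs ht => simp only [Tm.rename, hs, ht]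

theorem Fm.rename_id (φ : Fm Γ) : φ.rename (fun _ x => x) = φ := by
  induction φ with
  | bot => rfl
  | eq s t => simp only [Fm.rename, Tm.rename_id]
  | lt s t => simp only [Fm.rename, Tm.rename_id]
  | imp φ ψ h1 h2 => simp only [Fm.rename, h1, h2]
  | all σ φ ih =>
    rw [Fm.rename]
    congr 1
    refine Eq.trans (congrArg (fun r => φ.rename r) ?_) ih
    funext τ x; cases x <;> rfl

theorem Fm.rename_rename (φ : Fm Γ) : ∀ {Δ Θ : Ctx} (r : Ren Γ Δ) (r' : Ren Δ Θ),
    (φ.rename r).rename r' = φ.rename fun σ x => r' σ (r σ x) := by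
  induction φ with
  | bot => intros; rfl
  | eq s t => intros; simp only [Fm.rename, Tm.rename_rename]
  | lt s t => intros; simp only [Fm.rename, Tm.rename_rename]
  | imp φ ψ h1 h2 => intros; simp only [Fm.rename, h1, h2]
  | all σ φ ih =>
    intro Δ Θ r r'
    simp only [Fm.rename, ih]
    congr 2
    funext τ x; cases x <;> rfl

theorem Fm.rename_subst (φ : Fm Γ) : ∀ {Δ Θ : Ctx} (r : Ren Γ Δ) (s : Sub Δ Θ),
    (φ.rename r).subst s = φ.subst fun σ x => s σ (r σ x) := by
  induction φ with
  | bot => intros; rfl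
  | eq s t => intros; simp only [Fm.rename, Fm.subst, Tm.rename_subst]
  | lt s t => intros; simp only [Fm.rename, Fm.subst, Tm.rename_subst]
  | imp φ ψ h1 h2 => intros; simp only [Fm.rename, Fm.subst, h1, h2]
  | all σ φ ih =>
    intro Δ Θ r s
    simp only [Fm.rename, Fm.subst, ih]
    congr 2
    funext τ x; cases x <;> rfl

theorem Fm.subst_rename (φ : Fm Γ) : ∀ {Δ Θ : Ctx} (s : Sub Γ Δ) (r : Ren Δ Θ),
    (φ.subst s).rename r = φ.subst fun σ x => (s σ x).rename r := by
  induction φ with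
  | bot => intros; rfl
  | eq s t => intros; simp only [Fm.rename, Fm.subst, Tm.subst_rename]
  | lt s t => intros; simp only [Fm.rename, Fm.subst, Tm.subst_rename]
  | imp φ ψ h1 h2 => intros; simp only [Fm.rename, Fm.subst, h1, h2]
  | all σ φ ih =>
    intro Δ Θ s r
    simp only [Fm.rename, Fm.subst, ih]
    congr 2
    funext τ x
    cases x with
    | vz => rfl
    | vs x => simp only [Sub.lift, Tm.wk, Tm.rename_rename]; rfl

theorem Fm.subst_subst (φ : Fm Γ) : ∀ {Δ Θ : Ctx} (s : Sub Γ Δ) (s' : Sub Δ Θ),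
    (φ.subst s).subst s' = φ.subst fun σ x => (s σ x).subst s' := by
  induction φ with
  | bot => intros; rfl
  | eq s t => intros; simp only [Fm.subst, Tm.subst_subst]
  | lt s t => intros; simp only [Fm.subst, Tm.subst_subst]
  | imp φ ψ h1 h2 => intros; simp only [Fm.subst, h1, h2]
  | all σ φ ih =>
    intro Δ Θ s s'
    simp only [Fm.subst, ih]
    congr 2
    funext τ x
    cases x with
    | vz => rfl
    | vs x => simp only [Sub.lift, Tm.wk, Tm.subst_rename, Tm.rename_subst]

theorem Tm.subst_var (r : Ren Γ Δ) {σ : Ty} (t : Tm Γ σ) :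
    t.subst (fun σ x => .var (r σ x)) = t.rename r := by
  induction t with
  | var x => rfl
  | con c => rfl
  | app s t hs ht => simp only [Tm.rename, Tm.subst, hs, ht]

theorem Fm.subst_var (φ : Fm Γ) : ∀ {Δ : Ctx} (r : Ren Γ Δ),
    φ.subst (fun σ x => .var (r σ x)) = φ.rename r := by
  induction φ with
  | bot => intros; rfl
  | eq s t => intros; simp only [Fm.rename, Fm.subst, Tm.subst_var]
  | lt s t => intros; simp only [Fm.rename, Fm.subst, Tm.subst_var]
  | imp φ ψ h1 h2 => intros; simp only [Fm.rename, Fm.subst, h1, h2]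
  | all σ φ ih =>
    intro Δ r
    simp only [Fm.rename, Fm.subst, ← ih]
    congr 2
    funext τ x; cases x <;> rfl

/-- Renaming under the last variable and then instantiating it. -/
theorem Fm.rename_lift_inst {τ : Ty} (φ : Fm (τ :: Γ)) (r : Ren Γ Δ) (t : Tm Δ τ) :
    (φ.rename (r.lift τ)).inst t = φ.subst (Sub.cons t fun σ x => .var (r σ x)) := by
  rw [Fm.inst, Fm.rename_subst]
  congr 1
  funext σ x; cases x <;> rfl

end Substitution

end HOA

namespace HOA

/-! ## Countability of the language -/

def Ty.code : Ty → ℕ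
  | .nat => 0
  | .arr σ τ => Nat.pair σ.code τ.code + 1

theorem Ty.code_injective : Function.Injective Ty.code := by
  intro σ
  induction σ with
  | nat => intro τ h; cases τ <;> simp_all [Ty.code]
  | arr σ τ h1 h2 =>
    intro ρ h
    cases ρ with
    | nat => simp [Ty.code] at h
    | arr σ' τ' =>
      simp only [Ty.code, Nat.add_right_cancel_iff, Nat.pair_eq_pair] at h
      rw [h1 h.1, h2 h.2]

instance : Countable Ty := Ty.code_injective.countable

def Con.code : {σ : Ty} → Con σ → ℕ
  | _, .zero => Nat.pair 0 0
  | _, .one => Nat.pair 1 0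
  | _, .add => Nat.pair 2 0
  | _, .mul => Nat.pair 3 0
  | _, .k σ τ => Nat.pair 4 (Nat.pair σ.code τ.code)
  | _, .s ρ σ τ => Nat.pair 5 (Nat.pair ρ.code (Nat.pair σ.code τ.code))
  | _, .recursor σ => Nat.pair 6 σ.code

theorem Con.code_injective {σ τ : Ty} (c : Con σ) (d : Con τ) (h : c.code = d.code) :
    (⟨σ, c⟩ : Σ σ, Con σ) = ⟨τ, d⟩ := by
  cases c <;> cases d <;>
    simp_all [Con.code, Nat.pair_eq_pair, Ty.code_injective.eq_iff]
  · obtain ⟨rfl, rfl⟩ := h; rfl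
  · obtain ⟨rfl, rfl, rfl⟩ := h; rfl
  · cases h; rfl

def Var.code : {Γ : Ctx} → {σ : Ty} → Var Γ σ → ℕ
  | _, _, .vz => 0
  | _, _, .vs x => x.code + 1

theorem Var.code_injective {Γ : Ctx} {σ τ : Ty} (x : Var Γ σ) (y : Var Γ τ)
    (h : x.code = y.code) : (⟨σ, x⟩ : Σ σ, Var Γ σ) = ⟨τ, y⟩ := by
  induction x with
  | vz => cases y <;> simp_all [Var.code]
  | vs x ih =>
    cases y with
    | vz => simp [Var.code] at h
    | vs y =>
      have := ih y (by simpa [Var.code] using h)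
      cases this
      rfl

def Tm.code {Γ : Ctx} : {σ : Ty} → Tm Γ σ → ℕ
  | _, .var x => Nat.pair 0 x.code
  | _, .con c => Nat.pair 1 c.code
  | _, .app s t => Nat.pair 2 (Nat.pair s.code t.code)

/-- The argument type of an application is invisible in the type of the whole term, so the code must
determine the type as well; hence the equality of dependent pairs. -/
theorem Tm.code_injective {Γ : Ctx} {σ τ : Ty} (s : Tm Γ σ) (t : Tm Γ τ)
    (h : s.code = t.code) : (⟨σ, s⟩ : Σ σ, Tm Γ σ) = ⟨τ, t⟩ := by
  induction s generalizing τ with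
  | var x =>
    cases t with
    | var y =>
      cases Var.code_injective x y (by simpa [Tm.code, Nat.pair_eq_pair] using h)
      rfl
    | con => simp [Tm.code, Nat.pair_eq_pair] at h
    | app => simp [Tm.code, Nat.pair_eq_pair] at h
  | con c =>
    cases t with
    | con d =>
      cases Con.code_injective c d (by simpa [Tm.code, Nat.pair_eq_pair] using h)
      rfl
    | var => simp [Tm.code, Nat.pair_eq_pair] at h
    | app => simp [Tm.code, Nat.pair_eq_pair] at h
  | app s t h1 h2 =>
    cases t with
    | app s' t' =>
      simp only [Tm.code, Nat.pair_eq_pair, true_and] at h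
      cases h1 s' h.1
      cases h2 t' h.2
      rfl
    | var => simp [Tm.code, Nat.pair_eq_pair] at h
    | con => simp [Tm.code, Nat.pair_eq_pair] at h

def Fm.code : {Γ : Ctx} → Fm Γ → ℕ
  | _, .bot => Nat.pair 0 0
  | _, .eq s t => Nat.pair 1 (Nat.pair s.code t.code)
  | _, .lt s t => Nat.pair 2 (Nat.pair s.code t.code)
  | _, .imp φ ψ => Nat.pair 3 (Nat.pair φ.code ψ.code)
  | _, .all σ φ => Nat.pair 4 (Nat.pair σ.code φ.code)

theorem Fm.code_injective {Γ : Ctx} : Function.Injective (Fm.code (Γ := Γ)) := by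
  intro φ
  induction φ with
  | bot => intro ψ h; cases ψ <;> simp_all [Fm.code, Nat.pair_eq_pair]
  | eq s t =>
    intro ψ h
    cases ψ <;> simp only [Fm.code, Nat.pair_eq_pair, true_and, false_and,
      OfNat.one_ne_ofNat, one_ne_zero] at h
    cases Tm.code_injective _ _ h.1
    cases Tm.code_injective _ _ h.2
    rfl
  | lt s t =>
    intro ψ h
    cases ψ <;> simp [Fm.code, Nat.pair_eq_pair] at h
    cases Tm.code_injective _ _ h.1
    cases Tm.code_injective _ _ h.2
    rfl
  | imp φ χ h1 h2 =>
    intro ψ h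
    cases ψ <;> simp [Fm.code, Nat.pair_eq_pair] at h
    rw [h1 h.1, h2 h.2]
  | all σ φ ih =>
    intro ψ h
    cases ψ <;> simp [Fm.code, Nat.pair_eq_pair] at h
    obtain ⟨h1, h2⟩ := h
    cases Ty.code_injective h1
    rw [ih h2]

instance {Γ : Ctx} : Countable (Fm Γ) := Fm.code_injective.countable

/-! ## The completeness theorem -/

/-- A closed term of every type. -/
def Tm.default {Γ : Ctx} : (σ : Ty) → Tm Γ σ
  | .nat => zero
  | .arr σ τ => .app (.con (.k τ σ)) (Tm.default τ)

namespace Henkin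

/-- Henkin witnesses will be variables from one fixed supply. Every type has to recur beyond every
level, so that a fresh variable of the required type is always still to come. -/
theorem exists_typeSeq : ∃ f : ℕ → Ty, ∀ (σ : Ty) (n : ℕ), ∃ m, n ≤ m ∧ f m = σ := by
  have : Nonempty Ty := ⟨.nat⟩
  obtain ⟨f, hf⟩ := exists_surjective_nat Ty
  refine ⟨fun n => f n.unpair.1, fun σ n => ?_⟩
  obtain ⟨a, rfl⟩ := hf σ
  exact ⟨Nat.pair a n, Nat.right_le_pair a n, by simp⟩

/-- A sequence in which every type occurs infinitely often. -/
noncomputable def typeSeq : ℕ → Ty := exists_typeSeq.choose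

theorem exists_typeSeq_eq (σ : Ty) (n : ℕ) : ∃ m, n ≤ m ∧ typeSeq m = σ :=
  exists_typeSeq.choose_spec σ n

/-- The context of the first `n` variables of an infinite supply. -/
noncomputable def ctx : ℕ → Ctx
  | 0 => []
  | n + 1 => typeSeq n :: ctx n

/-- The inclusion of the first `n` variables in the first `m` variables. -/
noncomputable def up {n m : ℕ} (h : n ≤ m) : Ren (ctx n) (ctx m) :=
  Nat.leRec (motive := fun m _ => Ren (ctx n) (ctx m)) (fun _ x => x)
    (fun _ _ r _ x => .vs (r _ x)) h

theorem up_self (n : ℕ) : up (le_refl n) = fun _ x => x := Nat.leRec_self _ _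

theorem up_succ {n m : ℕ} (h : n ≤ m) :
    up (Nat.le_succ_of_le h) = fun σ x => .vs (up h σ x) := Nat.leRec_succ _ _ _

theorem up_succ_apply {n m : ℕ} (h : n ≤ m) {σ : Ty} (x : Var (ctx n) σ) :
    up (Nat.le_succ_of_le h) σ x = .vs (up h σ x) := congrFun (congrFun (up_succ h) σ) x

theorem up_up {n m k : ℕ} (h : n ≤ m) (h' : m ≤ k) {σ : Ty} (x : Var (ctx n) σ) :
    up h' σ (up h σ x) = up (h.trans h') σ x := by
  induction k, h' using Nat.le_induction with
  | base => rw [up_self]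
  | succ k hk ih =>
    exact (up_succ_apply hk _).trans ((congrArg Var.vs ih).trans (up_succ_apply _ _).symm)

theorem Tm.up_up {n m k : ℕ} (h : n ≤ m) (h' : m ≤ k) {σ : Ty} (t : Tm (ctx n) σ) :
    (t.rename (up h)).rename (up h') = t.rename (up (h.trans h')) := by
  simp only [Tm.rename_rename, Henkin.up_up]

theorem Fm.up_up {n m k : ℕ} (h : n ≤ m) (h' : m ≤ k) (φ : Fm (ctx n)) :
    (φ.rename (up h)).rename (up h') = φ.rename (up (h.trans h')) := by
  simp only [Fm.rename_rename, Henkin.up_up]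

theorem Tm.up_self {n : ℕ} {σ : Ty} (t : Tm (ctx n) σ) : t.rename (up (le_refl n)) = t := by
  rw [Henkin.up_self, Tm.rename_id]

theorem Fm.up_self {n : ℕ} (φ : Fm (ctx n)) : φ.rename (up (le_refl n)) = φ := by
  rw [Henkin.up_self, Fm.rename_id]

theorem Fm.up_succ {n : ℕ} (φ : Fm (ctx n)) : φ.rename (up (Nat.le_succ n)) = φ.wk := by
  rw [Henkin.up_succ (le_refl n), Henkin.up_self]; rfl

/-! ### Finite consistent conditions and generic sequences of them -/

variable {T : Set Sentence}

/-- Finite consistent sets of formulas. -/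
structure Cond (T : Set Sentence) where
  lvl : ℕ
  Δ : List (Fm (ctx lvl))
  consistent : ¬ Prf T Δ .bot

/-- Larger conditions are stronger: they use more variables and contain the lifts of all earlier
formulas. -/
instance : Preorder (Cond T) where
  le c d := ∃ h : c.lvl ≤ d.lvl, ∀ φ ∈ c.Δ, φ.rename (up h) ∈ d.Δ
  le_refl c := ⟨le_rfl, fun φ h => by rwa [Fm.up_self]⟩
  le_trans a b c := by
    rintro ⟨h1, h2⟩ ⟨h3, h4⟩
    refine ⟨h1.trans h3, fun φ h => ?_⟩
    rw [← Fm.up_up h1 h3]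
    exact h4 _ (h2 _ h)

/-- A fresh variable does no harm because every type has a closed term: a contradiction that uses
the variable can be generalized and then instantiated with `Tm.default`. -/
theorem Cond.exists_succ (c : Cond T) : ∃ d : Cond T, c ≤ d ∧ d.lvl = c.lvl + 1 := by
  refine ⟨⟨c.lvl + 1, c.Δ.map Fm.wk, fun h => c.consistent ?_⟩, ⟨Nat.le_succ _, fun φ hφ => ?_⟩,
    rfl⟩
  · exact Prf.allE (φ := .bot) (Tm.default _) (Prf.allI h)
  · rw [Fm.up_succ]
    exact List.mem_map_of_mem hφ

theorem Cond.exists_level (c : Cond T) {n : ℕ} (h : c.lvl ≤ n) :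
    ∃ d : Cond T, c ≤ d ∧ d.lvl = n := by
  induction n, h using Nat.le_induction with
  | base => exact ⟨c, le_rfl, rfl⟩
  | succ n _ ih =>
    obtain ⟨d, h1, rfl⟩ := ih
    obtain ⟨e, h2, h3⟩ := d.exists_succ
    exact ⟨e, h1.trans h2, h3⟩

theorem Cond.exists_cons (c : Cond T) {φ : Fm (ctx c.lvl)} (h : ¬ Prf T (φ :: c.Δ) .bot) :
    ∃ d : Cond T, c ≤ d ∧ ∃ hl : d.lvl = c.lvl, φ.rename (up hl.ge) ∈ d.Δ :=
  ⟨⟨c.lvl, φ :: c.Δ, h⟩, ⟨le_rfl, fun ψ hψ => by simp [Fm.up_self, hψ]⟩, rfl,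
    by simp [Fm.up_self]⟩

/-- The condition `c` decides `φ`, and gives a counterexample to a universal formula `φ` that it
refutes. -/
def Decides (c : Cond T) {n : ℕ} (φ : Fm (ctx n)) : Prop :=
  ∃ h : n ≤ c.lvl, φ.rename (up h) ∈ c.Δ ∨
    (φ.not.rename (up h) ∈ c.Δ ∧ ∀ (σ : Ty) (χ : Fm (σ :: ctx n)), φ = .all σ χ →
      ∃ t : Tm (ctx c.lvl) σ, (χ.subst (Sub.cons t fun _ x => .var (up h _ x))).not ∈ c.Δ)

theorem Cond.not_consistent_not {Γ : Ctx} {Δ : List (Fm Γ)} (hΔ : ¬ Prf T Δ .bot) {φ : Fm Γ}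
    (h : Prf T (φ :: Δ) .bot) : ¬ Prf T (φ.not :: Δ) .bot :=
  fun h' => hΔ (.impE (.impI h) (.raa h'))

/-- The next variable of the supply is fresh and serves as the counterexample. If the negated
instance were contradictory, generalization over the variable would derive the universal formula
from its own negation. -/
theorem Cond.exists_witness (c : Cond T) {σ : Ty} (χ : Fm (σ :: ctx c.lvl))
    (hσ : typeSeq c.lvl = σ) (h : Prf T (.all σ χ :: c.Δ) .bot) :
    ∃ d : Cond T, ∃ hl : c ≤ d, (Fm.all σ χ).not.rename (up hl.1) ∈ d.Δ ∧
      ∃ t : Tm (ctx d.lvl) σ, (χ.subst (Sub.cons t fun _ x => .var (up hl.1 _ x))).not ∈ d.Δ := by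
  subst hσ
  have hle : c.lvl ≤ c.lvl + 1 := Nat.le_succ _
  refine ⟨⟨c.lvl + 1, χ.not :: ((Fm.all _ χ).not :: c.Δ).map Fm.wk, fun h' => ?_⟩,
    ⟨hle, fun φ hφ => ?_⟩, ?_, .var .vz, ?_⟩
  · exact Cond.not_consistent_not c.consistent h 
      (.impE (.hyp List.mem_cons_self) (.allI (.raa h')))
  · rw [Fm.up_succ]
    exact List.mem_cons_of_mem _ (List.mem_map_of_mem (List.mem_cons_of_mem _ hφ))
  · rw [Fm.up_succ]
    exact List.mem_cons_of_mem _ (List.mem_map_of_mem List.mem_cons_self)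
  · have : χ.subst (Sub.cons (.var .vz) fun _ x => .var (up hle _ x)) = χ := by
      refine Eq.trans ?_ ((Fm.subst_var χ fun _ x => x).trans (Fm.rename_id χ))
      congr 1
      funext τ x
      cases x with
      | vz => rfl
      | vs x =>
        have : up hle τ x = .vs x := by
          rw [up_succ_apply (le_refl c.lvl), Henkin.up_self]
        exact congrArg Tm.var this
    exact List.mem_cons.2 (.inl (congrArg Fm.not this))

/-- This is the density that a generic sequence needs. Only a refuted universal formula is delicate:
the condition is first raised to a level whose next variable has the quantified type. -/
theorem exists_decides {n : ℕ} (φ : Fm (ctx n)) (c : Cond T) :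
    ∃ d : Cond T, Decides d φ ∧ c ≤ d := by
  wlog h : n ≤ c.lvl generalizing c
  · obtain ⟨d, h1, h2⟩ := c.exists_level (n := max n c.lvl) (le_max_right _ _)
    obtain ⟨e, h3, h4⟩ := this d (by simp [h2])
    exact ⟨e, h3, h1.trans h4⟩
  by_cases hφ : Prf T (φ.rename (up h) :: c.Δ) .bot
  swap
  · obtain ⟨d, h1, h2, h3⟩ := c.exists_cons hφ
    rw [Fm.up_up] at h3
    exact ⟨d, ⟨h.trans h2.ge, .inl h3⟩, h1⟩
  by_cases hall : ∃ (σ : Ty) (χ : Fm (σ :: ctx n)), φ = .all σ χ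
  swap
  · obtain ⟨d, h1, h2, h3⟩ := c.exists_cons (Cond.not_consistent_not c.consistent hφ)
    refine ⟨d, ⟨h.trans h2.ge, .inr ⟨?_, fun σ χ h => absurd ⟨σ, χ, h⟩ hall⟩⟩, h1⟩
    rw [← Fm.up_up h h2.ge]
    exact h3
  obtain ⟨σ, χ, rfl⟩ := hall
  obtain ⟨m, hm, hσ⟩ := exists_typeSeq_eq σ c.lvl
  obtain ⟨c', h1, rfl⟩ := c.exists_level hm
  -- The refutation found at the lower level is not transported upwards, which would need weakening
  -- of derivations; consistency is simply tested again at the new level.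
  by_cases hφ' : Prf T ((Fm.all σ χ).rename (up (h.trans h1.1)) :: c'.Δ) .bot
  swap
  · obtain ⟨d, h2, h3, h4⟩ := c'.exists_cons hφ'
    rw [Fm.up_up] at h4
    exact ⟨d, ⟨_, .inl h4⟩, h1.trans h2⟩
  obtain ⟨d, hd, h2, t, h3⟩ := c'.exists_witness _ hσ hφ'
  refine ⟨d, ⟨(h.trans h1.1).trans hd.1, .inr ⟨?_, fun σ' χ' he => ?_⟩⟩, h1.trans hd⟩
  · rw [← Fm.up_up (h.trans h1.1) hd.1]
    exact h2
  · cases he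
    refine ⟨t, ?_⟩
    rw [Fm.rename_subst] at h3
    convert h3 using 3
    funext τ x
    cases x with
    | vz => rfl
    | vs x => exact congrArg Tm.var (up_up (h.trans h1.1) hd.1 x).symm

/-- A set of formulas that has the properties of the set of the true formulas of a structure. -/
structure Complete (T : Set Sentence) where
  holds : {n : ℕ} → Fm (ctx n) → Prop
  up_iff {n m : ℕ} (h : n ≤ m) (φ : Fm (ctx n)) : holds (φ.rename (up h)) ↔ holds φ
  bot {n : ℕ} : ¬ holds (.bot : Fm (ctx n))
  imp_iff {n : ℕ} (φ ψ : Fm (ctx n)) : holds (.imp φ ψ) ↔ (holds φ → holds ψ)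
  all_iff {n : ℕ} {σ : Ty} (χ : Fm (σ :: ctx n)) : holds (.all σ χ) ↔ ∀ (m : ℕ) (h : n ≤ m)
    (t : Tm (ctx m) σ), holds (χ.subst (Sub.cons t fun _ x => .var (up h _ x)))
  ax (φ : Sentence) : φ ∈ T → holds (n := 0) φ

/-- The formula `φ` belongs to the condition `c`. -/
def Cond.Has (c : Cond T) {n : ℕ} (φ : Fm (ctx n)) : Prop :=
  ∃ h : n ≤ c.lvl, φ.rename (up h) ∈ c.Δ

theorem Cond.Has.mono {c d : Cond T} {n : ℕ} {φ : Fm (ctx n)} (h : c.Has φ) (hcd : c ≤ d) :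
    d.Has φ := by
  obtain ⟨h1, h2⟩ := h
  obtain ⟨h3, h4⟩ := hcd
  refine ⟨h1.trans h3, ?_⟩
  rw [← Fm.up_up h1 h3]
  exact h4 _ h2

theorem Cond.has_up {c : Cond T} {n m : ℕ} (h : n ≤ m) {φ : Fm (ctx n)}
    (hφ : c.Has (φ.rename (up h))) : c.Has φ := by
  obtain ⟨h1, h2⟩ := hφ
  rw [Fm.up_up] at h2
  exact ⟨h.trans h1, h2⟩

/-- There are countably many formulas, so some increasing sequence of conditions decides all of them
(Rasiowa–Sikorski). To hold is to belong to some condition of the sequence. Any two or three members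
lie in a common consistent condition, which gives the clauses for the connectives, and the recorded
counterexamples give the clause for the quantifier. -/
theorem exists_complete (c₀ : Cond T) :
    ∃ H : Complete T, ∀ {n : ℕ} (φ : Fm (ctx n)), c₀.Has φ → H.holds φ := by
  let _ : Encodable (Σ n, Fm (ctx n)) := Encodable.ofCountable _
  let 𝒟 : (Σ n, Fm (ctx n)) → Order.Cofinal (Cond T) := fun p =>
    ⟨{c | Decides c p.2}, fun c => exists_decides p.2 c⟩
  let G := Order.sequenceOfCofinals c₀ 𝒟
  have mono : Monotone G := Order.sequenceOfCofinals.monotone c₀ 𝒟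
  have dec : ∀ {n : ℕ} (φ : Fm (ctx n)), ∃ k, Decides (G k) φ := fun {n} φ =>
    ⟨_, Order.sequenceOfCofinals.encode_mem c₀ 𝒟 ⟨n, φ⟩⟩
  let holds : ∀ {n : ℕ}, Fm (ctx n) → Prop := fun φ => ∃ k, (G k).Has φ
  have not_of : ∀ {n : ℕ} (φ : Fm (ctx n)), ¬ holds φ → holds φ.not := by
    intro n φ h
    obtain ⟨k, hk, h1 | h1⟩ := dec φ
    · exact absurd ⟨k, hk, h1⟩ h
    · exact ⟨k, hk, h1.1⟩
  have not_both : ∀ {n : ℕ} (φ : Fm (ctx n)), holds φ → ¬ holds φ.not := by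
    rintro n φ ⟨k, h1⟩ ⟨l, h2⟩
    obtain ⟨h, h1⟩ := h1.mono (mono (le_max_left k l))
    obtain ⟨h', h2⟩ := h2.mono (mono (le_max_right k l))
    exact (G (max k l)).consistent (.impE (.hyp h2) (.hyp h1))
  have of_not : ∀ {n : ℕ} (φ : Fm (ctx n)), (holds φ.not → False) → holds φ :=
    fun φ h => by_contra fun h' => h (not_of φ h')
  refine ⟨{ holds := holds, up_iff := ?_, bot := ?_, imp_iff := ?_, all_iff := ?_, ax := ?_ },
    fun φ h => ⟨0, h⟩⟩
  · intro n m h φ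
    refine ⟨fun ⟨k, hk⟩ => ⟨k, Cond.has_up h hk⟩, fun ⟨k, hk⟩ => of_not _ fun h' => ?_⟩
    obtain ⟨l, hl⟩ := h'
    exact not_both φ ⟨k, hk⟩ ⟨l, Cond.has_up (φ := φ.not) h hl⟩
  · rintro n ⟨k, h, hk⟩
    exact (G k).consistent (.hyp hk)
  · intro n φ ψ
    constructor
    · rintro ⟨k, hk⟩ ⟨l, hl⟩
      refine of_not _ fun ⟨j, hj⟩ => ?_
      obtain ⟨_, h1⟩ := hk.mono (mono (le_max_left k (max l j)))
      obtain ⟨_, h2⟩ := hl.mono (mono ((le_max_left l j).trans (le_max_right k _)))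
      obtain ⟨_, h3⟩ := hj.mono (mono ((le_max_right l j).trans (le_max_right k _)))
      exact (G _).consistent (.impE (.hyp h3) (.impE (.hyp h1) (.hyp h2)))
    · intro h
      refine of_not _ fun ⟨j, hj⟩ => ?_
      by_cases hφ : holds φ
      · obtain ⟨l, hl⟩ := h hφ
        obtain ⟨_, h1⟩ := hl.mono (mono (le_max_left l j))
        obtain ⟨_, h2⟩ := hj.mono (mono (le_max_right l j))
        exact (G _).consistent (.impE (.hyp h2) (.impI (.hyp (List.mem_cons_of_mem _ h1))))
      · obtain ⟨l, hl⟩ := not_of _ hφ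
        obtain ⟨_, h1⟩ := hl.mono (mono (le_max_left l j))
        obtain ⟨_, h2⟩ := hj.mono (mono (le_max_right l j))
        exact (G _).consistent (.impE (.hyp h2) (.impI (.raa (.impE
          (.hyp (List.mem_cons_of_mem _ (List.mem_cons_of_mem _ h1)))
          (.hyp (List.mem_cons_of_mem _ List.mem_cons_self))))))
  · intro n σ χ
    constructor
    · rintro ⟨k, hk⟩ m h t
      refine of_not _ fun ⟨j, hj⟩ => ?_
      obtain ⟨h1, h2⟩ := hk.mono (mono (le_max_left k j))
      obtain ⟨h3, h4⟩ := hj.mono (mono (le_max_right k j))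
      refine (G _).consistent (.impE (.hyp h4) ?_)
      have := Prf.allE (T := T) (t.rename (up h3)) (.hyp h2)
      rw [Fm.rename_lift_inst] at this
      rw [Fm.subst_rename]
      convert this using 2
      funext τ x
      cases x with
      | vz => rfl
      | vs x => exact congrArg Tm.var (up_up h h3 x)
    · intro h
      by_contra h'
      obtain ⟨k, hk, h1 | ⟨h1, h2⟩⟩ := dec (.all σ χ)
      · exact h' ⟨k, hk, h1⟩
      · obtain ⟨t, ht⟩ := h2 σ χ rfl
        refine not_both _ (h _ hk t) ⟨k, le_rfl, ?_⟩
        rwa [Fm.up_self]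
  · intro φ hφ
    refine of_not (n := 0) _ fun ⟨k, h, hk⟩ => (G k).consistent (.impE (.hyp hk) ?_)
    have := Prf.ax (T := T) (Γ := ctx (G k).lvl) (Δ := (G k).Δ) hφ
    exact (congrArg (fun r : Ren [] (ctx (G k).lvl) => φ.rename r)
      (funext fun σ => funext fun x => nomatch x) : φ.rename Ren.nil = _) ▸ this

/-- The structure of the terms of a complete set of formulas. -/
noncomputable def Complete.str (H : Complete T) : Str where
  D σ := Σ n, Tm (ctx n) σ
  app s t := ⟨max s.1 t.1, .app (s.2.rename (up (le_max_left _ _)))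
    (t.2.rename (up (le_max_right _ _)))⟩
  con c := ⟨0, .con c⟩
  eq s t := H.holds (.eq (s.2.rename (up (le_max_left s.1 t.1)))
    (t.2.rename (up (le_max_right s.1 t.1))))
  lt s t := H.holds (.lt (s.2.rename (up (le_max_left s.1 t.1)))
    (t.2.rename (up (le_max_right s.1 t.1))))

/-! ### The truth lemma for the structure of terms -/

variable {H : Complete T}

/-- The substitution given by an assignment in the structure of the terms. -/
noncomputable def toSub {Γ : Ctx} (ρ : Env H.str Γ) {N : ℕ} (h : ∀ σ x, (ρ σ x).1 ≤ N) :
    Sub Γ (ctx N) :=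
  fun σ x => (ρ σ x).2.rename (up (h σ x))

theorem eval_str {Γ : Ctx} (ρ : Env H.str Γ) {N : ℕ} (h : ∀ σ x, (ρ σ x).1 ≤ N) {σ : Ty}
    (t : Tm Γ σ) : ∃ hN : (t.eval ρ).1 ≤ N, (t.eval ρ).2.rename (up hN) = t.subst (toSub ρ h) := by
  induction t with
  | var x => exact ⟨h _ x, rfl⟩
  | con c => exact ⟨Nat.zero_le _, rfl⟩
  | app s t hs ht =>
    obtain ⟨h1, h2⟩ := hs
    obtain ⟨h3, h4⟩ := ht
    exact ⟨max_le h1 h3, congrArg₂ Tm.app ((Tm.up_up _ _ _).trans h2) ((Tm.up_up _ _ _).trans h4)⟩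

/-- Truth lemma. The bound N on the levels of the assigned terms is arbitrary because a quantifier
may bring in a term from a higher level; the formula is then moved to the maximum of the two. -/
theorem sat_str {Γ : Ctx} (φ : Fm Γ) : ∀ (ρ : Env H.str Γ) {N : ℕ} (h : ∀ σ x, (ρ σ x).1 ≤ N),
    φ.sat ρ ↔ H.holds (φ.subst (toSub ρ h)) := by
  induction φ with
  | bot => exact fun ρ N h => ⟨False.elim, H.bot⟩
  | eq s t =>
    intro ρ N h
    obtain ⟨h1, h2⟩ := eval_str ρ h s
    obtain ⟨h3, h4⟩ := eval_str ρ h t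
    refine (H.up_iff (max_le h1 h3) _).symm.trans ?_
    simp only [Fm.rename, Tm.up_up, h2, h4, Fm.subst]
  | lt s t =>
    intro ρ N h
    obtain ⟨h1, h2⟩ := eval_str ρ h s
    obtain ⟨h3, h4⟩ := eval_str ρ h t
    refine (H.up_iff (max_le h1 h3) _).symm.trans ?_
    simp only [Fm.rename, Tm.up_up, h2, h4, Fm.subst]
  | imp φ ψ h1 h2 =>
    intro ρ N h
    simp only [Fm.sat, Fm.subst, H.imp_iff, h1 ρ h, h2 ρ h]
  | all σ φ ih =>
    intro ρ N h
    have key : ∀ (m : ℕ) (hm : N ≤ m) (d : H.str.D σ) (hd : d.1 ≤ m),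
        φ.sat (Env.cons d ρ) ↔ H.holds ((φ.subst (Sub.lift (toSub ρ h) σ)).subst
          (Sub.cons (d.2.rename (up hd)) fun _ x => .var (up hm _ x))) := by
      intro m hm d hd
      have hρ : ∀ τ x, (Env.cons d ρ τ x).1 ≤ m := by
        intro τ x
        cases x with
        | vz => exact hd
        | vs x => exact (h _ x).trans hm
      rw [ih _ hρ, Fm.subst_subst]
      refine iff_of_eq (congrArg (fun s => H.holds (φ.subst s)) ?_)
      funext τ x
      cases x with
      | vz => rfl
      | vs x =>
        simp only [Sub.lift, Tm.wk, Tm.rename_subst, toSub]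
        refine Eq.trans ?_ (Tm.subst_var (fun σ y => up hm σ (up (h τ x) σ y)) _).symm
        exact (Tm.up_up (h τ x) hm _).symm.trans (Tm.rename_rename _ _ _)
    simp only [Fm.sat, Fm.subst, H.all_iff]
    constructor
    · intro hs m hm t
      have := (key m hm ⟨m, t⟩ le_rfl).1 (hs _)
      rwa [Tm.up_self] at this
    · intro hs d
      exact (key (max N d.1) (le_max_left _ _) d (le_max_right _ _)).2 (hs _ _ _)

theorem models_str (φ : Sentence) : H.str.Models φ ↔ H.holds (n := 0) φ := by
  refine (sat_str φ Env.nil (N := 0) (fun _ x => nomatch x)).trans ?_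
  refine iff_of_eq (congrArg (H.holds (n := 0)) ?_)
  refine Eq.trans ?_ ((Fm.subst_var φ fun _ x => x).trans (Fm.rename_id φ))
  congr 1
  funext τ x
  cases x

end Henkin

/-- A sentence that is true in all models of `T` is provable in `T`. -/
theorem completeness {T : Set Sentence} {φ : Sentence}
    (h : ∀ M : Str, (∀ ψ ∈ T, M.Models ψ) → M.Models φ) : Proves T φ := by
  by_contra hφ
  obtain ⟨H, hH⟩ := Henkin.exists_complete (T := T)
    ⟨0, [φ.not], fun h' => hφ (.raa h')⟩
  have h1 : H.str.Models φ.not :=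
    (Henkin.models_str _).2 (hH (n := 0) φ.not 
      ⟨le_rfl, List.mem_cons.2 (.inl (Henkin.Fm.up_self (n := 0) _))⟩)
  exact h1 (h H.str fun ψ hψ => (Henkin.models_str ψ).2 (H.ax ψ hψ))

end HOA

namespace HOA

/-! ## Normal structures -/

/-- Equality of all types, defined pointwise from the equality of numbers. -/
def Str.Rel (M : Str) : (σ : Ty) → M.D σ → M.D σ → Prop
  | .nat, a, b => M.eq a b
  | .arr σ τ, f, g => ∀ a : M.D σ, M.Rel τ (M.app f a) (M.app g a)

theorem sat_eqT {M : Str} : ∀ (σ : Ty) {Γ : Ctx} (ρ : Env M Γ) (s t : Tm Γ σ),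
    (eqT σ s t).sat ρ ↔ M.Rel σ (s.eval ρ) (t.eval ρ)
  | .nat, _, _, _, _ => Iff.rfl
  | .arr σ τ, _, ρ, s, t => by
    simp only [eqT, Fm.sat, Str.Rel, sat_eqT τ, Tm.eval_app, Tm.eval_wk, Tm.eval_var, Env.cons_vz]

/-- A structure with standard and extensional equality. -/
structure Str.Normal (M : Str) : Prop where
  eq_iff (a b : M.D .nat) : M.eq a b ↔ a = b
  ext {σ τ : Ty} (f g : M.D (.arr σ τ)) : (∀ a, M.app f a = M.app g a) → f = g

theorem Str.Normal.rel_iff {M : Str} (hM : M.Normal) :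
    ∀ (σ : Ty) (a b : M.D σ), M.Rel σ a b ↔ a = b
  | .nat, a, b => hM.eq_iff a b
  | .arr σ τ, f, g => by
    simp only [Str.Rel, hM.rel_iff τ]
    exact ⟨hM.ext f g, fun h a => h ▸ rfl⟩

theorem Str.Normal.sat_eqT {M : Str} (hM : M.Normal) {σ : Ty} {Γ : Ctx} (ρ : Env M Γ)
    (s t : Tm Γ σ) : (eqT σ s t).sat ρ ↔ s.eval ρ = t.eval ρ :=
  (HOA.sat_eqT σ ρ s t).trans (hM.rel_iff σ _ _)

section Quotient

variable {M : Str} (hM : ∀ φ ∈ RCA, M.Models φ)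

include hM

theorem Str.models_of_rcaAx {Γ : Ctx} {φ : Fm Γ} (h : RCAAx (.close Γ φ)) (ρ : Env M Γ) :
    φ.sat ρ :=
  (Fm.models_close φ).1 (hM _ h) ρ

theorem Str.rel_refl : ∀ (σ : Ty) (a : M.D σ), M.Rel σ a a
  | .nat, a => M.models_of_rcaAx hM .eq_refl (Env.cons a Env.nil)
  | .arr _ τ, f => fun a => Str.rel_refl τ (M.app f a)

theorem Str.rel_symm : ∀ (σ : Ty) {a b : M.D σ}, M.Rel σ a b → M.Rel σ b a
  | .nat, a, b, h => M.models_of_rcaAx hM .eq_symm (Env.cons a (Env.cons b Env.nil)) h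
  | .arr _ τ, _, _, h => fun a => Str.rel_symm τ (h a)

theorem Str.rel_trans : ∀ (σ : Ty) {a b c : M.D σ}, M.Rel σ a b → M.Rel σ b c → M.Rel σ a c
  | .nat, a, b, c, h, h' =>
    M.models_of_rcaAx hM .eq_trans (Env.cons a (Env.cons b (Env.cons c Env.nil))) h h'
  | .arr _ τ, _, _, _, h, h' => fun a => Str.rel_trans τ (h a) (h' a)

/-- Congruence in the function is the definition of pointwise equality; congruence in the argument
is the axiom of extensionality, which is used here to pass to a quotient at all types. -/
theorem Str.rel_app {σ τ : Ty} {f g : M.D (.arr σ τ)} {a b : M.D σ}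
    (h : M.Rel _ f g) (h' : M.Rel _ a b) : M.Rel τ (M.app f a) (M.app g b) := by
  have := M.models_of_rcaAx hM (.ext σ τ) (Env.cons a (Env.cons b (Env.cons f Env.nil)))
  simp only [Fm.sat, sat_eqT] at this
  exact Str.rel_trans hM τ (this h') (h b)

theorem Str.rel_lt {a b a' b' : M.D .nat} (h : M.Rel _ a a') (h' : M.Rel _ b b')
    (hl : M.lt a b) : M.lt a' b' :=
  M.models_of_rcaAx hM .lt_congr_right (Env.cons b (Env.cons b' (Env.cons a' Env.nil))) h'
    (M.models_of_rcaAx hM .lt_congr_left (Env.cons a (Env.cons a' (Env.cons b Env.nil))) h hl)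

/-- The setoid of pointwise equality. -/
def Str.setoid (σ : Ty) : Setoid (M.D σ) :=
  ⟨M.Rel σ, Str.rel_refl hM σ, Str.rel_symm hM σ, Str.rel_trans hM σ⟩

/-- The quotient of a model of the base theory by pointwise equality. -/
def Str.quot : Str where
  D σ := Quotient (Str.setoid hM σ)
  app := Quotient.map₂ M.app fun _ _ h _ _ h' => Str.rel_app hM h h'
  con c := Quotient.mk _ (M.con c)
  eq a b := a = b
  lt := Quotient.lift₂ M.lt fun _ _ _ _ h h' => propext
    ⟨Str.rel_lt hM h h', Str.rel_lt hM (Str.rel_symm hM _ h) (Str.rel_symm hM _ h')⟩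

/-- The projection of an assignment to the quotient. -/
def Str.quotEnv {Γ : Ctx} (ρ : Env M Γ) : Env (Str.quot hM) Γ := fun σ x => Quotient.mk _ (ρ σ x)

theorem Str.eval_quot {Γ : Ctx} (ρ : Env M Γ) {σ : Ty} (t : Tm Γ σ) :
    t.eval (Str.quotEnv hM ρ) = (Quotient.mk _ (t.eval ρ) : (Str.quot hM).D σ) := by
  induction t with
  | var x => rfl
  | con c => rfl
  | app s t hs ht => rw [Tm.eval_app, hs, ht]; rfl

theorem Str.sat_quot {Γ : Ctx} (φ : Fm Γ) (ρ : Env M Γ) :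
    φ.sat (Str.quotEnv hM ρ) ↔ φ.sat ρ := by
  induction φ with
  | bot => rfl
  | eq s t => simp only [Fm.sat, Str.eval_quot]; exact Quotient.eq
  | lt s t => simp only [Fm.sat, Str.eval_quot]; rfl
  | imp φ ψ h1 h2 => simp only [Fm.sat, h1, h2]
  | all σ φ ih =>
    have key : ∀ d : M.D σ,
        φ.sat (Env.cons (M := Str.quot hM) (Quotient.mk _ d) (Str.quotEnv hM ρ)) ↔
          φ.sat (Env.cons d ρ) := by
      intro d
      rw [← ih]
      refine iff_of_eq (congrArg (fun ρ => φ.sat ρ) ?_)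
      funext τ x
      cases x <;> rfl
    exact ⟨fun h d => (key d).1 (h _), fun h => Quotient.ind fun d => (key d).2 (h d)⟩

theorem Str.models_quot (φ : Sentence) : (Str.quot hM).Models φ ↔ M.Models φ := by
  rw [Str.Models, Env.ext_nil (M := Str.quot hM) Env.nil (Str.quotEnv hM Env.nil)]
  exact Str.sat_quot hM φ _

theorem Str.quot_normal : (Str.quot hM).Normal where
  eq_iff _ _ := Iff.rfl
  ext := Quotient.ind₂ fun _ _ h => Quotient.sound fun a => Quotient.exact
    (h (Quotient.mk _ a))

end Quotient

/-- A normal model of the base theory. -/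
structure Model extends Str where
  normal : toStr.Normal
  rca : ∀ φ ∈ RCA, toStr.Models φ

/-- A sentence that is true in all normal models of an extension `T` of the base theory is provable
in `T`. -/
theorem completeness_normal {T : Set Sentence} (hT : RCA ⊆ T) {φ : Sentence}
    (h : ∀ M : Model, (∀ ψ ∈ T, M.Models ψ) → M.Models φ) : Proves T φ := by
  refine completeness fun M hM => ?_
  have hR : ∀ ψ ∈ RCA, M.Models ψ := fun ψ hψ => hM ψ (hT hψ)
  refine (Str.models_quot hR φ).1 (h ⟨Str.quot hR, Str.quot_normal hR, fun ψ hψ => ?_⟩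
    fun ψ hψ => ?_)
  · exact (Str.models_quot hR ψ).2 (hR ψ hψ)
  · exact (Str.models_quot hR ψ).2 (hM ψ hψ)

end HOA

/-! ## The ordered field of fractions of an ordered semiring -/

namespace OrderedFraction

variable (α : Type*) [CommSemiring α] [LinearOrder α] [IsStrictOrderedRing α]

/-- The congruence on the formal differences `x.re - x.im` that identifies equal differences. -/
def diffCon : RingCon (QuadraticAlgebra α 1 0) where
  r x y := x.re + y.im = y.re + x.im
  iseqv :=
    { refl := fun _ => rfl
      symm := fun h => h.symm
      trans := fun {x y z} h h' => by
        have : (x.re + z.im) + (y.re + y.im) = (z.re + x.im) + (y.re + y.im) := by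
          calc _ = (x.re + y.im) + (y.re + z.im) := by ring
            _ = (y.re + x.im) + (z.re + y.im) := by rw [h, h']
            _ = _ := by ring
        exact add_right_cancel this }
  add' {x y z w} h h' := by
    simp only [QuadraticAlgebra.re_add, QuadraticAlgebra.im_add]
    calc _ = (x.re + y.im) + (z.re + w.im) := by ring
      _ = (y.re + x.im) + (w.re + z.im) := by rw [h, h']
      _ = _ := by ring
  mul' {x y z w} h h' := by
    simp only [QuadraticAlgebra.re_mul, QuadraticAlgebra.im_mul, one_mul, zero_mul, add_zero]
    -- The two congruences are applied one after the other, through the product of y and z; the term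
    -- added on both sides is the sum of the two components of that product.
    refine add_right_cancel (b := y.re * z.re + y.im * z.im + y.re * z.im + y.im * z.re) ?_
    calc _ = (x.re + y.im) * z.re + (y.re + x.im) * z.im + y.re * (z.re + w.im)
          + y.im * (w.re + z.im) := by ring
      _ = (y.re + x.im) * z.re + (x.re + y.im) * z.im + y.re * (w.re + z.im)
          + y.im * (z.re + w.im) := by rw [h, h']
      _ = _ := by ring

/-- The ring of differences. -/
def Diff : Type _ := (diffCon α).Quotient

noncomputable instance : CommSemiring (Diff α) :=
  inferInstanceAs (CommSemiring (diffCon α).Quotient)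

variable {α}

/-- The generator of `QuadraticAlgebra α 1 0` has square 1 and plays the role of −1. The pair thus
stands for a − b, and pairs multiply as differences do. -/
def Diff.mk (a b : α) : Diff α := ((⟨a, b⟩ : QuadraticAlgebra α 1 0) : (diffCon α).Quotient)

theorem Diff.mk_eq_mk {a b c d : α} : Diff.mk a b = Diff.mk c d ↔ a + d = c + b :=
  (RingCon.eq (c := diffCon α))

theorem Diff.mk_add (a b c d : α) : Diff.mk a b + Diff.mk c d = Diff.mk (a + c) (b + d) := rfl

theorem Diff.mk_mul (a b c d : α) :
    Diff.mk a b * Diff.mk c d = Diff.mk (a * c + b * d) (a * d + b * c) := by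
  have : Diff.mk a b * Diff.mk c d = Diff.mk (a * c + 1 * b * d) (a * d + b * c + 0 * b * d) := rfl
  rw [this]
  congr 1 <;> ring

theorem Diff.zero_def : (0 : Diff α) = Diff.mk 0 0 := rfl

theorem Diff.ind {p : Diff α → Prop} (h : ∀ a b, p (Diff.mk a b)) (x : Diff α) : p x :=
  Quotient.ind (fun x => h x.re x.im) x

noncomputable instance : Neg (Diff α) := ⟨fun x => Diff.mk 0 1 * x⟩

noncomputable instance : CommRing (Diff α) :=
  { (inferInstance : CommSemiring (Diff α)), (inferInstance : Neg (Diff α)) with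
    zsmul := zsmulRec
    neg_add_cancel := by
      refine Diff.ind fun a b => ?_
      change Diff.mk 0 1 * Diff.mk a b + Diff.mk a b = 0
      rw [Diff.mk_mul, Diff.mk_add, Diff.zero_def, Diff.mk_eq_mk]
      ring }

/-- The inclusion of the semiring in the ring of differences. -/
noncomputable def Diff.of : α →+* Diff α where
  toFun a := Diff.mk a 0
  map_one' := rfl
  map_zero' := rfl
  map_add' a b := by rw [Diff.mk_add, add_zero]
  map_mul' a b := by rw [Diff.mk_mul]; simp

theorem Diff.of_injective : Function.Injective (Diff.of (α := α)) := by
  intro a b h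
  simpa using Diff.mk_eq_mk.1 h

/-! ### Signs, absence of zero divisors, and the order of the fractions -/

variable [CanonicallyOrderedAdd α]

/-- The order is linear and smaller elements can be subtracted, so every difference is an element up
to sign. This reduces both the absence of zero divisors and the totality of the order of fractions
to the semiring. -/
theorem Diff.eq_of_or_eq_neg (x : Diff α) : ∃ a : α, x = Diff.of a ∨ x = -Diff.of a := by
  induction x using Diff.ind with
  | h a b =>
    rcases le_total a b with h | h
    · obtain ⟨c, rfl⟩ := exists_add_of_le h
      refine ⟨c, .inr ?_⟩
      change _ = Diff.mk 0 1 * Diff.mk c 0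
      rw [Diff.mk_mul, Diff.mk_eq_mk]
      ring
    · obtain ⟨c, rfl⟩ := exists_add_of_le h
      refine ⟨c, .inl (Diff.mk_eq_mk.2 ?_)⟩
      ring

instance : Nontrivial (Diff α) := Diff.of_injective.nontrivial

instance : NoZeroDivisors (Diff α) where
  eq_zero_or_eq_zero_of_mul_eq_zero {x y} h := by
    obtain ⟨a, ha⟩ := x.eq_of_or_eq_neg
    obtain ⟨b, hb⟩ := y.eq_of_or_eq_neg
    have hab : Diff.of (a * b) = 0 := by
      rw [map_mul]
      rcases ha with rfl | rfl <;> rcases hb with rfl | rfl <;> simpa using h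
    rw [map_eq_zero_iff _ Diff.of_injective, mul_eq_zero] at hab
    rcases hab with rfl | rfl
    · exact .inl (by simpa using ha)
    · exact .inr (by simpa using hb)

instance : IsDomain (Diff α) := NoZeroDivisors.to_isDomain _

variable (α) in
/-- The field of fractions of an ordered semiring. -/
abbrev Frac : Type _ := FractionRing (Diff α)

/-- The inclusion of an ordered semiring in its field of fractions. -/
noncomputable def of : α →+* Frac α := (algebraMap (Diff α) (Frac α)).comp Diff.of

omit [CanonicallyOrderedAdd α] in
theorem of_injective : Function.Injective (of (α := α)) :=
  (IsFractionRing.injective (Diff α) (Frac α)).comp Diff.of_injective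

omit [CanonicallyOrderedAdd α] in
theorem of_eq_zero {a : α} : of a = 0 ↔ a = 0 := map_eq_zero_iff _ of_injective

/-- The non-negative fractions. -/
def cone : RingCone (Frac α) where
  carrier := {x | ∃ a d : α, d ≠ 0 ∧ x * of d = of a}
  zero_mem' := ⟨0, 1, one_ne_zero, by simp⟩
  one_mem' := ⟨1, 1, one_ne_zero, by simp⟩
  add_mem' := by
    rintro x y ⟨a, d, hd, hx⟩ ⟨b, e, he, hy⟩
    refine ⟨a * e + b * d, d * e, mul_ne_zero hd he, ?_⟩
    simp only [map_mul, map_add, ← hx, ← hy]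
    ring
  mul_mem' := by
    rintro x y ⟨a, d, hd, hx⟩ ⟨b, e, he, hy⟩
    refine ⟨a * b, d * e, mul_ne_zero hd he, ?_⟩
    simp only [map_mul, ← hx, ← hy]
    ring
  eq_zero_of_mem_of_neg_mem' := by
    rintro x ⟨a, d, hd, hx⟩ ⟨b, e, he, hy⟩
    have h : of (a * e + b * d) = 0 := by
      simp only [map_mul, map_add, ← hx, ← hy]
      ring
    rw [of_eq_zero, add_eq_zero, mul_eq_zero, or_iff_left he] at h
    rw [h.1, map_zero, mul_eq_zero, of_eq_zero, or_iff_left hd] at hx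
    exact hx

instance : HasMemOrNegMem (cone (α := α)) where
  mem_or_neg_mem x := by
    obtain ⟨z, w, hw, rfl⟩ := IsFractionRing.div_surjective (A := Diff α) x
    have hw' : algebraMap (Diff α) (Frac α) w ≠ 0 := by
      simpa using nonZeroDivisors.ne_zero hw
    obtain ⟨a, ha⟩ := z.eq_of_or_eq_neg
    obtain ⟨d, hd⟩ := w.eq_of_or_eq_neg
    have hd0 : d ≠ 0 := by
      rintro rfl
      rcases hd with rfl | rfl <;> simp at hw'
    have hd' : algebraMap (Diff α) (Frac α) (Diff.of d) ≠ 0 := fun h => hd0 (of_eq_zero.1 h)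
    rcases ha with rfl | rfl <;> rcases hd with rfl | rfl
    · exact .inl ⟨a, d, hd0, by simp [of, hd']⟩
    · exact .inr ⟨a, d, hd0, by simp [of, div_neg, hd']⟩
    · exact .inr ⟨a, d, hd0, by simp [of, hd']⟩
    · exact .inl ⟨a, d, hd0, by simp [of, div_neg, hd']⟩

/-- The order of the field of fractions. -/
def FracLE (x y : Frac α) : Prop := y - x ∈ cone

open Classical in
noncomputable instance : LinearOrder (Frac α) where
  le := FracLE
  le_refl := (LinearOrder.mkOfAddGroupCone (cone (α := α))).le_refl
  le_trans := (LinearOrder.mkOfAddGroupCone (cone (α := α))).le_trans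
  le_antisymm := (LinearOrder.mkOfAddGroupCone (cone (α := α))).le_antisymm
  le_total := (LinearOrder.mkOfAddGroupCone (cone (α := α))).le_total
  toDecidableLE := inferInstance

instance : IsOrderedRing (Frac α) :=
  have h := IsOrderedRing.mkOfCone (cone (α := α))
  { add_le_add_left := h.add_le_add_left
    zero_le_one := h.zero_le_one
    mul_le_mul_of_nonneg_left := h.mul_le_mul_of_nonneg_left
    mul_le_mul_of_nonneg_right := h.mul_le_mul_of_nonneg_right }

instance : IsStrictOrderedRing (Frac α) := IsOrderedRing.toIsStrictOrderedRing _

theorem of_nonneg (a : α) : 0 ≤ of a :=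
  show of a - 0 ∈ cone (α := α) from ⟨a, 1, one_ne_zero, by simp⟩

theorem of_strictMono : StrictMono (of (α := α)) := by
  intro a b h
  obtain ⟨c, rfl⟩ := exists_add_of_le h.le
  refine lt_of_le_of_ne ?_ fun h' => h.ne (of_injective h')
  rw [map_add]
  exact le_add_of_nonneg_right (of_nonneg c)

end OrderedFraction

namespace HOA

/-! ## Arithmetic in a normal model of the base theory -/

namespace Model

variable {M : Model}

theorem axm {Γ : Ctx} {φ : Fm Γ} (h : RCAAx (.close Γ φ)) (ρ : Env M.toStr Γ) : φ.sat ρ :=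
  Str.models_of_rcaAx M.rca h ρ

/-- The assignments to one, two and three variables. -/
abbrev env1 {σ : Ty} (a : M.D σ) : Env M.toStr [σ] := Env.cons a Env.nil

abbrev env2 {σ τ : Ty} (a : M.D σ) (b : M.D τ) : Env M.toStr [σ, τ] := Env.cons a (env1 b)

abbrev env3 {σ τ ρ : Ty} (a : M.D σ) (b : M.D τ) (c : M.D ρ) : Env M.toStr [σ, τ, ρ] :=
  Env.cons a (env2 b c)

instance : Zero (M.D .nat) := ⟨M.con .zero⟩

instance : One (M.D .nat) := ⟨M.con .one⟩

instance : Add (M.D .nat) := ⟨fun a b => M.app (M.app (M.con .add) a) b⟩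

instance : Mul (M.D .nat) := ⟨fun a b => M.app (M.app (M.con .mul) a) b⟩

instance : LT (M.D .nat) := ⟨M.lt⟩

instance : LE (M.D .nat) := ⟨fun a b => a < b ∨ a = b⟩

section Eval

variable {Γ : Ctx} (ρ : Env M.toStr Γ)

@[simp] theorem eval_zero : (zero : Tm Γ .nat).eval ρ = 0 := rfl

@[simp] theorem eval_one : (one : Tm Γ .nat).eval ρ = 1 := rfl

@[simp] theorem eval_add (s t : Tm Γ .nat) : (add s t).eval ρ = s.eval ρ + t.eval ρ := rfl

@[simp] theorem eval_mul (s t : Tm Γ .nat) : (mul s t).eval ρ = s.eval ρ * t.eval ρ := rfl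

@[simp] theorem eval_succ (t : Tm Γ .nat) : (succ t).eval ρ = t.eval ρ + 1 := rfl

@[simp high] theorem sat_eq (s t : Tm Γ .nat) : (Fm.eq s t).sat ρ ↔ s.eval ρ = t.eval ρ :=
  M.normal.eq_iff _ _

@[simp high] theorem sat_lt (s t : Tm Γ .nat) : (Fm.lt s t).sat ρ ↔ s.eval ρ < t.eval ρ := Iff.rfl

theorem app_k {σ τ : Ty} (a : M.D σ) (b : M.D τ) : M.app (M.app (M.con (.k σ τ)) a) b = a :=
  (M.normal.sat_eqT _ _ _).1 (axm (.k σ τ) (env2 a b))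

theorem app_s {ρ σ τ : Ty} (f : M.D (.arr ρ (.arr σ τ))) (g : M.D (.arr ρ σ)) (a : M.D ρ) :
    M.app (M.app (M.app (M.con (.s ρ σ τ)) f) g) a = M.app (M.app f a) (M.app g a) :=
  (M.normal.sat_eqT _ _ _).1 (axm (.s ρ σ τ) (env3 a g f))

-- Combinatory completeness: the axioms for Π and Σ hold as identities in a normal model, so
-- abstraction by combinators satisfies β-conversion.
@[simp] theorem eval_lam {σ τ : Ty} (t : Tm (σ :: Γ) τ) (d : M.D σ) :
    M.app (t.lam.eval ρ) d = t.eval (Env.cons d ρ) := by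
  match t with
  | .var .vz => simp only [Tm.lam, Var.lam, Tm.eval_app, Tm.eval_con, app_s, app_k]; rfl
  | .var (.vs y) => simp only [Tm.lam, Var.lam, Tm.eval_app, Tm.eval_con, app_k]; rfl
  | .con c => simp only [Tm.lam, Tm.eval_app, Tm.eval_con, app_k]
  | .app s t =>
    simp only [Tm.lam, Tm.eval_app, Tm.eval_con, app_s, eval_lam s, eval_lam t]

end Eval

instance : CommSemiring (M.D .nat) where
  add_assoc a b c := (M.normal.eq_iff _ _).1 (axm .add_assoc (env3 a b c))
  zero_add a := ((M.normal.eq_iff _ _).1 (axm .add_comm (env2 0 a))).trans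
    ((M.normal.eq_iff _ _).1 (axm .add_zero (env1 a)))
  add_zero a := (M.normal.eq_iff _ _).1 (axm .add_zero (env1 a))
  add_comm a b := (M.normal.eq_iff _ _).1 (axm .add_comm (env2 a b))
  left_distrib a b c := (M.normal.eq_iff _ _).1 (axm .mul_add (env3 a b c))
  right_distrib a b c := by
    have comm : ∀ a b : M.D .nat, a * b = b * a := fun a b =>
      (M.normal.eq_iff _ _).1 (axm .mul_comm (env2 a b))
    rw [comm, comm a, comm b]
    exact (M.normal.eq_iff _ _).1 (axm .mul_add (env3 c a b))
  zero_mul a := ((M.normal.eq_iff _ _).1 (axm .mul_comm (env2 0 a))).trans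
    ((M.normal.eq_iff _ _).1 (axm .mul_zero (env1 a)))
  mul_zero a := (M.normal.eq_iff _ _).1 (axm .mul_zero (env1 a))
  mul_assoc a b c := (M.normal.eq_iff _ _).1 (axm .mul_assoc (env3 a b c))
  one_mul a := ((M.normal.eq_iff _ _).1 (axm .mul_comm (env2 1 a))).trans
    ((M.normal.eq_iff _ _).1 (axm .mul_one (env1 a)))
  mul_one a := (M.normal.eq_iff _ _).1 (axm .mul_one (env1 a))
  mul_comm a b := (M.normal.eq_iff _ _).1 (axm .mul_comm (env2 a b))
  nsmul := nsmulRec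

theorem lt_irrefl' (a : M.D .nat) : ¬ a < a := axm .lt_irrefl (env1 a)

theorem lt_trans' {a b c : M.D .nat} (h : a < b) (h' : b < c) : a < c :=
  axm .lt_trans (env3 a b c) h h'

theorem lt_total' (a b : M.D .nat) : a < b ∨ a = b ∨ b < a := by
  simpa using axm .lt_total (env2 a b)

open Classical in
noncomputable instance : LinearOrder (M.D .nat) where
  le_refl a := .inr rfl
  le_trans a b c := by
    rintro (h | rfl) (h' | rfl)
    · exact .inl (lt_trans' h h')
    · exact .inl h
    · exact .inl h'
    · exact .inr rfl
  le_antisymm a b := by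
    rintro (h | rfl) (h' | h')
    · exact absurd (lt_trans' h h') (lt_irrefl' a)
    · exact h'.symm
    · rfl
    · rfl
  lt_iff_le_not_ge a b := by
    refine ⟨fun h => ⟨.inl h, ?_⟩, fun ⟨h, h'⟩ => h.resolve_right fun e => h' (.inr e.symm)⟩
    rintro (h' | rfl)
    · exact lt_irrefl' a (lt_trans' h h')
    · exact lt_irrefl' _ h
  le_total a b := by
    rcases lt_total' a b with h | h | h
    · exact .inl (.inl h)
    · exact .inl (.inr h)
    · exact .inr (.inl h)
  toDecidableLE := inferInstance

theorem lt_add_one_iff' {a b : M.D .nat} : a < b + 1 ↔ a ≤ b := by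
  have h := axm .lt_succ (env2 a b)
  simp only [Fm.sat_iff, Fm.sat_or, sat_lt, sat_eq] at h
  exact h

theorem zero_le' (a : M.D .nat) : 0 ≤ a := not_lt.1 (axm .not_lt_zero (env1 a))

theorem add_lt_add_right' {a b : M.D .nat} (h : a < b) (c : M.D .nat) : a + c < b + c :=
  axm .add_lt_add (env3 a b c) h

theorem mul_lt_mul_right' {a b c : M.D .nat} (hc : 0 < c) (h : a < b) : a * c < b * c :=
  axm .mul_lt_mul (env3 a b c) hc h

instance : IsStrictOrderedRing (M.D .nat) where
  add_le_add_left a b h c := by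
    rcases h.lt_or_eq with h | rfl
    · exact (add_lt_add_right' h c).le
    · exact le_rfl
  le_of_add_le_add_left a b c h := by
    by_contra h'
    have := add_lt_add_right' (not_le.1 h') a
    rw [add_comm c, add_comm b] at this
    exact absurd h this.not_ge
  zero_le_one := zero_le' _
  exists_pair_ne := ⟨0, 1, ((by simpa using (lt_add_one_iff' (a := (0 : M.D .nat))).2 le_rfl :
    (0 : M.D .nat) < 1)).ne⟩
  mul_lt_mul_of_pos_left a ha b c h := by
    have := mul_lt_mul_right' ha h
    rwa [mul_comm b, mul_comm c] at this
  mul_lt_mul_of_pos_right a ha b c h := mul_lt_mul_right' ha h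

theorem add_one_le_iff' {a b : M.D .nat} : a + 1 ≤ b ↔ a < b := by
  rw [← lt_add_one_iff', add_lt_add_iff_right]

@[simp] theorem sat_le {Γ : Ctx} (ρ : Env M.toStr Γ) (s t : Tm Γ .nat) :
    (HOA.le s t).sat ρ ↔ s.eval ρ ≤ t.eval ρ := by
  rw [HOA.le, Fm.sat_not, sat_lt, not_lt]

/-! ### Induction and choice -/

end Model

section QF

variable {Γ : Ctx} (φ ψ : Fm Γ) (s t : Tm Γ .nat)

@[simp] theorem Fm.qf_bot : (Fm.bot : Fm Γ).QF := trivial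

@[simp] theorem Fm.qf_eq : (Fm.eq s t).QF := trivial

@[simp] theorem Fm.qf_lt : (Fm.lt s t).QF := trivial

@[simp] theorem Fm.qf_imp : (Fm.imp φ ψ).QF ↔ φ.QF ∧ ψ.QF := Iff.rfl

@[simp] theorem Fm.qf_not : φ.not.QF ↔ φ.QF := by simp [Fm.not]

@[simp] theorem Fm.qf_and : (φ.and ψ).QF ↔ φ.QF ∧ ψ.QF := by simp [Fm.and]

@[simp] theorem Fm.qf_or : (φ.or ψ).QF ↔ φ.QF ∧ ψ.QF := by simp [Fm.or]

@[simp] theorem qf_le : (HOA.le s t).QF := by simp [HOA.le]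

end QF

namespace Model

variable {M : Model}

/-- The numbers of the model may be nonstandard, so this is the only induction available over them.
Properties proved by induction must therefore be expressed by quantifier-free formulas, with the
auxiliary functions as terms. -/
theorem induction_qf {Γ : Ctx} (φ : Fm (.nat :: Γ)) (hφ : φ.QF) (ρ : Env M.toStr Γ)
    (h0 : φ.sat (Env.cons 0 ρ))
    (hs : ∀ n, φ.sat (Env.cons n ρ) → φ.sat (Env.cons (n + 1) ρ)) (n : M.D .nat) :
    φ.sat (Env.cons n ρ) := by
  refine axm (.ind φ hφ) ρ ((Fm.sat_inst _ _ _).2 h0) (fun n hn => ?_) n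
  refine (Fm.sat_subst _ _ _).2 ?_
  have : (fun σ x => (Sub.next σ x).eval (Env.cons n ρ)) = Env.cons (M := M.toStr) (n + 1) ρ := by
    funext σ x
    cases x <;> rfl
  exact this ▸ hs n hn

theorem choice_qf {Γ : Ctx} (φ : Fm (.nat :: .one :: Γ)) (hφ : φ.QF) (ρ : Env M.toStr Γ)
    (h : ∀ g : M.D .one, ∃ n, φ.sat (Env.cons n (Env.cons g ρ))) :
    ∃ Y : M.D .two, ∀ g : M.D .one, φ.sat (Env.cons (M.app Y g) (Env.cons g ρ)) := by
  have := axm (.qfac φ hφ) ρ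
  simp only [Fm.sat_imp, Fm.sat_all, Fm.sat_ex] at this
  obtain ⟨Y, hY⟩ := this h
  refine ⟨Y, fun g => ?_⟩
  have h1 := (Fm.sat_subst _ _ _).1 (hY g)
  have : (fun σ x => (Sub.choice σ x).eval (Env.cons g (Env.cons Y ρ))) =
      Env.cons (M := M.toStr) (M.app Y g) (Env.cons g ρ) := by
    funext σ x
    cases x with
    | vz => rfl
    | vs x => cases x <;> rfl
  exact this ▸ h1

/-! ### Primitive recursion -/

/-- Primitive recursion in the model. -/
def recur (b : M.D .nat) (f : M.D (.arr .nat .one)) (n : M.D .nat) : M.D .nat :=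
  M.app (M.app (M.app (M.con (.recursor .nat)) f) b) n

theorem recur_zero (b : M.D .nat) (f : M.D (.arr .nat .one)) : recur b f 0 = b :=
  (M.normal.eq_iff _ _).1 (axm .rec_zero (env2 b f))

theorem recur_succ (b : M.D .nat) (f : M.D (.arr .nat .one)) (n : M.D .nat) :
    recur b f (n + 1) = M.app (M.app f n) (recur b f n) :=
  (M.normal.eq_iff _ _).1 (axm .rec_succ (env3 n b f))

theorem eval_primRec {Γ : Ctx} (ρ : Env M.toStr Γ) (b : Tm Γ .nat)
    (s : Tm (.nat :: .nat :: Γ) .nat) (n : Tm Γ .nat) :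
    (primRec b s n).eval ρ = recur (b.eval ρ) (s.lam.lam.eval ρ) (n.eval ρ) := rfl

/-- Primitive recursion only depends on the values of the step function. -/
theorem recur_congr {Γ Δ : Ctx} {ρ : Env M.toStr Γ} {ρ' : Env M.toStr Δ}
    {s : Tm (.nat :: .nat :: Γ) .nat} {s' : Tm (.nat :: .nat :: Δ) .nat}
    (h : ∀ i g, s.eval (Env.cons g (Env.cons i ρ)) = s'.eval (Env.cons g (Env.cons i ρ')))
    (b n : M.D .nat) : recur b (s.lam.lam.eval ρ) n = recur b (s'.lam.lam.eval ρ') n := by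
  congr 1
  refine M.normal.ext _ _ fun i => M.normal.ext _ _ fun g => ?_
  simp only [eval_lam, h]

theorem recur_step {Γ : Ctx} {ρ : Env M.toStr Γ} (ρ' : Env M.toStr Γ)
    {s : Tm (.nat :: .nat :: Γ) .nat}
    (h : ∀ i g, s.eval (Env.cons g (Env.cons i ρ)) = s.eval (Env.cons g (Env.cons i ρ')))
    {b n c : M.D .nat} (hc : c = recur b (s.lam.lam.eval ρ') n) :
    recur b (s.lam.lam.eval ρ) (n + 1) = s.eval (Env.cons c (Env.cons n ρ)) := by
  rw [recur_succ, eval_lam, eval_lam, recur_congr h, hc]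

/-- The predecessor in the model. -/
def prd (n : M.D .nat) : M.D .nat := (HOA.pred v0).eval (env1 n)

@[simp] theorem eval_pred {Γ : Ctx} (ρ : Env M.toStr Γ) (t : Tm Γ .nat) :
    (HOA.pred t).eval ρ = prd (t.eval ρ) :=
  recur_congr (fun _ _ => rfl) _ _

theorem prd_zero : prd (0 : M.D .nat) = 0 := recur_zero _ _

theorem prd_succ (n : M.D .nat) : prd (n + 1) = n := by
  refine (recur_succ _ _ _).trans ?_
  simp

theorem eq_zero_or_eq_prd_add_one (n : M.D .nat) : n = 0 ∨ n = prd n + 1 := by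
  have := induction_qf (.or (.eq v0 zero) (.eq v0 (succ (HOA.pred v0)))) (by simp)
    (Env.nil : Env M.toStr []) (by simp) (fun n _ => by simp [prd_succ]) n
  simpa using this

instance : _root_.Sub (M.D .nat) := ⟨fun a b => (monus v0 v1).eval (env2 a b)⟩

@[simp] theorem eval_monus {Γ : Ctx} (ρ : Env M.toStr Γ) (s t : Tm Γ .nat) :
    (monus s t).eval ρ = s.eval ρ - t.eval ρ :=
  recur_congr (fun _ _ => by simp) _ _

theorem sub_zero' (a : M.D .nat) : a - 0 = a := recur_zero _ _

theorem sub_succ' (a b : M.D .nat) : a - (b + 1) = prd (a - b) := by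
  refine (recur_succ _ _ _).trans ?_
  simp only [eval_lam, eval_pred]
  rfl

/-- Both halves go through a single induction on b, since the second half at b = a follows from the
first half at the predecessor of b. -/
theorem sub_spec (a b : M.D .nat) : (b ≤ a → a - b + b = a) ∧ (a ≤ b → a - b = 0) := by
  have := induction_qf (.and (.imp (HOA.le v0 v1) (.eq (add (monus v1 v0) v0) v1))
    (.imp (HOA.le v1 v0) (.eq (monus v1 v0) zero)))
    (by simp) (env1 a)
    (by simpa [sub_zero'] using fun h => le_antisymm h (zero_le' a)) (fun n hn => ?_) b
  · simpa using this
  · simp only [Fm.sat_and, Fm.sat_imp, sat_le, sat_eq, Tm.eval_var, Env.cons_vz, Env.cons_vs,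
      eval_add, eval_monus, eval_zero, sub_succ'] at hn ⊢
    constructor
    · intro h
      have h1 := hn.1 ((lt_add_one_iff'.2 le_rfl).le.trans h)
      rcases eq_zero_or_eq_prd_add_one (a - n) with h2 | h2
      · rw [h2, zero_add] at h1
        exact absurd h1 (add_one_le_iff'.1 h).ne
      · rw [h2] at h1
        rw [add_comm n 1, ← add_assoc]
        exact h1
    · intro h
      rcases h.lt_or_eq with h | rfl
      · rw [hn.2 (lt_add_one_iff'.1 h), prd_zero]
      · have h1 := hn.1 (lt_add_one_iff'.2 le_rfl).le
        have : n + 1 - n = 1 := by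
          rw [add_comm n 1] at h1 ⊢
          exact add_right_cancel h1
        rw [this]
        simpa using prd_succ (0 : M.D .nat)

instance : CanonicallyOrderedAdd (M.D .nat) where
  exists_add_of_le {a b} h := ⟨b - a, by rw [add_comm, (sub_spec b a).1 h]⟩
  le_add_self a b := le_add_of_nonneg_left (zero_le' b)
  le_self_add a b := le_add_of_nonneg_right (zero_le' b)

instance : OrderedSub (M.D .nat) where
  tsub_le_iff_right a b c := by
    rcases le_total b a with h | h
    · rw [← add_le_add_iff_right b, (sub_spec a b).1 h]
    · rw [(sub_spec a b).2 h]
      exact ⟨fun _ => h.trans (le_add_of_nonneg_left (zero_le' c)), fun _ => zero_le' c⟩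

theorem eq_zero_or_one_le (a : M.D .nat) : a = 0 ∨ 1 ≤ a := by
  rcases (zero_le' a).eq_or_lt with h | h
  · exact .inl h.symm
  · exact .inr (by simpa using add_one_le_iff'.2 h)

open Classical in
/-- The truth value of a proposition as a number. -/
noncomputable def ind (p : Prop) : M.D .nat := if p then 1 else 0

theorem ind_pos {p : Prop} (h : p) : (ind p : M.D .nat) = 1 := if_pos h

theorem ind_neg {p : Prop} (h : ¬ p) : (ind p : M.D .nat) = 0 := if_neg h

theorem one_sub_one_sub (a : M.D .nat) : 1 - (1 - a) = ind (a ≠ 0) := by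
  by_cases h : a = 0
  · rw [ind_neg (not_not.2 h), h, sub_zero', tsub_self]
  · rw [ind_pos h, tsub_eq_zero_of_le ((eq_zero_or_one_le _).resolve_left h), sub_zero']

@[simp] theorem eval_ltInd {Γ : Ctx} (ρ : Env M.toStr Γ) (s t : Tm Γ .nat) :
    (ltInd s t).eval ρ = ind (s.eval ρ < t.eval ρ) := by
  simp only [ltInd, eval_monus, eval_one, one_sub_one_sub, Ne, tsub_eq_zero_iff_le, not_le]

/-- Powers of two in the model. -/
def twoPow (n : M.D .nat) : M.D .nat := (pow2 v0).eval (env1 n)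

@[simp] theorem eval_two {Γ : Ctx} (ρ : Env M.toStr Γ) : (two : Tm Γ .nat).eval ρ = 2 :=
  one_add_one_eq_two

@[simp] theorem eval_pow2 {Γ : Ctx} (ρ : Env M.toStr Γ) (t : Tm Γ .nat) :
    (pow2 t).eval ρ = twoPow (t.eval ρ) :=
  recur_congr (fun _ _ => by simp) _ _

theorem twoPow_zero : twoPow (0 : M.D .nat) = 1 := recur_zero _ _

theorem twoPow_succ (n : M.D .nat) : twoPow (n + 1) = 2 * twoPow n := by
  refine (recur_succ _ _ _).trans ?_
  simp only [eval_lam, eval_mul, eval_two]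
  rfl

theorem twoPow_pos (n : M.D .nat) : 0 < twoPow n := by
  have := induction_qf (.lt zero (pow2 v0)) (by simp) (Env.nil : Env M.toStr [])
    (by simp [twoPow_zero]) (fun n hn => ?_) n
  · simpa using this
  · simp only [sat_lt, eval_zero, eval_pow2, Tm.eval_var, Env.cons_vz, twoPow_succ] at hn ⊢
    exact mul_pos two_pos hn

end Model

end HOA

namespace HOA

namespace Model

variable {M : Model}

/-! ### Rational and real numbers in a model -/

section Codes

variable {Γ : Ctx} (ρ : Env M.toStr Γ) (s t : Tm Γ .nat)

def parityFn (n : M.D .nat) : M.D .nat := (parity v0).eval (env1 n)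

@[simp] theorem eval_parity : (parity t).eval ρ = parityFn (t.eval ρ) :=
  recur_congr (fun _ _ => by simp) _ _

def halfFn (n : M.D .nat) : M.D .nat := (half v0).eval (env1 n)

@[simp] theorem eval_half : (half t).eval ρ = halfFn (t.eval ρ) :=
  recur_congr (fun _ _ => by simp) _ _

def triFn (n : M.D .nat) : M.D .nat := (tri v0).eval (env1 n)

@[simp] theorem eval_tri : (tri t).eval ρ = triFn (t.eval ρ) :=
  recur_congr (fun _ _ => by simp) _ _

def triRootFn (n : M.D .nat) : M.D .nat := (triRoot v0).eval (env1 n)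

@[simp] theorem eval_triRoot : (triRoot t).eval ρ = triRootFn (t.eval ρ) :=
  recur_congr (fun _ _ => by simp) _ _

def posNumFn (q : M.D .nat) : M.D .nat := (posNum v0).eval (env1 q)

@[simp] theorem eval_posNum : (posNum t).eval ρ = posNumFn (t.eval ρ) := by
  simp [posNum, posNumFn, unpairLeft, unpairRight]

def negNumFn (q : M.D .nat) : M.D .nat := (negNum v0).eval (env1 q)

@[simp] theorem eval_negNum : (negNum t).eval ρ = negNumFn (t.eval ρ) := by
  simp [negNum, negNumFn, unpairLeft, unpairRight]

def denFn (q : M.D .nat) : M.D .nat := (den v0).eval (env1 q)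

@[simp] theorem eval_den : (den t).eval ρ = denFn (t.eval ρ) := by
  simp [den, denFn, unpairRight]

@[simp] theorem eval_cden : (cden s t).eval ρ = denFn (s.eval ρ) * denFn (t.eval ρ) := by
  simp [cden]

def distNumFn (q r : M.D .nat) : M.D .nat := (distNum v0 v1).eval (env2 q r)

@[simp] theorem eval_distNum : (distNum s t).eval ρ = distNumFn (s.eval ρ) (t.eval ρ) := by
  simp [distNum, distNumFn, absDiff, diffPos, diffNeg]

end Codes

theorem denFn_pos (q : M.D .nat) : 0 < denFn q := by
  simp [denFn, den]

open OrderedFraction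

/-- The ordered field of fractions of the numbers of a model. -/
noncomputable abbrev Fr (M : Model) : Type := Frac (M.D .nat)

theorem of_lt_of {a b : M.D .nat} : of a < of b ↔ a < b := of_strictMono.lt_iff_lt

theorem of_le_of {a b : M.D .nat} : of a ≤ of b ↔ a ≤ b := of_strictMono.le_iff_le

theorem of_pos {a : M.D .nat} (h : 0 < a) : 0 < of a := by
  simpa using of_lt_of.2 h

/-- The rational number with the code `q`. -/
noncomputable def val (q : M.D .nat) : Fr M := (of (posNumFn q) - of (negNumFn q)) / of (denFn q)

theorem of_denFn_pos (q : M.D .nat) : 0 < of (denFn q) := of_pos (denFn_pos q)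

theorem of_absDiff (a b : M.D .nat) : of ((a - b) + (b - a)) = |of a - of b| := by
  rcases le_total a b with h | h
  · obtain ⟨c, rfl⟩ := exists_add_of_le h
    rw [tsub_eq_zero_of_le h, add_tsub_cancel_left, zero_add, map_add, sub_add_cancel_left, abs_neg,
      abs_of_nonneg (of_nonneg c)]
  · obtain ⟨c, rfl⟩ := exists_add_of_le h
    rw [tsub_eq_zero_of_le h, add_tsub_cancel_left, add_zero, map_add, add_sub_cancel_left,
      abs_of_nonneg (of_nonneg c)]

theorem of_distNumFn (q r : M.D .nat) :
    of (distNumFn q r) = |val q - val r| * (of (denFn q) * of (denFn r)) := by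
  have hq := of_denFn_pos q
  have hr := of_denFn_pos r
  have : of (distNumFn q r) = |of (posNumFn q * denFn r + negNumFn r * denFn q) -
      of (negNumFn q * denFn r + posNumFn r * denFn q)| := by
    rw [← of_absDiff]
    simp [distNumFn, distNum, absDiff, diffPos, diffNeg]
  rw [this, ← abs_of_pos (mul_pos hq hr), ← abs_mul]
  congr 1
  simp only [val, map_add, map_mul]
  field_simp
  ring

theorem of_diff (q r : M.D .nat) :
    of (posNumFn q * denFn r + negNumFn r * denFn q) -
      of (negNumFn q * denFn r + posNumFn r * denFn q) =
        (val q - val r) * (of (denFn q) * of (denFn r)) := by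
  have hq := of_denFn_pos q
  have hr := of_denFn_pos r
  simp only [val, map_add, map_mul]
  field_simp
  ring

/-- Negative powers of two. -/
noncomputable def eps (n : M.D .nat) : Fr M := (of (twoPow n))⁻¹

theorem eps_pos (n : M.D .nat) : 0 < eps n := inv_pos.2 (of_pos (twoPow_pos n))

theorem eps_succ (n : M.D .nat) : eps (n + 1) = eps n / 2 := by
  rw [eps, eps, twoPow_succ, map_mul, mul_inv, map_ofNat]
  ring

theorem lt_iff_of_scale {a b x y p : Fr M} (hp : 0 < p) (hx : x = a * p) (hy : y = b * p) :
    x < y ↔ a < b := by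
  rw [hx, hy, mul_lt_mul_iff_left₀ hp]

theorem le_iff_of_scale {a b x y p : Fr M} (hp : 0 < p) (hx : x = a * p) (hy : y = b * p) :
    x ≤ y ↔ a ≤ b := by
  rw [hx, hy, mul_le_mul_iff_left₀ hp]

/-! ### Inequalities between rationals as quantifier-free inequalities between numbers -/

section Comparison

variable (q r n k : M.D .nat)

/-- Multiplication by the denominators and the power of two clears all fractions. Such equivalences
make estimates in the field accessible to quantifier-free induction and choice, and conversely make
the formulas of the language accessible to field arithmetic. -/
theorem dist_lt_iff : distNumFn q r * twoPow n < denFn q * denFn r ↔ |val q - val r| < eps n := by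
  have hc := mul_pos (of_denFn_pos q) (of_denFn_pos r)
  have hn := of_pos (twoPow_pos n)
  rw [← of_lt_of]
  refine lt_iff_of_scale (mul_pos hc hn) ?_ ?_
  · simp only [map_mul, of_distNumFn]; ring
  · simp only [map_mul, eps]; field_simp

theorem dist_le_iff :
    distNumFn q r * twoPow n ≤ 2 * (denFn q * denFn r) ↔ |val q - val r| ≤ 2 * eps n := by
  have hc := mul_pos (of_denFn_pos q) (of_denFn_pos r)
  have hn := of_pos (twoPow_pos n)
  rw [← of_le_of]
  refine le_iff_of_scale (mul_pos hc hn) ?_ ?_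
  · simp only [map_mul, of_distNumFn]; ring
  · simp only [map_mul, eps, map_ofNat]; field_simp

theorem le_dist_iff :
    denFn q * denFn r ≤ 2 * (distNumFn q r * twoPow n) ↔ eps n ≤ 2 * |val q - val r| := by
  have hc := mul_pos (of_denFn_pos q) (of_denFn_pos r)
  have hn := of_pos (twoPow_pos n)
  rw [← of_le_of]
  refine le_iff_of_scale (mul_pos hc hn) ?_ ?_
  · simp only [map_mul, eps]; field_simp
  · simp only [map_mul, of_distNumFn, map_ofNat]; ring

theorem near_iff : (distNumFn q r * twoPow n + 2 * (denFn q * denFn r)) * twoPow k <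
    denFn q * denFn r * twoPow n ↔ |val q - val r| + 2 * eps n < eps k := by
  have hc := mul_pos (of_denFn_pos q) (of_denFn_pos r)
  have hn := of_pos (twoPow_pos n)
  have hk := of_pos (twoPow_pos k)
  rw [← of_lt_of]
  refine lt_iff_of_scale (mul_pos (mul_pos hc hn) hk) ?_ ?_
  · simp only [map_mul, map_add, of_distNumFn, map_ofNat, eps]; field_simp
  · simp only [map_mul, eps]; field_simp

theorem cauchy_iff :
    distNumFn q r * twoPow k * twoPow n + denFn q * denFn r * twoPow n ≤
      denFn q * denFn r * twoPow k ↔ |val q - val r| + eps k ≤ eps n := by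
  have hc := mul_pos (of_denFn_pos q) (of_denFn_pos r)
  have hn := of_pos (twoPow_pos n)
  have hk := of_pos (twoPow_pos k)
  rw [← of_le_of]
  refine le_iff_of_scale (mul_pos (mul_pos hc hn) hk) ?_ ?_
  · simp only [map_mul, map_add, of_distNumFn, eps]; field_simp
  · simp only [map_mul, eps]; field_simp

theorem diff_lt_iff :
    (negNumFn q * denFn r + posNumFn r * denFn q) * twoPow n + 2 * (denFn q * denFn r) <
      (posNumFn q * denFn r + negNumFn r * denFn q) * twoPow n ↔
        2 * eps n < val q - val r := by
  have hc := mul_pos (of_denFn_pos q) (of_denFn_pos r)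
  have hn := of_pos (twoPow_pos n)
  rw [← of_lt_of, ← sub_lt_sub_iff_right
    (of ((negNumFn q * denFn r + posNumFn r * denFn q) * twoPow n))]
  refine lt_iff_of_scale (mul_pos hc hn) ?_ ?_
  · rw [map_add, add_sub_cancel_left]
    simp only [map_mul, eps, map_ofNat]; field_simp
  · rw [map_mul _ _ (twoPow n), map_mul _ _ (twoPow n), ← sub_mul, of_diff]
    ring

theorem val_nonneg_iff : negNumFn q ≤ posNumFn q ↔ 0 ≤ val q := by
  rw [← of_le_of, val, le_div_iff₀ (of_denFn_pos q), zero_mul, sub_nonneg]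

theorem val_le_one_iff : posNumFn q ≤ negNumFn q + denFn q ↔ val q ≤ 1 := by
  rw [← of_le_of, val, div_le_one (of_denFn_pos q), sub_le_iff_le_add, map_add, add_comm (of _)]

end Comparison

/-! ### Regular sequences -/

/-- The `n`-th rational approximation of the real number `x`. -/
def hatFn (x : M.D .one) (n : M.D .nat) : M.D .nat := (hat v1 v0).eval (env2 n x)

def hatIndexFn (x : M.D .one) (n : M.D .nat) : M.D .nat := (hatIndex v1 v0).eval (env2 n x)

section

variable {Γ : Ctx} (ρ : Env M.toStr Γ) (x : Tm Γ .one) (t : Tm Γ .nat)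

@[simp] theorem eval_hatIndex : (hatIndex x t).eval ρ = hatIndexFn (x.eval ρ) (t.eval ρ) :=
  recur_congr (fun _ _ => by simp) _ _

@[simp] theorem eval_hat : (hat x t).eval ρ = hatFn (x.eval ρ) (t.eval ρ) := by
  simp [hat, hatFn]

end

theorem hatFn_eq (x : M.D .one) (n : M.D .nat) : hatFn x n = M.app x (hatIndexFn x n) := by
  simp [hat, hatFn]

/-- The value of the `n`-th rational approximation of the real number `x`. -/
noncomputable def approx (x : M.D .one) (n : M.D .nat) : Fr M := val (hatFn x n)

/-- The sequence `x` converges fast at the place `n`. -/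
def Regular (x : M.D .one) (n : M.D .nat) : Prop :=
  |val (M.app x n) - val (M.app x (n + 1))| < eps (n + 1)

/-- The step of the recursion that defines `hatIndex`. -/
def hatStep {Γ : Ctx} (x : Tm Γ .one) : Tm (.nat :: .nat :: Γ) .nat :=
  add v0 (mul (monus one (monus v1 v0))
    (ltInd (mul (distNum (.app x.wk.wk v1) (.app x.wk.wk (succ v1))) (pow2 (succ v1)))
      (cden (.app x.wk.wk v1) (.app x.wk.wk (succ v1)))))

theorem eval_hatStep {Γ : Ctx} (ρ : Env M.toStr Γ) (x : Tm Γ .one) (n a : M.D .nat) :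
    (hatStep x).eval (Env.cons a (Env.cons n ρ)) =
      a + (1 - (n - a)) * ind (Regular (x.eval ρ) n) := by
  simp only [hatStep, eval_add, eval_mul, eval_monus, eval_ltInd, eval_one, eval_distNum,
    eval_cden, eval_pow2, eval_succ, Tm.eval_app, Tm.eval_wk, Tm.eval_var, Env.cons_vz, Env.cons_vs,
    dist_lt_iff, Regular]

theorem hatIndexFn_eq (x : M.D .one) (n : M.D .nat) :
    hatIndexFn x n = recur 0 ((hatStep v0).lam.lam.eval (env1 x)) n :=
  recur_congr (s := hatStep v1) (fun _ _ => by simp [eval_hatStep]) _ _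

theorem hatIndexFn_zero (x : M.D .one) : hatIndexFn x 0 = 0 := recur_zero _ _

/-- One step of the search for the first number that does not satisfy a condition. -/
theorem search_step {a n : M.D .nat} (h : a ≤ n) (p : Prop) [Decidable p] :
    a + (1 - (n - a)) * ind p = if a = n ∧ p then n + 1 else a := by
  rcases h.eq_or_lt with rfl | h
  · rw [tsub_self, sub_zero', one_mul]
    by_cases hp : p
    · rw [ind_pos hp, if_pos ⟨rfl, hp⟩]
    · rw [ind_neg hp, if_neg fun h => hp h.2, add_zero]
  · have : 1 - (n - a) = 0 := by
      refine tsub_eq_zero_of_le ((eq_zero_or_one_le _).resolve_left fun h' => ?_)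
      exact h.not_ge (tsub_eq_zero_iff_le.1 h')
    simp [this, h.ne]

theorem hatIndexFn_succ' (x : M.D .one) (n : M.D .nat) : hatIndexFn x (n + 1) =
    hatIndexFn x n + (1 - (n - hatIndexFn x n)) * ind (Regular x n) := by
  rw [hatIndexFn_eq, hatIndexFn_eq, recur_succ, eval_lam, eval_lam, eval_hatStep]
  rfl

open Classical in
theorem hatIndexFn_le (x : M.D .one) (n : M.D .nat) : hatIndexFn x n ≤ n := by
  have := induction_qf (HOA.le (hatIndex v1 v0) v0) (by simp) (env1 x)
    (by simp [hatIndexFn_zero]) (fun n hn => ?_) n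
  · simpa using this
  · simp only [sat_le, eval_hatIndex, Tm.eval_var, Env.cons_vz, Env.cons_vs] at hn ⊢
    rw [hatIndexFn_succ', search_step hn]
    split_ifs
    · exact le_rfl
    · exact hn.trans (lt_add_one_iff'.2 le_rfl).le

open Classical in
theorem hatIndexFn_succ (x : M.D .one) (n : M.D .nat) : hatIndexFn x (n + 1) =
    if hatIndexFn x n = n ∧ Regular x n then n + 1 else hatIndexFn x n := by
  rw [hatIndexFn_succ', search_step (hatIndexFn_le x n)]

/-- Either the index advances, which it does only where x converges fast, or it stays and the two
approximations coincide. Hence the estimate holds for every x of type 1. -/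
theorem approx_step (x : M.D .one) (n : M.D .nat) : |approx x n - approx x (n + 1)| < eps (n + 1) := by
  rw [approx, approx, hatFn_eq, hatFn_eq, hatIndexFn_succ]
  split_ifs with h
  · rw [h.1]
    exact h.2
  · simpa using eps_pos _

theorem hatFn_eq_self {x : M.D .one} (hx : ∀ n, Regular x n) (n : M.D .nat) :
    hatFn x n = M.app x n := by
  have := induction_qf (.eq (hatIndex v1 v0) v0) (by simp) (env1 x)
    (by simp [hatIndexFn_zero]) (fun n hn => ?_) n
  · simp only [sat_eq, eval_hatIndex, Tm.eval_var, Env.cons_vz, Env.cons_vs] at this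
    rw [hatFn_eq, this]
  · simp only [sat_eq, eval_hatIndex, Tm.eval_var, Env.cons_vz, Env.cons_vs] at hn ⊢
    rw [hatIndexFn_succ, if_pos ⟨hn, hx n⟩]

/-- The geometric series is summed by induction on d. The summand eps (n + d) on the left pays for
the next step, and `cauchy_iff` makes the inequality quantifier-free. -/
theorem approx_cauchy_add (x : M.D .one) (n d : M.D .nat) :
    |approx x n - approx x (n + d)| + eps (n + d) ≤ eps n := by
  have := induction_qf (Γ := [.nat, .one]) (HOA.le
    (add (mul (mul (distNum (hat v2 v1) (hat v2 (add v1 v0))) (pow2 (add v1 v0))) (pow2 v1))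
      (mul (cden (hat v2 v1) (hat v2 (add v1 v0))) (pow2 v1)))
    (mul (cden (hat v2 v1) (hat v2 (add v1 v0))) (pow2 (add v1 v0)))) (by simp) (env2 n x)
    ?_ (fun d hd => ?_) d
  · simpa [cauchy_iff, approx] using this
  · simp only [sat_le, eval_add, eval_mul, eval_distNum, eval_cden, eval_hat, eval_pow2, Tm.eval_var,
      Env.cons_vz, Env.cons_vs, cauchy_iff, add_zero, sub_self, abs_zero, zero_add, le_refl]
  · simp only [sat_le, eval_add, eval_mul, eval_distNum, eval_cden, eval_hat, eval_pow2, Tm.eval_var,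
      Env.cons_vz, Env.cons_vs, cauchy_iff] at hd ⊢
    have h1 := approx_step x (n + d)
    have h2 := abs_sub_le (approx x n) (approx x (n + d)) (approx x (n + (d + 1)))
    rw [← add_assoc] at h2 ⊢
    rw [eps_succ] at h1 ⊢
    change |approx x n - approx x (n + d)| + eps (n + d) ≤ eps n at hd
    change |approx x n - approx x (n + d + 1)| + _ ≤ eps n
    linarith

theorem approx_cauchy (x : M.D .one) {n m : M.D .nat} (h : n ≤ m) :
    |approx x n - approx x m| ≤ eps n - eps m := by
  obtain ⟨d, rfl⟩ := exists_add_of_le h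
  have := approx_cauchy_add x n d
  linarith

theorem approx_sub_approx_le (x : M.D .one) (n m : M.D .nat) :
    |approx x n - approx x m| ≤ eps n + eps m := by
  have hn := eps_pos n
  have hm := eps_pos m
  rcases le_total n m with h | h
  · have := approx_cauchy x h
    linarith
  · have := approx_cauchy x h
    rw [abs_sub_comm] at this
    linarith

/-! ### The relations between real numbers -/

def REq (x y : M.D .one) : Prop := ∀ n, |approx x n - approx y n| ≤ 2 * eps n

def RNear (x y : M.D .one) (k : M.D .nat) : Prop :=
  ∃ n, |approx x n - approx y n| + 2 * eps n < eps k

def InUnit (x : M.D .one) : Prop := ∀ n, -(2 * eps n) ≤ approx x n ∧ approx x n ≤ 1 + 2 * eps n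

section

variable {Γ : Ctx} (ρ : Env M.toStr Γ) (x y : Tm Γ .one) (k : Tm Γ .nat)

theorem sat_realEq : (realEq x y).sat ρ ↔ REq (x.eval ρ) (y.eval ρ) := by
  simp [realEq, REq, dist_le_iff, approx]

theorem sat_realNear : (realNear x y k).sat ρ ↔ RNear (x.eval ρ) (y.eval ρ) (k.eval ρ) := by
  simp [realNear, RNear, near_iff, approx]

theorem sat_realLt :
    (realLt x y).sat ρ ↔ ∃ n, 2 * eps n < approx (y.eval ρ) n - approx (x.eval ρ) n := by
  simp [realLt, diffNeg, diffPos, diff_lt_iff, approx]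

end

/-! ### Recursion equations for the coding functions -/

theorem triFn_zero : triFn (0 : M.D .nat) = 0 := recur_zero _ _

theorem triFn_succ (n : M.D .nat) : triFn (n + 1) = triFn n + (n + 1) :=
  (recur_step (env1 n) (c := triFn n) (fun _ _ => by simp) rfl).trans (by simp)

theorem parityFn_zero : parityFn (0 : M.D .nat) = 0 := recur_zero _ _

theorem parityFn_succ (n : M.D .nat) : parityFn (n + 1) = 1 - parityFn n :=
  (recur_step (env1 n) (c := parityFn n) (fun _ _ => by simp) rfl).trans (by simp)

theorem halfFn_zero : halfFn (0 : M.D .nat) = 0 := recur_zero _ _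

theorem halfFn_succ (n : M.D .nat) : halfFn (n + 1) = halfFn n + parityFn n :=
  (recur_step (env1 n) (c := halfFn n) (fun _ _ => by simp) rfl).trans (by simp)

theorem triRootFn_zero : triRootFn (0 : M.D .nat) = 0 := recur_zero _ _

theorem triRootFn_succ (n : M.D .nat) : triRootFn (n + 1) =
    triRootFn n + ind (triFn (triRootFn n + 1) < n + 1 + 1) :=
  (recur_step (env1 n) (c := triRootFn n) (fun _ _ => by simp) rfl).trans (by simp)

end Model

end HOA

namespace HOA

namespace Model

variable {M : Model}

open OrderedFraction

/-! ### Constant sequences and the unit interval -/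

/-- The constant sequence with the value `q`. -/
def const (q : M.D .nat) : M.D .one := M.app (M.con (.k .nat .nat)) q

theorem app_const (q n : M.D .nat) : M.app (const q) n = q := app_k q n

theorem hatFn_of_const {x : M.D .one} {q : M.D .nat} (h : ∀ n, M.app x n = q) (n : M.D .nat) :
    hatFn x n = q := by
  rw [hatFn_eq, h]

@[simp] theorem approx_const (q n : M.D .nat) : approx (const q) n = val q := by
  rw [approx, hatFn_of_const (app_const q)]

theorem posNumFn_eq (q : M.D .nat) : posNumFn q =
    (1 - parityFn (triRootFn q - (q - triFn (triRootFn q)))) *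
      halfFn (triRootFn q - (q - triFn (triRootFn q))) := by
  simp [posNumFn, posNum, unpairLeft, unpairRight]

theorem negNumFn_eq (q : M.D .nat) : negNumFn q =
    parityFn (triRootFn q - (q - triFn (triRootFn q))) *
      (halfFn (triRootFn q - (q - triFn (triRootFn q))) + 1) := by
  simp [negNumFn, negNum, unpairLeft, unpairRight]

theorem denFn_eq (q : M.D .nat) : denFn q = (q - triFn (triRootFn q)) + 1 := by
  simp [denFn, den, unpairRight]

theorem val_zero : val (0 : M.D .nat) = 0 := by
  simp [val, posNumFn_eq, negNumFn_eq, triRootFn_zero, triFn_zero, parityFn_zero, halfFn_zero]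

theorem triFn_one : triFn (1 : M.D .nat) = 1 := by
  have := triFn_succ (0 : M.D .nat)
  simpa [triFn_zero] using this

theorem triFn_two : triFn (1 + 1 : M.D .nat) = 1 + 1 + 1 := by
  rw [triFn_succ, triFn_one, add_assoc]

/-- The real number 1 is the constant sequence of codes `pair two zero`, that is, 3. The codes 0 and
3 are the only ones that are ever decoded explicitly; the general inversion of the pairing function
is not needed. -/
theorem triRootFn_three : triRootFn (1 + 1 + 1 : M.D .nat) = 1 + 1 := by
  have h01 : (1 : M.D .nat) < 1 + 1 := lt_add_one _
  have h1 : triRootFn (1 : M.D .nat) = 1 := by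
    have := triRootFn_succ (0 : M.D .nat)
    rw [triRootFn_zero, zero_add, zero_add, triFn_one, ind_pos h01] at this
    simpa using this
  have h2 : triRootFn (1 + 1 : M.D .nat) = 1 := by
    rw [triRootFn_succ, h1, triFn_two, ind_neg (lt_irrefl _), add_zero]
  rw [triRootFn_succ, h2, triFn_two, ind_pos (lt_add_one _)]

theorem parityFn_one : parityFn (1 : M.D .nat) = 1 := by
  have := parityFn_succ (0 : M.D .nat)
  simpa [parityFn_zero, sub_zero'] using this

theorem halfFn_one : halfFn (1 : M.D .nat) = 0 := by
  have := halfFn_succ (0 : M.D .nat)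
  simpa [parityFn_zero, halfFn_zero] using this

theorem val_three : val (1 + 1 + 1 : M.D .nat) = 1 := by
  have h : (1 + 1 : M.D .nat) - 0 = 1 + 1 := sub_zero' _
  rw [val, posNumFn_eq, negNumFn_eq, denFn_eq, triRootFn_three, triFn_two, tsub_self, h,
    parityFn_succ, halfFn_succ, parityFn_one, halfFn_one, tsub_self, sub_zero']
  simp

section

variable {Γ : Ctx} (ρ : Env M.toStr Γ) (x y : Tm Γ .one)

theorem approx_realZero (n : M.D .nat) : approx ((realZero : Tm Γ .one).eval ρ) n = 0 := by
  rw [approx, hatFn_of_const (q := 0), val_zero]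
  intro n
  simp [realZero, pair, triFn_zero]

theorem approx_realOne (n : M.D .nat) : approx ((realOne : Tm Γ .one).eval ρ) n = 1 := by
  rw [approx, hatFn_of_const (q := 1 + 1 + 1), val_three]
  intro n
  simp only [realOne, pair, eval_lam, eval_add, eval_tri, eval_two, eval_zero, add_zero]
  rw [← one_add_one_eq_two, triFn_two]

theorem sat_inUnit : (inUnit x).sat ρ ↔ InUnit (x.eval ρ) := by
  simp only [inUnit, Fm.sat_and, Fm.sat_not, sat_realLt, approx_realZero, approx_realOne, InUnit,
    not_exists, not_lt, ← forall_and]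
  refine forall_congr' fun n => and_congr ?_ ?_ <;> constructor <;> intro h <;> linarith

end

/-- `f` is a function from the unit interval to the reals. -/
def IsFn (f : M.D (.arr .one .one)) : Prop :=
  ∀ x y, InUnit x → InUnit y → REq x y → REq (M.app f x) (M.app f y)

/-- `f` is continuous on the unit interval. -/
def IsCont (f : M.D (.arr .one .one)) : Prop :=
  ∀ x, InUnit x → ∀ k, ∃ N, ∀ y, InUnit y → RNear x y N → RNear (M.app f x) (M.app f y) k

theorem sat_isFunction {Γ : Ctx} (ρ : Env M.toStr Γ) (f : Tm Γ (.arr .one .one)) :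
    (isFunction f).sat ρ ↔ IsFn (f.eval ρ) := by
  simp [isFunction, IsFn, sat_inUnit, sat_realEq]

theorem sat_isContinuous {Γ : Ctx} (ρ : Env M.toStr Γ) (f : Tm Γ (.arr .one .one)) :
    (isContinuous f).sat ρ ↔ IsCont (f.eval ρ) := by
  simp [isContinuous, IsCont, sat_inUnit, sat_realNear]

theorem inUnit_const {q : M.D .nat} (h0 : 0 ≤ val q) (h1 : val q ≤ 1) : InUnit (const q) := by
  intro n
  have := eps_pos n
  rw [approx_const]
  constructor <;> linarith

/-- Every number in the unit interval is close to a rational number in the unit interval. -/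
theorem InUnit.exists_rat {x : M.D .one} (hx : InUnit x) (n : M.D .nat) :
    ∃ q : M.D .nat, 0 ≤ val q ∧ val q ≤ 1 ∧ |val q - approx x n| ≤ 2 * eps n := by
  obtain ⟨h1, h2⟩ := hx n
  have := eps_pos n
  by_cases h3 : 0 ≤ approx x n
  · by_cases h4 : approx x n ≤ 1
    · exact ⟨hatFn x n, h3, h4, by rw [approx, sub_self, abs_zero]; linarith⟩
    -- An approximation that leaves the interval does so by at most 2 eps n, so it is replaced by
    -- the nearer endpoint: the code 3 of the number 1 here, the code 0 below.
    · refine ⟨1 + 1 + 1, ?_⟩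
      rw [val_three, abs_le]
      refine ⟨?_, ?_, ?_, ?_⟩ <;> linarith
  · refine ⟨0, ?_⟩
    rw [val_zero, abs_le]
    refine ⟨?_, ?_, ?_, ?_⟩ <;> linarith

/-! ### Least zeros -/

/-- The recursion step of `zeroSearch`. -/
def zeroSearchStep {Γ : Ctx} (g : Tm Γ .one) : Tm (.nat :: .nat :: Γ) .nat :=
  add v0 (mul (monus one (monus v1 v0)) (monus one (monus one (.app g.wk.wk v1))))

/-- `n` if `g` has no zero below `n`; otherwise the least zero of `g`. -/
def zeroSearch {Γ : Ctx} (g : Tm Γ .one) (n : Tm Γ .nat) : Tm Γ .nat :=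
  primRec zero (zeroSearchStep g) n

theorem eval_zeroSearchStep {Γ : Ctx} (ρ : Env M.toStr Γ) (g : Tm Γ .one) (n a : M.D .nat) :
    (zeroSearchStep g).eval (Env.cons a (Env.cons n ρ)) =
      a + (1 - (n - a)) * ind (M.app (g.eval ρ) n ≠ 0) := by
  simp [zeroSearchStep, one_sub_one_sub]

def zeroSearchFn (g : M.D .one) (n : M.D .nat) : M.D .nat :=
  recur 0 ((zeroSearchStep v0).lam.lam.eval (env1 g)) n

@[simp] theorem eval_zeroSearch {Γ : Ctx} (ρ : Env M.toStr Γ) (g : Tm Γ .one) (t : Tm Γ .nat) :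
    (zeroSearch g t).eval ρ = zeroSearchFn (g.eval ρ) (t.eval ρ) :=
  recur_congr (fun _ _ => by simp [eval_zeroSearchStep]) _ _

section ZeroSearch

variable (g : M.D .one)

theorem zeroSearchFn_zero : zeroSearchFn g 0 = 0 := recur_zero _ _

theorem zeroSearchFn_succ' (n : M.D .nat) : zeroSearchFn g (n + 1) =
    zeroSearchFn g n + (1 - (n - zeroSearchFn g n)) * ind (M.app g n ≠ 0) := by
  rw [zeroSearchFn, zeroSearchFn, recur_succ, eval_lam, eval_lam, eval_zeroSearchStep]
  rfl

open Classical in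
theorem zeroSearchFn_le (n : M.D .nat) : zeroSearchFn g n ≤ n := by
  have := induction_qf (HOA.le (zeroSearch v1 v0) v0) (by simp) (env1 g)
    (by simp [zeroSearchFn_zero]) (fun n hn => ?_) n
  · simpa using this
  · simp only [sat_le, eval_zeroSearch, Tm.eval_var, Env.cons_vz, Env.cons_vs] at hn ⊢
    rw [zeroSearchFn_succ', search_step hn]
    split_ifs
    · exact le_rfl
    · exact hn.trans (lt_add_one _).le

open Classical in
theorem zeroSearchFn_succ (n : M.D .nat) : zeroSearchFn g (n + 1) =
    if zeroSearchFn g n = n ∧ M.app g n ≠ 0 then n + 1 else zeroSearchFn g n := by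
  rw [zeroSearchFn_succ', search_step (zeroSearchFn_le g n)]

variable {g}

theorem app_zeroSearchFn {n : M.D .nat} (h : zeroSearchFn g n < n) :
    M.app g (zeroSearchFn g n) = 0 := by
  have := induction_qf (.imp (.lt (zeroSearch v1 v0) v0) (.eq (.app v1 (zeroSearch v1 v0)) zero))
    (by simp) (env1 g) (by simp [zeroSearchFn_zero]) (fun n hn => ?_) n
  · simp only [Fm.sat_imp, sat_lt, sat_eq, eval_zeroSearch, Tm.eval_app, eval_zero, Tm.eval_var,
      Env.cons_vz, Env.cons_vs] at this
    exact this h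
  · simp only [Fm.sat_imp, sat_lt, sat_eq, eval_zeroSearch, Tm.eval_app, eval_zero, Tm.eval_var,
      Env.cons_vz, Env.cons_vs] at hn ⊢
    rw [zeroSearchFn_succ]
    split_ifs with h'
    · exact fun h => absurd h (lt_irrefl _)
    · intro _
      rcases (zeroSearchFn_le g n).eq_or_lt with h1 | h1
      · rw [h1]
        exact not_not.1 fun h2 => h' ⟨h1, h2⟩
      · exact hn h1

theorem app_ne_zero_of_lt {i n : M.D .nat} (h : i < zeroSearchFn g n) : M.app g i ≠ 0 := by
  have := induction_qf (Γ := [.nat, .one])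
    (.imp (.lt v1 (zeroSearch v2 v0)) (.not (.eq (.app v2 v1) zero)))
    (by simp) (env2 i g) ?_ (fun n hn => ?_) n
  · simp only [Fm.sat_imp, sat_lt, Fm.sat_not, sat_eq, eval_zeroSearch, Tm.eval_app, eval_zero,
      Tm.eval_var, Env.cons_vz, Env.cons_vs] at this
    exact this h
  · simp only [Fm.sat_imp, sat_lt, eval_zeroSearch, Tm.eval_var, Env.cons_vz, Env.cons_vs,
      zeroSearchFn_zero]
    exact fun h => absurd h (zero_le' i).not_gt
  · simp only [Fm.sat_imp, sat_lt, Fm.sat_not, sat_eq, eval_zeroSearch, Tm.eval_app, eval_zero,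
      Tm.eval_var, Env.cons_vz, Env.cons_vs] at hn ⊢
    rw [zeroSearchFn_succ]
    split_ifs with h'
    · intro hi
      rcases (lt_add_one_iff'.1 hi).eq_or_lt with rfl | h1
      · exact h'.2
      · exact hn (by rwa [h'.1])
    · exact hn

theorem zeroSearchFn_lt {i n : M.D .nat} (hi : i < n) (h : M.app g i = 0) : zeroSearchFn g n < n :=
  lt_of_le_of_ne (zeroSearchFn_le g n) fun h' => app_ne_zero_of_lt (h'.symm ▸ hi) h

theorem zeroSearchFn_eq_of_least {i n : M.D .nat} (hi : i < n) (h : M.app g i = 0)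
    (hl : ∀ j < i, M.app g j ≠ 0) : zeroSearchFn g n = i := by
  refine le_antisymm (not_lt.1 fun h' => app_ne_zero_of_lt h' h) (not_lt.1 fun h' => ?_)
  exact hl _ h' (app_zeroSearchFn (zeroSearchFn_lt hi h))

theorem zeroSearchFn_of_lt {i n : M.D .nat} (hn : n ≤ i)
    (hl : ∀ j < i, M.app g j ≠ 0) : zeroSearchFn g n = n := by
  by_contra h
  have h' := lt_of_le_of_ne (zeroSearchFn_le g n) h
  exact hl _ (h'.trans_le hn) (app_zeroSearchFn h')

end ZeroSearch

/-- The least number principle for zeros, obtained from quantifier-free induction by means of the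
primitive recursive bounded search. -/
theorem exists_least_zero {g : M.D .one} {n : M.D .nat} (h : M.app g n = 0) :
    ∃ i, M.app g i = 0 ∧ ∀ j < i, M.app g j ≠ 0 :=
  ⟨zeroSearchFn g (n + 1), app_zeroSearchFn (zeroSearchFn_lt (lt_add_one n) h),
    fun _ => app_ne_zero_of_lt⟩

/-- `s` if `c = 0`, and `t` otherwise. -/
def ifZero {Γ : Ctx} (c s t : Tm Γ .nat) : Tm Γ .nat :=
  add (mul (monus one c) s) (mul (monus one (monus one c)) t)

theorem eval_ifZero_pos {Γ : Ctx} {ρ : Env M.toStr Γ} {c : Tm Γ .nat} (h : c.eval ρ = 0)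
    (s t : Tm Γ .nat) : (ifZero c s t).eval ρ = s.eval ρ := by
  simp [ifZero, h]

theorem eval_ifZero_neg {Γ : Ctx} {ρ : Env M.toStr Γ} {c : Tm Γ .nat} (h : c.eval ρ ≠ 0)
    (s t : Tm Γ .nat) : (ifZero c s t).eval ρ = t.eval ρ := by
  have : 1 - c.eval ρ = 0 := tsub_eq_zero_of_le ((eq_zero_or_one_le _).resolve_left h)
  simp [ifZero, this]

/-- A functional that finds a zero of every function that has one gives the functional `μ`. -/
theorem models_muTwo {Y : M.D .two}
    (hY : ∀ (g : M.D .one) n, M.app g n = 0 → M.app g (M.app Y g) = 0) : M.Models muTwo := by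
  have h : M.Models muTwo ↔ ∃ μ : M.D .two, ∀ g : M.D .one,
      ((∃ n, M.app g n = 0) → M.app g (M.app μ g) = 0 ∧ ∀ n < M.app μ g, M.app g n ≠ 0) ∧
        ((∀ n, M.app g n ≠ 0) → M.app μ g = 0) := by
    simp [muTwo, Str.Models]
  -- Y(g) is a zero whenever there is one, so the search below Y(g) + 1 finds the least. The test
  -- whether the search has succeeded supplies the default value 0.
  refine h.2 ⟨(ifZero (.app v0 (zeroSearch v0 (succ (.app v1 v0)))) (zeroSearch v0 (succ (.app v1 v0)))
    zero).lam.eval (env1 Y), fun g => ⟨?_, fun hg => ?_⟩⟩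
  · rintro ⟨n, hn⟩
    have h0 := app_zeroSearchFn (zeroSearchFn_lt (lt_add_one _) (hY g n hn))
    rw [eval_lam, eval_ifZero_pos (by simpa using h0)]
    simp only [eval_zeroSearch, eval_succ, Tm.eval_app, Tm.eval_var, Env.cons_vz, Env.cons_vs]
    exact ⟨h0, fun _ => app_ne_zero_of_lt⟩
  · rw [eval_lam, eval_ifZero_neg (by simpa using hg _)]
    simp

end Model

end HOA

namespace HOA

namespace Model

variable {M : Model}

open OrderedFraction

/-! ### Continuity in the absence of `μ` -/

/-- For a constant sequence the Cauchy estimate bounds a non-negative quantity by eps n − eps (n +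
d), so no further induction is needed. -/
theorem eps_anti (n d : M.D .nat) : eps (n + d) ≤ eps n := by
  have h := approx_cauchy (const 0) (le_self_add : n ≤ n + d)
  have := abs_nonneg (approx (const 0) n - approx (const 0) (n + d))
  linarith

theorem eps_le {n m : M.D .nat} (h : n ≤ m) : eps m ≤ eps n := by
  obtain ⟨d, rfl⟩ := exists_add_of_le h
  exact eps_anti n d

/-- Four steps after the number `k`. -/
def plusFour {Γ : Ctx} (k : Tm Γ .nat) : Tm Γ .nat := succ (succ (succ (succ k)))

/-- For sequences `s` and `x` and a function `g`, the sequence that agrees with a shift of `x` as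
long as no zero of `g` has been found, and is constant with the value `s(i)` after the least zero
`i` of `g`. -/
def switch {Γ : Ctx} (g s x : Tm Γ .one) : Tm Γ .one :=
  (ifZero (monus (succ v0) (zeroSearch g.wk (succ v0))) (hat x.wk (succ (succ (succ v0))))
    (.app s.wk (zeroSearch g.wk (succ v0)))).lam

def switchFn (g s x : M.D .one) : M.D .one := (switch v0 v1 v2).eval (env3 g s x)

@[simp] theorem eval_switch {Γ : Ctx} (ρ : Env M.toStr Γ) (g s x : Tm Γ .one) :
    (switch g s x).eval ρ = switchFn (g.eval ρ) (s.eval ρ) (x.eval ρ) := by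
  refine M.normal.ext _ _ fun n => ?_
  rw [switch, eval_lam, switchFn, switch, eval_lam]
  simp [ifZero]

section Switch

variable {g s x : M.D .one}

theorem app_switchFn_of_ne {n : M.D .nat} (h : ∀ j < n + 1, M.app g j ≠ 0) :
    M.app (switchFn g s x) n = hatFn x (n + 1 + 1 + 1) := by
  rw [switchFn, switch, eval_lam, eval_ifZero_pos]
  · simp
  · simp [zeroSearchFn_of_lt le_rfl h]

theorem app_switchFn_of_least {n i : M.D .nat} (hi : i < n + 1) (h : M.app g i = 0)
    (hl : ∀ j < i, M.app g j ≠ 0) : M.app (switchFn g s x) n = M.app s i := by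
  rw [switchFn, switch, eval_lam, eval_ifZero_neg]
  · simp [zeroSearchFn_eq_of_least hi h hl]
  · simpa [zeroSearchFn_eq_of_least hi h hl, tsub_eq_zero_iff_le] using hi

/-- The rational numbers with the codes `s(0)`, `s(1)`, … converge fast to the number `x`. -/
def ConvTo (s x : M.D .one) : Prop := ∀ n,
  |val (M.app s n) - approx x (n + 1 + 1 + 1 + 1 + 1)| < eps (n + 1 + 1 + 1 + 1)

/-- There are three cases: no zero has been seen yet, and consecutive entries are approximations of
x; the least zero is n + 1, and the entries jump from x to s(n + 1); or the sequence is already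
constant. The shift of x by three places makes the jump at most eps (n+3) + eps (n+6) + eps (n+5),
which is less than eps (n+1). -/
theorem ConvTo.regular_switchFn (hs : ConvTo s x) (n : M.D .nat) :
    Regular (switchFn g s x) n := by
  have hn := eps_pos n
  by_cases h : ∀ j < n + 1 + 1, M.app g j ≠ 0
  · have h1 := approx_step x (n + 1 + 1 + 1)
    rw [Regular, app_switchFn_of_ne h,
      app_switchFn_of_ne fun j hj => h j (hj.trans (lt_add_one _))]
    change |approx x _ - approx x _| < _
    simp only [eps_succ] at h1 ⊢
    linarith
  · push Not at h
    obtain ⟨j, hj, h0⟩ := h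
    obtain ⟨i, hi, hl⟩ := exists_least_zero h0
    have hij : i ≤ j := not_lt.1 fun h' => hl _ h' h0
    rw [Regular, app_switchFn_of_least (hij.trans_lt hj) hi hl]
    rcases (lt_add_one_iff'.1 (hij.trans_lt hj)).eq_or_lt with rfl | h'
    · rw [app_switchFn_of_ne hl]
      change |approx x _ - val _| < _
      have h1 := hs (n + 1)
      have h2 := approx_sub_approx_le x (n + 1 + 1 + 1) (n + 1 + 1 + 1 + 1 + 1 + 1)
      have h3 := abs_sub_le (approx x (n + 1 + 1 + 1)) (approx x (n + 1 + 1 + 1 + 1 + 1 + 1))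
        (val (M.app s (n + 1)))
      rw [abs_sub_comm (approx x (n + 1 + 1 + 1 + 1 + 1 + 1))] at h3
      simp only [eps_succ] at h1 h2 ⊢
      linarith
    · rw [app_switchFn_of_least h' hi hl, sub_self, abs_zero]
      exact eps_pos _

theorem ConvTo.approx_switchFn (hs : ConvTo s x) (n : M.D .nat) :
    approx (switchFn g s x) n = val (M.app (switchFn g s x) n) := by
  rw [approx, hatFn_eq_self hs.regular_switchFn]

theorem ConvTo.switchFn_of_ne (hs : ConvTo s x) (hx : InUnit x) (h : ∀ j, M.app g j ≠ 0) :
    InUnit (switchFn g s x) ∧ REq (switchFn g s x) x := by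
  refine ⟨fun n => ?_, fun n => ?_⟩ <;> have hn := eps_pos n <;>
    rw [hs.approx_switchFn, app_switchFn_of_ne fun j _ => h j]
  · have := hx (n + 1 + 1 + 1)
    simp only [eps_succ] at this
    change _ ≤ approx x _ ∧ approx x _ ≤ _
    constructor <;> linarith
  · have := approx_sub_approx_le x (n + 1 + 1 + 1) n
    change |approx x _ - approx x _| ≤ _
    simp only [eps_succ] at this
    linarith

/-- Only entries with n + 1 ≤ i differ from s(i). They are approximations of x, and s(i) is close to
x because i is large compared with n. Membership in the unit interval follows from the equality with
a rational that lies there. -/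
theorem ConvTo.switchFn_of_least (hs : ConvTo s x) {i : M.D .nat} (h0 : 0 ≤ val (M.app s i))
    (h1 : val (M.app s i) ≤ 1) (hi : M.app g i = 0) (hl : ∀ j < i, M.app g j ≠ 0) :
    InUnit (switchFn g s x) ∧ REq (switchFn g s x) (const (M.app s i)) := by
  have key : REq (switchFn g s x) (const (M.app s i)) := by
    intro n
    have hn := eps_pos n
    rw [hs.approx_switchFn, approx_const]
    rcases lt_or_ge i (n + 1) with h | h
    · rw [app_switchFn_of_least h hi hl, sub_self, abs_zero]
      linarith
    · rw [app_switchFn_of_ne fun j hj => hl j (hj.trans_le h)]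
      change |approx x _ - val _| ≤ _
      have h2 := hs i
      have h3 := approx_sub_approx_le x (n + 1 + 1 + 1) (i + 1 + 1 + 1 + 1 + 1)
      have h4 := abs_sub_le (approx x (n + 1 + 1 + 1)) (approx x (i + 1 + 1 + 1 + 1 + 1))
        (val (M.app s i))
      rw [abs_sub_comm (approx x (i + 1 + 1 + 1 + 1 + 1))] at h4
      have h5 := eps_le h
      simp only [eps_succ] at h2 h3 h5 ⊢
      linarith
  refine ⟨fun n => ?_, key⟩
  have := abs_le.1 (key n)
  rw [approx_const] at this
  constructor <;> linarith

end Switch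

/-- Grilliot's trick: a function that is discontinuous at `x` along a sequence of rational numbers
gives the functional `μ`. -/
theorem models_muTwo_of_discontinuous {f : M.D (.arr .one .one)} (hf : IsFn f) {x s : M.D .one}
    (hx : InUnit x) (hs : ConvTo s x) (hs0 : ∀ n, 0 ≤ val (M.app s n))
    (hs1 : ∀ n, val (M.app s n) ≤ 1) (k : M.D .nat)
    (hk : ∀ n, eps k ≤ 2 * |approx (M.app f (const (M.app s n))) (k + 1 + 1 + 1 + 1) -
      approx (M.app f x) (k + 1 + 1 + 1 + 1)|) : M.Models muTwo := by
  have hpos := eps_pos k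
  -- If g has no zero, the switched sequence equals x, so f takes equal values there and the first
  -- alternative holds with any n. Comparing one fixed approximation keeps the matrix
  -- quantifier-free.
  have key : ∀ g : M.D .one, ∃ n, |approx (M.app f (switchFn g s x)) (k + 1 + 1 + 1 + 1) -
      approx (M.app f x) (k + 1 + 1 + 1 + 1)| ≤ 2 * eps (k + 1 + 1 + 1 + 1) ∨ M.app g n = 0 := by
    intro g
    by_cases hg : ∃ n, M.app g n = 0
    · exact hg.imp fun n => .inr
    · push Not at hg
      obtain ⟨h1, h2⟩ := hs.switchFn_of_ne hx hg
      exact ⟨0, .inl (hf _ _ h1 hx h2 _)⟩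
  let Γ : Ctx := [.nat, .one, .one, .one, .arr .one .one, .nat]
  let F : Tm Γ (.arr .one .one) := .var (.vs (.vs (.vs (.vs .vz))))
  let K : Tm Γ .nat := plusFour (.var (.vs (.vs (.vs (.vs (.vs .vz))))))
  let X : Tm Γ .one := .var (.vs (.vs (.vs .vz)))
  let a : Tm Γ .nat := hat (.app F (switch v1 v2 X)) K
  let b : Tm Γ .nat := hat (.app F X) K
  have hsat : ∀ (g : M.D .one) n, (Fm.or (HOA.le (mul (distNum a b) (pow2 K)) (mul two (cden a b)))
      (.eq (.app v1 v0) zero)).sat (Env.cons n (Env.cons g (Env.cons s (env3 x f k)))) ↔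
      |approx (M.app f (switchFn g s x)) (k + 1 + 1 + 1 + 1) -
        approx (M.app f x) (k + 1 + 1 + 1 + 1)| ≤ 2 * eps (k + 1 + 1 + 1 + 1) ∨
          M.app g n = 0 := by
    intro g n
    simp only [Fm.sat_or, sat_le, sat_eq, eval_mul, eval_distNum, eval_pow2, eval_two, eval_cden,
      a, b, K, F, X, plusFour, eval_hat, eval_succ, Tm.eval_app, Tm.eval_var, eval_switch,
      eval_zero, Env.cons_vz, Env.cons_vs, dist_le_iff]
    rfl
  obtain ⟨Y, hY⟩ := choice_qf _ (by simp) (Env.cons s (env3 x f k))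
    (fun g => (key g).imp fun n => (hsat g n).2)
  refine models_muTwo (Y := Y) fun g n hn => ?_
  -- If g has a zero, the switched sequence equals s(i), so the value of f there is within 2 eps
  -- (k+4) of f(s(i)). Closeness to f(x) would put f(s(i)) within 4 eps (k+4) = eps k / 4 of f(x),
  -- against the gap eps k / 2.
  refine ((hsat g _).1 (hY g)).resolve_left fun h => ?_
  obtain ⟨i, hi, hl⟩ := exists_least_zero hn
  obtain ⟨h1, h2⟩ := hs.switchFn_of_least (hs0 i) (hs1 i) hi hl
  have h3 := hf _ _ h1 (inUnit_const (hs0 i) (hs1 i)) h2 (k + 1 + 1 + 1 + 1)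
  have h4 := hk i
  have h5 := abs_sub_le (approx (M.app f (const (M.app s i))) (k + 1 + 1 + 1 + 1))
    (approx (M.app f (switchFn g s x)) (k + 1 + 1 + 1 + 1)) (approx (M.app f x) (k + 1 + 1 + 1 + 1))
  rw [abs_sub_comm (approx (M.app f (const (M.app s i))) _)
    (approx (M.app f (switchFn g s x)) _)] at h5
  simp only [eps_succ] at h h3
  linarith

/-- Choice for numbers. -/
theorem choice_nat {P : M.D .nat → M.D .nat → Prop} {Γ : Ctx} (φ : Fm (.nat :: .one :: Γ))
    (hφ : φ.QF) (ρ : Env M.toStr Γ)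
    (hP : ∀ g q, φ.sat (Env.cons q (Env.cons g ρ)) ↔ P (M.app g 0) q) (h : ∀ n, ∃ q, P n q) :
    ∃ s : M.D .one, ∀ n, P n (M.app s n) := by
  -- The available choice has a type 1 argument, so a number n is passed as the constant function n
  -- and read off as g(0).
  obtain ⟨Y, hY⟩ := choice_qf φ hφ ρ fun g => (h (M.app g 0)).imp fun q => (hP g q).2
  refine ⟨(Tm.app v1 (.app (.con (.k .nat .nat)) v0)).lam.eval (env1 Y), fun n => ?_⟩
  have := (hP _ _).1 (hY (const n))
  rw [app_const] at this
  rw [eval_lam]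
  exact this

/-- Otherwise every N has a rational q close to x whose value is far from f(x). This condition on N
and q is quantifier-free, since it compares codes and fixed approximations, so choice gives a
sequence to which Grilliot's trick applies. Nearby points are restricted to rationals because choice
yields only numbers. -/
theorem exists_modulus (h : ¬ M.Models muTwo) {f : M.D (.arr .one .one)} (hf : IsFn f)
    {x : M.D .one} (hx : InUnit x) (k : M.D .nat) : ∃ N : M.D .nat, ∀ q, 0 ≤ val q → val q ≤ 1 →
      |val q - approx x (N + 1 + 1 + 1 + 1 + 1)| < eps (N + 1 + 1 + 1 + 1) →
      2 * |approx (M.app f (const q)) (k + 1 + 1 + 1 + 1) - approx (M.app f x) (k + 1 + 1 + 1 + 1)|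
        < eps k := by
  by_contra! hN
  let Γ : Ctx := [.nat, .one, .one, .arr .one .one, .nat]
  let N : Tm Γ .nat := plusFour (.app v1 zero)
  let k' : Tm Γ .nat := .var (.vs (.vs (.vs (.vs .vz))))
  let F : Tm Γ (.arr .one .one) := .var (.vs (.vs (.vs .vz)))
  let X : Tm Γ .one := v2
  let a : Tm Γ .nat := hat (.app F (.app (.con (.k .nat .nat)) v0)) (plusFour k')
  let b : Tm Γ .nat := hat (.app F X) (plusFour k')
  obtain ⟨s, hs⟩ := choice_nat (P := fun n q => 0 ≤ val q ∧ val q ≤ 1 ∧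
      |val q - approx x (n + 1 + 1 + 1 + 1 + 1)| < eps (n + 1 + 1 + 1 + 1) ∧
      eps k ≤ 2 * |approx (M.app f (const q)) (k + 1 + 1 + 1 + 1) -
        approx (M.app f x) (k + 1 + 1 + 1 + 1)|)
    (Fm.and (HOA.le (negNum v0) (posNum v0)) (.and (HOA.le (posNum v0) (add (negNum v0) (den v0)))
      (.and (.lt (mul (distNum v0 (hat X (succ N))) (pow2 N)) (cden v0 (hat X (succ N))))
        (HOA.le (cden a b) (mul two (mul (distNum a b) (pow2 k')))))))
    (by simp) (env3 x f k)
    (fun g q => by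
      simp only [Fm.sat_and, sat_le, sat_lt, eval_negNum, eval_posNum, eval_den, eval_add, eval_mul,
        eval_distNum, eval_pow2, eval_two, eval_cden, a, b, N, F, X, k', plusFour, eval_hat,
        eval_succ, Tm.eval_app, Tm.eval_var, Tm.eval_con, eval_zero, Env.cons_vz, Env.cons_vs,
        val_nonneg_iff, val_le_one_iff, dist_lt_iff, le_dist_iff]
      rfl)
    hN
  exact h (models_muTwo_of_discontinuous hf hx (fun n => (hs n).2.2.1) (fun n => (hs n).1)
    (fun n => (hs n).2.1) k fun n => (hs n).2.2.2)

/-- If there is no functional `μ` then all functions on the unit interval are continuous. -/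
theorem isCont_of_not_muTwo (h : ¬ M.Models muTwo) {f : M.D (.arr .one .one)} (hf : IsFn f) :
    IsCont f := by
  intro x hx k
  -- The modulus at x controls only rational points. An arbitrary y near x is reached through a
  -- rational q close to both, with a second modulus at y; that one may depend on y because it only
  -- constrains the choice of q.
  obtain ⟨N, hN⟩ := exists_modulus h hf hx (k + 1 + 1)
  refine ⟨N + 1 + 1 + 1 + 1 + 1 + 1, fun y hy ⟨n, hn⟩ => ?_⟩
  obtain ⟨N', hN'⟩ := exists_modulus h hf hy (k + 1 + 1)
  obtain ⟨q, hq0, hq1, hq⟩ := hy.exists_rat (N + N' + 1 + 1 + 1 + 1 + 1 + 1 + 1 + 1 + 1 + 1)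
  have hk := eps_pos k
  have hNpos := eps_pos N
  have hNpos' := eps_pos N'
  have e1 := eps_le (le_self_add : N ≤ N + N')
  have e2 := eps_le (le_add_self : N' ≤ N + N')
  have h1 := hN q hq0 hq1 (by
    have a1 := approx_sub_approx_le y (N + N' + 1 + 1 + 1 + 1 + 1 + 1 + 1 + 1 + 1 + 1) n
    have a2 := approx_sub_approx_le x n (N + 1 + 1 + 1 + 1 + 1)
    rw [abs_le] at a1 a2 hq
    have a3 := abs_lt.1 (lt_sub_iff_add_lt.2 hn)
    simp only [eps_succ] at a1 a2 a3 hq ⊢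
    rw [abs_lt]
    constructor <;> linarith)
  have h2 := hN' q hq0 hq1 (by
    have a1 := approx_sub_approx_le y (N + N' + 1 + 1 + 1 + 1 + 1 + 1 + 1 + 1 + 1 + 1)
      (N' + 1 + 1 + 1 + 1 + 1)
    rw [abs_le] at a1 hq
    simp only [eps_succ] at a1 hq ⊢
    rw [abs_lt]
    constructor <;> linarith)
  -- A modulus for k + 2 concerns the approximations with index k + 6. Each of the two differences
  -- is below eps k / 8, and 2 eps (k+6) = eps k / 32, so the sum stays below eps k.
  refine ⟨k + 1 + 1 + 1 + 1 + 1 + 1, ?_⟩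
  have h3 := abs_sub_le (approx (M.app f x) (k + 1 + 1 + 1 + 1 + 1 + 1))
    (approx (M.app f (const q)) (k + 1 + 1 + 1 + 1 + 1 + 1))
    (approx (M.app f y) (k + 1 + 1 + 1 + 1 + 1 + 1))
  rw [abs_sub_comm (approx (M.app f x) _) (approx (M.app f (const q)) _)] at h3
  simp only [eps_succ] at h1 h2 ⊢
  linarith

end Model

/-- Principles for all functions on the unit interval that are provable with `μ`, and provable for
continuous functions without `μ`. -/
theorem proves_forallFunctions {A : Fm [.arr .one .one]}
    (ha : Proves ACAomega (forallFunctions A)) (hb : Proves RCAWKL (forallContinuous A)) :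
    Proves RCAWKL (forallFunctions A) := by
  refine completeness_normal Set.subset_union_left fun M hM => ?_
  -- Excluded middle for (μ²) is applied in each model separately.
  by_cases hμ : M.Models muTwo
  · refine ha.sound fun φ hφ => ?_
    rcases hφ with hφ | rfl
    · exact M.rca φ hφ
    · exact hμ
  · have h := hb.sound hM
    intro f hf
    refine h f ?_
    have hfn := (Model.sat_isFunction _ _).1 hf
    exact (Fm.sat_and _ _ _).2 ⟨hf, (Model.sat_isContinuous _ _).2
      (Model.isCont_of_not_muTwo hμ hfn)⟩

end HOA

namespace TuringIdeal

open Encodable Denumerable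

/-! ## Turing ideals

Sets of functions that are closed under relative computability. -/

/-- A set of functions that contains the primitive recursive functions and is closed under
composition, pairing, primitive recursion and minimization. -/
structure IsIdeal (C : Set (ℕ → ℕ)) : Prop where
  prim {f : ℕ → ℕ} : Nat.Primrec f → f ∈ C
  comp {f g : ℕ → ℕ} : f ∈ C → g ∈ C → (fun n => f (g n)) ∈ C
  pair {f g : ℕ → ℕ} : f ∈ C → g ∈ C → (fun n => Nat.pair (f n) (g n)) ∈ C
  prec {f g : ℕ → ℕ} : f ∈ C → g ∈ C → (fun n => (Nat.rec (f n.unpair.1)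
    (fun y i => g (Nat.pair n.unpair.1 (Nat.pair y i))) n.unpair.2 : ℕ)) ∈ C
  find {f : ℕ → ℕ} (h : ∀ a, ∃ n, f (Nat.pair a n) = 0) : f ∈ C → (fun a => Nat.find (h a)) ∈ C

/-- Membership in an ideal for functions between denumerable types. -/
def Mem (C : Set (ℕ → ℕ)) {α β : Type} [Denumerable α] [Denumerable β] (f : α → β) : Prop :=
  (fun n => encode (f (ofNat α n))) ∈ C

section Mem

variable {C : Set (ℕ → ℕ)} {α β γ δ : Type} [Denumerable α] [Denumerable β] [Denumerable γ]
  [Denumerable δ]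

theorem mem_iff {f : ℕ → ℕ} : Mem C f ↔ f ∈ C := Iff.rfl

namespace IsIdeal

theorem mem_comp (hC : IsIdeal C) {g : β → γ} {f : α → β} (hg : Mem C g) (hf : Mem C f) :
    Mem C fun a => g (f a) := by
  have := hC.comp hg hf
  simpa only [Mem, ofNat_encode] using this

theorem mem_pair (hC : IsIdeal C) {f : α → β} {g : α → γ} (hf : Mem C f) (hg : Mem C g) :
    Mem C fun a => (f a, g a) :=
  hC.pair hf hg

theorem mem_primrec (hC : IsIdeal C) {f : α → β} (hf : Primrec f) : Mem C f :=
  hC.prim (Primrec.nat_iff.1 (Primrec.encode.comp (hf.comp (Primrec.ofNat α))))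

theorem mem_id (hC : IsIdeal C) : Mem C fun a : α => a := hC.mem_primrec Primrec.id

theorem mem_const (hC : IsIdeal C) (b : β) : Mem C fun _ : α => b := hC.mem_primrec (Primrec.const b)

theorem mem_fst (hC : IsIdeal C) : Mem C fun a : α × β => a.1 := hC.mem_primrec Primrec.fst

theorem mem_snd (hC : IsIdeal C) : Mem C fun a : α × β => a.2 := hC.mem_primrec Primrec.snd

theorem mem_comp₂ (hC : IsIdeal C) {h : β → γ → δ} {f : α → β} {g : α → γ} (hh : Primrec₂ h)
    (hf : Mem C f) (hg : Mem C g) : Mem C fun a => h (f a) (g a) :=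
  hC.mem_comp (g := fun p : β × γ => h p.1 p.2) (hC.mem_primrec hh) (hC.mem_pair hf hg)

theorem mem_add (hC : IsIdeal C) {f g : α → ℕ} (hf : Mem C f) (hg : Mem C g) :
    Mem C fun a => f a + g a := hC.mem_comp₂ Primrec.nat_add hf hg

theorem mem_sub (hC : IsIdeal C) {f g : α → ℕ} (hf : Mem C f) (hg : Mem C g) :
    Mem C fun a => f a - g a := hC.mem_comp₂ Primrec.nat_sub hf hg

theorem mem_mul (hC : IsIdeal C) {f g : α → ℕ} (hf : Mem C f) (hg : Mem C g) :
    Mem C fun a => f a * g a := hC.mem_comp₂ Primrec.nat_mul hf hg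

/-- Definition by cases. -/
theorem mem_ite (hC : IsIdeal C) {p : α → Prop} [DecidablePred p] {f g : α → ℕ}
    (hp : Mem C fun a => if p a then 0 else 1) (hf : Mem C f) (hg : Mem C g) :
    Mem C fun a => if p a then f a else g a := by
  have := hC.mem_add (hC.mem_mul (hC.mem_sub (hC.mem_const 1) hp) hf) (hC.mem_mul hp hg)
  convert this using 2 with a
  by_cases h : p a <;> simp [h]

theorem mem_eq (hC : IsIdeal C) {f g : α → ℕ} (hf : Mem C f) (hg : Mem C g) :
    Mem C fun a => if f a = g a then 0 else 1 :=
  hC.mem_comp₂ (h := fun m n => if m = n then 0 else 1)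
    (Primrec.ite Primrec.eq (Primrec.const 0) (Primrec.const 1)) hf hg

theorem mem_lt (hC : IsIdeal C) {f g : α → ℕ} (hf : Mem C f) (hg : Mem C g) :
    Mem C fun a => if f a < g a then 0 else 1 :=
  hC.mem_comp₂ (h := fun m n => if m < n then 0 else 1)
    (Primrec.ite Primrec.nat_lt (Primrec.const 0) (Primrec.const 1)) hf hg

theorem mem_le (hC : IsIdeal C) {f g : α → ℕ} (hf : Mem C f) (hg : Mem C g) :
    Mem C fun a => if f a ≤ g a then 0 else 1 :=
  hC.mem_comp₂ (h := fun m n => if m ≤ n then 0 else 1)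
    (Primrec.ite Primrec.nat_le (Primrec.const 0) (Primrec.const 1)) hf hg

theorem mem_or (hC : IsIdeal C) {p q : α → Prop} [DecidablePred p] [DecidablePred q]
    (hp : Mem C fun a => if p a then 0 else 1) (hq : Mem C fun a => if q a then 0 else 1) :
    Mem C fun a => if p a ∨ q a then 0 else 1 := by
  convert hC.mem_mul hp hq using 2 with a
  by_cases h : p a <;> by_cases h' : q a <;> simp [h, h']

theorem mem_imp (hC : IsIdeal C) {p q : α → Prop} [DecidablePred p] [DecidablePred q]
    (hp : Mem C fun a => if p a then 0 else 1) (hq : Mem C fun a => if q a then 0 else 1) :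
    Mem C fun a => if p a → q a then 0 else 1 := by
  convert hC.mem_sub hq hp using 2 with a
  by_cases h : p a <;> by_cases h' : q a <;> simp [h, h']

/-- Primitive recursion. -/
theorem mem_rec (hC : IsIdeal C) {f : α → ℕ} {g : α × ℕ × ℕ → ℕ} {k : α → ℕ} (hf : Mem C f)
    (hg : Mem C g) (hk : Mem C k) :
    Mem C fun a => (Nat.rec (f a) (fun y i => g (a, y, i)) (k a) : ℕ) := by
  have h : Mem C fun p : α × ℕ => (Nat.rec (f p.1) (fun y i => g (p.1, y, i)) p.2 : ℕ) := by
    have := hC.prec hf hg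
    simpa [Mem, prod_ofNat_val] using this
  exact hC.mem_comp h (hC.mem_pair hC.mem_id hk)

/-- Minimization. -/
theorem mem_find (hC : IsIdeal C) {p : α → ℕ → Prop} [∀ a, DecidablePred (p a)]
    (h : ∀ a, ∃ n, p a n) (hp : Mem C fun x : α × ℕ => if p x.1 x.2 then 0 else 1) :
    Mem C fun a => Nat.find (h a) := by
  have h' : ∀ a, ∃ n, (fun m => encode ((fun x : α × ℕ => if p x.1 x.2 then 0 else 1)
      (ofNat (α × ℕ) m))) (Nat.pair a n) = 0 := fun a => by
    obtain ⟨n, hn⟩ := h (ofNat α a)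
    exact ⟨n, by simp [hn]⟩
  have := hC.find h' hp
  unfold Mem
  convert this using 2 with a
  simp

/-- Bounded quantification. -/
theorem mem_ball (hC : IsIdeal C) {p : α → ℕ → Prop} [∀ a, DecidablePred (p a)] {k : α → ℕ}
    (hp : Mem C fun x : α × ℕ => if p x.1 x.2 then 0 else 1) (hk : Mem C k) :
    Mem C fun a => if ∀ i < k a, p a i then 0 else 1 := by
  -- The bounded universal statement holds exactly if the least n that reaches the bound or violates
  -- p is at least the bound.
  have h : ∀ a, ∃ n, k a ≤ n ∨ ¬ p a n := fun a => ⟨k a, .inl le_rfl⟩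
  have hn : Mem C fun x : α × ℕ => if ¬ p x.1 x.2 then 0 else 1 := by
    have := hC.mem_sub (hC.mem_const 1) hp
    convert this using 2 with x
    by_cases h : p x.1 x.2 <;> simp [h]
  have := hC.mem_le hk (hC.mem_find h (hC.mem_or (hC.mem_le (hC.mem_comp hk hC.mem_fst) hC.mem_snd) hn))
  convert this using 2 with a
  refine if_congr ?_ rfl rfl
  rw [Nat.le_find_iff]
  simp only [not_or, not_le, not_not]
  exact forall₂_congr fun i hi => ⟨fun h => ⟨hi, h⟩, fun h => h.2⟩

end IsIdeal

end Mem

/-- The computable functions. -/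
theorem isIdeal_computable : IsIdeal {f | Computable f} where
  prim hf := (Primrec.nat_iff.2 hf).to_comp
  comp hf hg := Computable.comp hf hg
  pair hf hg := Primrec₂.natPair.to_comp.comp hf hg
  prec {f g} hf hg := by
    have h1 : Computable fun n : ℕ => n.unpair.1 := Computable.fst.comp Computable.unpair
    refine Computable.nat_rec (Computable.snd.comp Computable.unpair) (Computable.comp hf h1)
      (h := fun n p => g (Nat.pair n.unpair.1 (Nat.pair p.1 p.2))) ?_
    have hp : Computable₂ Nat.pair := Primrec₂.natPair.to_comp
    exact (Computable.comp hg (hp.comp (h1.comp Computable.fst)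
      (hp.comp (Computable.fst.comp Computable.snd) (Computable.snd.comp Computable.snd)))).to₂
  find {f} h hf := by
    have hp : Computable₂ fun a n => decide (f (Nat.pair a n) = 0) :=
      ((Primrec.eq.decide.comp Primrec.id (Primrec.const 0)).to_comp.comp
        (Computable.comp hf (Primrec₂.natPair.to_comp))).to₂
    refine (Partrec.rfind hp.partrec₂).of_eq_tot fun a => ?_
    simp only [Nat.mem_rfind, PFun.coe_val, Part.mem_some_iff]
    exact ⟨by simpa using Nat.find_spec (h a), fun {m} hm => by simpa using Nat.find_min (h a) hm⟩

theorem countable_computable : {f : ℕ → ℕ | Computable f}.Countable := by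
  have h : ∀ f : {f : ℕ → ℕ | Computable f}, ∃ c : Nat.Partrec.Code, c.eval = (f.1 : ℕ →. ℕ) :=
    fun f => Nat.Partrec.Code.exists_code.1 (Partrec.nat_iff.1 f.2)
  choose c hc using h
  have : Function.Injective c := fun f g hfg => by
    have h1 := hc f
    rw [hfg, hc g] at h1
    exact Subtype.ext (funext fun n => (Part.some_injective (congrFun h1 n)).symm)
  exact this.countable

/-- There is a computable function whose range is not computable. -/
theorem exists_range_not_computable :
    ∃ h : ℕ → ℕ, Computable h ∧
      ∀ g : ℕ → ℕ, (∀ n, g n = 0 ↔ n ∈ Set.range h) → ¬ Computable g := by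
  -- The argument w codes a number of steps and a program. Programs that halt on input 0 are listed
  -- with their codes raised by one, so that 0 is free as the value of unsuccessful attempts.
  let h : ℕ → ℕ := fun w =>
    if ((ofNat Nat.Partrec.Code w.unpair.2).evaln w.unpair.1 0).isSome then w.unpair.2 + 1 else 0
  refine ⟨h, ?_, fun g hg hc => ComputablePred.halting_problem 0 ?_⟩
  · refine Primrec.to_comp (Primrec.ite ?_ ?_ (Primrec.const 0))
    · refine Primrec.eq.comp (Primrec.option_isSome.comp (Nat.Partrec.Code.primrec_evaln.comp
        (((Primrec.fst.comp Primrec.unpair).pair ((Primrec.ofNat _).comp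
          (Primrec.snd.comp Primrec.unpair))).pair (Primrec.const 0)))) (Primrec.const true)
    · exact Primrec.succ.comp (Primrec.snd.comp Primrec.unpair)
  · have h1 : ComputablePred fun c : Nat.Partrec.Code => g (encode c + 1) = 0 := by
      refine ⟨fun c => inferInstance, ?_⟩
      exact (Primrec.eq.decide.comp Primrec.id (Primrec.const 0)).to_comp.comp
        (Computable.comp hc (Computable.succ.comp Computable.encode))
    refine h1.of_eq fun c => ?_
    rw [hg]
    constructor
    · rintro ⟨w, hw⟩
      simp only [h] at hw
      split_ifs at hw with hs
      obtain ⟨x, hx⟩ := Option.isSome_iff_exists.1 hs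
      have hc : ofNat Nat.Partrec.Code w.unpair.2 = c := by
        rw [Nat.add_right_cancel hw, ofNat_encode]
      rw [hc] at hx
      exact Part.dom_iff_mem.2 ⟨x, Nat.Partrec.Code.evaln_sound hx⟩
    · intro hd
      obtain ⟨x, hx⟩ := Part.dom_iff_mem.1 hd
      obtain ⟨k, hk⟩ := Nat.Partrec.Code.evaln_complete.1 hx
      refine ⟨Nat.pair k (encode c), ?_⟩
      have : (c.evaln k 0).isSome := Option.isSome_iff_exists.2 ⟨x, hk⟩
      simp [h, this]

end TuringIdeal

namespace TuringIdeal

/-! ## Adjoining a path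

A finite binary sequence is coded by the positive number whose binary expansion is a leading `1`
followed by the sequence. -/

/-- The code of the initial segment of length `n` of `P`. -/
def seg (P : ℕ → ℕ) : ℕ → ℕ
  | 0 => 1
  | n + 1 => 2 * seg P n + P n

/-- Functionals on finite sequences, with values `v + 1` where they are defined and `0` elsewhere,
for which values persist. -/
def Persistent (φ : ℕ × ℕ → ℕ) : Prop :=
  ∀ s x b, b ≤ 1 → φ (s, x) ≠ 0 → φ (2 * s + b, x) = φ (s, x)

/-- `Y` is the function that the functional `φ` computes from `P`. -/
def Computes (φ : ℕ × ℕ → ℕ) (P Y : ℕ → ℕ) : Prop := ∀ x, ∃ n, φ (seg P n, x) = Y x + 1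

/-- The functions that are computable from `P` relative to `C`. -/
def adjoin (C : Set (ℕ → ℕ)) (P : ℕ → ℕ) : Set (ℕ → ℕ) :=
  {Y | ∃ φ, Mem C φ ∧ Persistent φ ∧ Computes φ P Y}

section

variable {C : Set (ℕ → ℕ)} {P : ℕ → ℕ} {φ : ℕ × ℕ → ℕ}

theorem Persistent.seg_le (hφ : Persistent φ) (hP : ∀ n, P n ≤ 1) {x n m v : ℕ} (h : n ≤ m)
    (hv : φ (seg P n, x) = v + 1) : φ (seg P m, x) = v + 1 := by
  induction m, h using Nat.le_induction with
  | base => exact hv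
  | succ m _ ih => rw [seg, hφ _ _ _ (hP m) (by omega), ih]

theorem le_seg (P : ℕ → ℕ) (n : ℕ) : 2 ^ n ≤ seg P n := by
  induction n with
  | zero => simp [seg]
  | succ n ih => rw [seg, pow_succ]; omega

theorem seg_lt (hP : ∀ n, P n ≤ 1) (n : ℕ) : seg P n < 2 ^ (n + 1) := by
  induction n with
  | zero => simp [seg]
  | succ n ih => rw [seg, pow_succ]; have := hP n; omega

theorem subset_adjoin (hC : IsIdeal C) (P : ℕ → ℕ) : C ⊆ adjoin C P := fun f hf => by
  refine ⟨fun p => f p.2 + 1, hC.mem_add (hC.mem_comp (mem_iff.2 hf) hC.mem_snd) (hC.mem_const 1),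
    fun _ _ _ _ _ => rfl, fun x => ⟨0, rfl⟩⟩

theorem IsIdeal.mem_two_pow (hC : IsIdeal C) : Mem C fun n : ℕ => 2 ^ n := by
  have := hC.mem_rec (α := ℕ) (f := fun _ => 1) (g := fun p => 2 * p.2.2) (hC.mem_const 1)
    (hC.mem_mul (hC.mem_const 2) (hC.mem_comp hC.mem_snd hC.mem_snd)) hC.mem_id
  convert this using 2 with n
  induction n with
  | zero => rfl
  | succ n ih => rw [pow_succ', ih]

theorem exists_div_lt (p : ℕ × ℕ) : ∃ k, p.1 / 2 ^ k < 2 ^ (p.2 + 2) := by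
  refine ⟨p.1, ?_⟩
  rw [Nat.div_eq_of_lt Nat.lt_two_pow_self]
  positivity

/-- The bit with index x is read from a code s of length above x: dropping the last κ bits leaves
length x + 1, and the parity of the result is the bit. Appending a bit to s raises κ by one and
leaves the result unchanged, which is persistence. -/
theorem self_mem_adjoin (hC : IsIdeal C) (hP : ∀ n, P n ≤ 1) : P ∈ adjoin C P := by
  let κ : ℕ × ℕ → ℕ := fun p => Nat.find (exists_div_lt p)
  have hdiv : ∀ (f g : (ℕ × ℕ) × ℕ → ℕ), Mem C f → Mem C g → Mem C fun p => f p / 2 ^ g p :=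
    fun f g hf hg => hC.mem_comp₂ Primrec.nat_div hf (hC.mem_comp hC.mem_two_pow hg)
  have hκ : Mem C κ := hC.mem_find exists_div_lt
    (hC.mem_lt (hdiv _ _ (hC.mem_comp hC.mem_fst hC.mem_fst) hC.mem_snd)
      (hC.mem_comp hC.mem_two_pow
        (hC.mem_add (hC.mem_comp hC.mem_snd hC.mem_fst) (hC.mem_const 2))))
  have hκ' : ∀ s x k, s / 2 ^ k < 2 ^ (x + 2) → 2 ^ (x + 1) ≤ s / 2 ^ k → κ (s, x) = k := by
    intro s x k h1 h2
    refine (Nat.find_eq_iff _).2 ⟨h1, fun m hm => not_lt.2 ?_⟩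
    obtain ⟨d, rfl⟩ := Nat.exists_eq_add_of_lt hm
    rw [add_assoc, pow_add 2 m, ← Nat.div_div_eq_div_mul] at h2
    have h3 := (Nat.le_div_iff_mul_le (by positivity)).1 h2
    refine le_trans ?_ h3
    rw [pow_succ 2 (x + 1)]
    exact Nat.mul_le_mul le_rfl (Nat.le_self_pow (by omega) 2)
  refine ⟨fun p => if p.1 < 2 ^ (p.2 + 1) then 0 else p.1 / 2 ^ κ p % 2 + 1, ?_, ?_, ?_⟩
  · refine hC.mem_ite (hC.mem_lt hC.mem_fst (hC.mem_comp hC.mem_two_pow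
      (hC.mem_add hC.mem_snd (hC.mem_const 1)))) (hC.mem_const 0) (hC.mem_add ?_ (hC.mem_const 1))
    exact hC.mem_comp₂ Primrec.nat_mod (hC.mem_comp₂ Primrec.nat_div hC.mem_fst
      (hC.mem_comp hC.mem_two_pow hκ)) (hC.mem_const 2)
  · intro s x b hb hs
    have hs' : 2 ^ (x + 1) ≤ s := by
      by_contra h
      exact hs (if_pos (not_le.1 h))
    have hspec : s / 2 ^ κ (s, x) < 2 ^ (x + 2) := Nat.find_spec (exists_div_lt (s, x))
    have hle : 2 ^ (x + 1) ≤ s / 2 ^ κ (s, x) := by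
      rcases h : κ (s, x) with _ | k
      · simpa using hs'
      · have h1 := Nat.find_min (exists_div_lt (s, x)) (m := k) (by change k < κ (s, x); omega)
        simp only [not_lt] at h1
        rw [pow_succ 2 k, ← Nat.div_div_eq_div_mul, Nat.le_div_iff_mul_le (by norm_num)]
        rw [← pow_succ]
        exact h1
    have hd : (2 * s + b) / 2 ^ (κ (s, x) + 1) = s / 2 ^ κ (s, x) := by
      rw [pow_succ', ← Nat.div_div_eq_div_mul]
      congr 1
      omega
    have hk : κ (2 * s + b, x) = κ (s, x) + 1 := hκ' _ _ _ (hd ▸ hspec) (hd ▸ hle)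
    simp only [hk, hd]
    rw [if_neg (by omega), if_neg (by omega)]
  · intro x
    refine ⟨x + 1, ?_⟩
    have h0 : κ (seg P (x + 1), x) = 0 := hκ' _ _ _ (by simpa using seg_lt hP (x + 1))
      (by simpa using le_seg P (x + 1))
    simp only [h0]
    rw [if_neg (not_lt.2 (le_seg P (x + 1))), seg]
    have := hP x
    simp only [pow_zero, Nat.div_one]
    omega

/-- Each operation is carried out on a finite initial segment of P, with 0 for "not yet defined".
Undefined intermediate results make the outcome undefined, so values persist; any one value of the
result uses finitely many values, all defined on a long enough segment. -/
theorem isIdeal_adjoin (hC : IsIdeal C) (hP : ∀ n, P n ≤ 1) : IsIdeal (adjoin C P) where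
  prim hf := subset_adjoin hC P (hC.prim hf)
  comp := by
    rintro f g ⟨φ, hφ, mφ, cφ⟩ ⟨ψ, hψ, mψ, cψ⟩
    refine ⟨fun p => if ψ p = 0 then 0 else φ (p.1, ψ p - 1), ?_, ?_, ?_⟩
    · exact hC.mem_ite (hC.mem_eq hψ (hC.mem_const 0)) (hC.mem_const 0)
        (hC.mem_comp hφ (hC.mem_pair hC.mem_fst (hC.mem_sub hψ (hC.mem_const 1))))
    · intro s x b hb h
      by_cases h0 : ψ (s, x) = 0
      · simp [h0] at h
      · simp only [if_neg h0, mψ s x b hb h0] at h ⊢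
        exact mφ _ _ _ hb h
    · intro x
      obtain ⟨n, hn⟩ := cψ x
      obtain ⟨m, hm⟩ := cφ (g x)
      refine ⟨max n m, ?_⟩
      simp [mψ.seg_le hP (le_max_left n m) hn, mφ.seg_le hP (le_max_right n m) hm]
  pair := by
    rintro f g ⟨φ, hφ, mφ, cφ⟩ ⟨ψ, hψ, mψ, cψ⟩
    refine ⟨fun p => if φ p = 0 then 0 else if ψ p = 0 then 0 else
      Nat.pair (φ p - 1) (ψ p - 1) + 1, ?_, ?_, ?_⟩
    · exact hC.mem_ite (hC.mem_eq hφ (hC.mem_const 0)) (hC.mem_const 0)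
        (hC.mem_ite (hC.mem_eq hψ (hC.mem_const 0)) (hC.mem_const 0) (hC.mem_add
          (hC.mem_comp₂ Primrec₂.natPair (hC.mem_sub hφ (hC.mem_const 1))
            (hC.mem_sub hψ (hC.mem_const 1))) (hC.mem_const 1)))
    · intro s x b hb h
      by_cases h0 : φ (s, x) = 0
      · simp [h0] at h
      by_cases h1 : ψ (s, x) = 0
      · simp [h1] at h
      simp only [mφ s x b hb h0, mψ s x b hb h1]
    · intro x
      obtain ⟨n, hn⟩ := cψ x
      obtain ⟨m, hm⟩ := cφ x
      refine ⟨max n m, ?_⟩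
      simp [mψ.seg_le hP (le_max_left n m) hn, mφ.seg_le hP (le_max_right n m) hm]
  prec := by
    rintro f g ⟨φ, hφ, mφ, cφ⟩ ⟨ψ, hψ, mψ, cψ⟩
    let step : ℕ → ℕ → ℕ → ℕ → ℕ := fun s z y i =>
      if i = 0 then 0 else ψ (s, Nat.pair z (Nat.pair y (i - 1)))
    refine ⟨fun p => Nat.rec (φ (p.1, p.2.unpair.1)) (fun y i => step p.1 p.2.unpair.1 y i)
      p.2.unpair.2, ?_, ?_, ?_⟩
    · have h1 : Mem C fun p : ℕ × ℕ => p.2.unpair.1 :=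
        hC.mem_primrec (Primrec.fst.comp (Primrec.unpair.comp Primrec.snd))
      have h2 : Mem C fun p : ℕ × ℕ => p.2.unpair.2 :=
        hC.mem_primrec (Primrec.snd.comp (Primrec.unpair.comp Primrec.snd))
      refine hC.mem_rec (g := fun q => step q.1.1 q.1.2.unpair.1 q.2.1 q.2.2)
        (hC.mem_comp hφ (hC.mem_pair hC.mem_fst h1)) ?_ h2
      have hy : Mem C fun q : (ℕ × ℕ) × ℕ × ℕ => q.2.1 := hC.mem_comp hC.mem_fst hC.mem_snd
      have hi : Mem C fun q : (ℕ × ℕ) × ℕ × ℕ => q.2.2 := hC.mem_comp hC.mem_snd hC.mem_snd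
      have hz : Mem C fun q : (ℕ × ℕ) × ℕ × ℕ => q.1.2.unpair.1 :=
        hC.mem_comp (g := fun p : ℕ × ℕ => p.2.unpair.1) h1 hC.mem_fst
      exact hC.mem_ite (hC.mem_eq hi (hC.mem_const 0)) (hC.mem_const 0) (hC.mem_comp hψ
        (hC.mem_pair (hC.mem_comp hC.mem_fst hC.mem_fst) (hC.mem_comp₂ Primrec₂.natPair
          hz (hC.mem_comp₂ Primrec₂.natPair hy
            (hC.mem_sub hi (hC.mem_const 1))))))
    · intro s x b hb
      dsimp only
      generalize x.unpair.1 = z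
      induction x.unpair.2 with
      | zero => exact mφ _ _ _ hb
      | succ y ih =>
        dsimp only at ih ⊢
        generalize (Nat.rec (φ (s, z)) (fun y i => step s z y i) y : ℕ) = u at ih ⊢
        generalize (Nat.rec (φ (2 * s + b, z)) (fun y i => step (2 * s + b) z y i) y : ℕ) = u'
          at ih ⊢
        intro h
        have hu : u ≠ 0 := fun hu => h (if_pos hu)
        rw [ih hu]
        simp only [step, if_neg hu] at h ⊢
        exact mψ _ _ _ hb h
    · intro x
      dsimp only
      generalize x.unpair.1 = z
      suffices h : ∀ y, ∃ n, ∀ m, n ≤ m →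
          (Nat.rec (φ (seg P m, z)) (fun y i => step (seg P m) z y i) y : ℕ) =
            (Nat.rec (f z) (fun y i => g (Nat.pair z (Nat.pair y i))) y : ℕ) + 1 by
        obtain ⟨n, hn⟩ := h x.unpair.2
        exact ⟨n, hn n le_rfl⟩
      intro y
      induction y with
      | zero =>
        obtain ⟨n, hn⟩ := cφ z
        exact ⟨n, fun m hm => mφ.seg_le hP hm hn⟩
      | succ y ih =>
        obtain ⟨n, hn⟩ := ih
        obtain ⟨k, hk⟩ := cψ (Nat.pair z (Nat.pair y
          (Nat.rec (f z) (fun y i => g (Nat.pair z (Nat.pair y i))) y)))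
        refine ⟨max n k, fun m hm => ?_⟩
        dsimp only
        rw [hn m (le_trans (le_max_left n k) hm)]
        exact mψ.seg_le hP (le_trans (le_max_right n k) hm) hk
  find := by
    rintro f hf ⟨φ, hφ, mφ, cφ⟩
    -- The search is bounded by the code s and also stops at an undefined value. An answer is given
    -- only if the value where it stops is 1, which represents f = 0; so no undefined value is
    -- skipped.
    have hex : ∀ p : ℕ × ℕ, ∃ i, p.1 ≤ i ∨ φ (p.1, Nat.pair p.2 i) ≤ 1 :=
      fun p => ⟨p.1, .inl le_rfl⟩
    let ι : ℕ × ℕ → ℕ := fun p => Nat.find (hex p)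
    have h1 : Mem C fun q : (ℕ × ℕ) × ℕ => φ (q.1.1, Nat.pair q.1.2 q.2) :=
      hC.mem_comp hφ (hC.mem_pair (hC.mem_comp hC.mem_fst hC.mem_fst)
        (hC.mem_comp₂ Primrec₂.natPair (hC.mem_comp hC.mem_snd hC.mem_fst) hC.mem_snd))
    have hι : Mem C ι := hC.mem_find hex
      (hC.mem_or (hC.mem_le (hC.mem_comp hC.mem_fst hC.mem_fst) hC.mem_snd)
        (hC.mem_le h1 (hC.mem_const 1)))
    have hι' : ∀ s x i, φ (s, Nat.pair x i) = 1 → (∀ j < i, j < s ∧ 1 < φ (s, Nat.pair x j)) →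
        ι (s, x) = i := by
      intro s x i hi hj
      refine (Nat.find_eq_iff _).2 ⟨.inr hi.le, fun j hji => ?_⟩
      have := hj j hji
      simp only [not_or, not_le]
      exact this
    refine ⟨fun p => if φ (p.1, Nat.pair p.2 (ι p)) = 1 then ι p + 1 else 0, ?_, ?_, ?_⟩
    · exact hC.mem_ite (hC.mem_eq (hC.mem_comp hφ (hC.mem_pair hC.mem_fst
        (hC.mem_comp₂ Primrec₂.natPair hC.mem_snd hι))) (hC.mem_const 1))
        (hC.mem_add hι (hC.mem_const 1)) (hC.mem_const 0)
    · intro s x b hb h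
      have h2 : φ (s, Nat.pair x (ι (s, x))) = 1 := by
        by_contra h2
        exact h (if_neg h2)
      have h3 : φ (2 * s + b, Nat.pair x (ι (s, x))) = 1 := by rw [mφ _ _ _ hb (by omega), h2]
      have h4 : ι (2 * s + b, x) = ι (s, x) := by
        refine hι' _ _ _ h3 fun j hj => ?_
        have h5 := Nat.find_min (hex (s, x)) hj
        simp only [not_or, not_le] at h5
        rw [mφ _ _ _ hb (by omega)]
        exact ⟨by omega, h5.2⟩
      simp only [h4, h3, h2]
    · intro x
      have hn : ∀ i, ∃ n, ∀ j ≤ i, φ (seg P n, Nat.pair x j) = f (Nat.pair x j) + 1 := by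
        intro i
        induction i with
        | zero =>
          obtain ⟨n, hn⟩ := cφ (Nat.pair x 0)
          refine ⟨n, fun j hj => ?_⟩
          obtain rfl : j = 0 := by omega
          exact hn
        | succ i ih =>
          obtain ⟨n, hn⟩ := ih
          obtain ⟨m, hm⟩ := cφ (Nat.pair x (i + 1))
          refine ⟨max n m, fun j hj => ?_⟩
          rcases Nat.lt_or_ge i j with h | h
          · obtain rfl : j = i + 1 := by omega
            exact mφ.seg_le hP (le_max_right n m) hm
          · exact mφ.seg_le hP (le_max_left n m) (hn j h)
      have hspec := Nat.find_spec (hf x)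
      have hmin : ∀ j, j < Nat.find (hf x) → f (Nat.pair x j) ≠ 0 := fun j hj =>
        Nat.find_min (hf x) hj
      generalize hi : Nat.find (hf x) = i at hspec hmin
      obtain ⟨n, hn⟩ := hn i
      have hn' : ∀ j ≤ i, φ (seg P (max n i), Nat.pair x j) = f (Nat.pair x j) + 1 := fun j hj =>
        mφ.seg_le hP (le_max_left n i) (hn j hj)
      -- Length at least i makes the code exceed i, so that the bound on the search is not reached
      -- too early.
      refine ⟨max n i, ?_⟩
      have h1 : ι (seg P (max n i), x) = i := by
        refine hι' _ _ _ (by rw [hn' i le_rfl, hspec]) fun j hj => ⟨?_, ?_⟩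
        · exact (hj.trans_le (le_max_right n i)).trans
            (Nat.lt_two_pow_self.trans_le (le_seg P (max n i)))
        · have := hmin j hj
          rw [hn' j hj.le]
          omega
      simp only [h1]
      rw [if_pos (by rw [hn' i le_rfl, hspec]), hi]

theorem Computes.unique (hφ : Persistent φ) (hP : ∀ n, P n ≤ 1) {Y Z : ℕ → ℕ}
    (hY : Computes φ P Y) (hZ : Computes φ P Z) : Y = Z := by
  funext x
  obtain ⟨n, hn⟩ := hY x
  obtain ⟨m, hm⟩ := hZ x
  have h1 := hφ.seg_le hP (le_max_left n m) hn
  have h2 := hφ.seg_le hP (le_max_right n m) hm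
  omega

/-- A persistent functional computes at most one function from P, so the members of the extension
inject into C. -/
theorem countable_adjoin (hC : C.Countable) (hP : ∀ n, P n ≤ 1) : (adjoin C P).Countable := by
  choose φ hφ mφ cφ using fun Y : adjoin C P => Y.2
  have := hC.to_subtype
  refine (Function.Injective.countable (f := fun Y => (⟨_, hφ Y⟩ : C)) fun Y Z h => ?_)
  have h1 : φ Y = φ Z := funext fun p => by
    have := congrFun (congrArg Subtype.val h) (Encodable.encode p)
    simp only [Denumerable.ofNat_encode] at this
    exact this
  refine Subtype.ext (Computes.unique (mφ Z) hP ?_ (cφ Z))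
  rw [← h1]
  exact cφ Y

end

end TuringIdeal

namespace TuringIdeal

/-! ## Cone avoidance

Every infinite binary tree in a countable ideal has a path from which a given function outside the
ideal remains non-computable. -/

/-- The set of codes `s` with `T s = 0` is closed under initial segments. -/
def IsTree (T : ℕ → ℕ) : Prop := ∀ s b, 0 < s → b ≤ 1 → T (2 * s + b) = 0 → T s = 0

/-- There are codes `s` of sequences of every length with `T s = 0`. -/
def IsInfinite (T : ℕ → ℕ) : Prop := ∀ n, ∃ s, 2 ^ n ≤ s ∧ s < 2 ^ (n + 1) ∧ T s = 0

/-- Division by 2 ^ k deletes the last k entries of a sequence. -/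
theorem IsTree.div {T : ℕ → ℕ} (hT : IsTree T) {s k : ℕ} (hk : 0 < s / 2 ^ k) (h : T s = 0) :
    T (s / 2 ^ k) = 0 := by
  induction k with
  | zero => simpa using h
  | succ k ih =>
    rw [pow_succ, ← Nat.div_div_eq_div_mul] at hk ⊢
    refine hT _ (s / 2 ^ k % 2) hk (by omega) ?_
    rw [Nat.div_add_mod]
    exact ih (by omega)

theorem Persistent.div {φ : ℕ × ℕ → ℕ} (hφ : Persistent φ) {s k x v : ℕ}
    (h : φ (s / 2 ^ k, x) = v + 1) : φ (s, x) = v + 1 := by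
  induction k with
  | zero => simpa using h
  | succ k ih =>
    rw [pow_succ, ← Nat.div_div_eq_div_mul] at h
    refine ih ?_
    have := hφ (s / 2 ^ k / 2) x (s / 2 ^ k % 2) (by omega) (by omega)
    rwa [Nat.div_add_mod, h] at this

theorem level_div {s n m : ℕ} (h1 : 2 ^ m ≤ s) (h2 : s < 2 ^ (m + 1)) (hn : n ≤ m) :
    2 ^ n ≤ s / 2 ^ (m - n) ∧ s / 2 ^ (m - n) < 2 ^ (n + 1) := by
  rw [Nat.le_div_iff_mul_le (by positivity), Nat.div_lt_iff_lt_mul (by positivity), ← pow_add,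
    ← pow_add, show n + (m - n) = m by omega, show n + 1 + (m - n) = m + 1 by omega]
  exact ⟨h1, h2⟩

/-- The single step of cone avoidance. If for some x infinitely much of T avoids the value K(x)
under φ, that part is the required subtree. If not, then for every x all nodes of T on some level
give the value K(x), and K could be computed in C by searching for a level on which all nodes agree.
-/
theorem exists_subtree {C : Set (ℕ → ℕ)} (hC : IsIdeal C) {K : ℕ → ℕ} (hK : K ∉ C) {T : ℕ → ℕ}
    (hTC : T ∈ C) (hT : IsTree T) (hi : IsInfinite T) {φ : ℕ × ℕ → ℕ} (hφC : Mem C φ)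
    (hφ : Persistent φ) :
    ∃ T' ∈ C, IsTree T' ∧ IsInfinite T' ∧ (∀ s, T' s = 0 → T s = 0) ∧
      ∃ x, ∀ s, T' s = 0 → φ (s, x) ≠ K x + 1 := by
  by_contra hcon
  have hfin : ∀ x, ∃ n, ∀ s < 2 ^ (n + 1), 2 ^ n ≤ s → T s = 0 → φ (s, x) = K x + 1 := by
    intro x
    by_contra hx
    push Not at hx
    -- Nodes on which φ is still undefined remain in the subtree; persistence makes what remains
    -- closed under initial segments.
    refine hcon ⟨fun s => if φ (s, x) = K x + 1 then 1 else T s, ?_, ?_, ?_, ?_, x, ?_⟩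
    · exact mem_iff.1 (hC.mem_ite (hC.mem_eq (hC.mem_comp hφC (hC.mem_pair hC.mem_id
        (hC.mem_const x))) (hC.mem_const _)) (hC.mem_const 1) hTC)
    · intro s b hs hb h
      dsimp only at h ⊢
      split_ifs at h with h1
      rw [if_neg fun h2 => h1 ((hφ s x b hb (by omega)).trans h2)]
      exact hT s b hs hb h
    · intro n
      obtain ⟨s, h1, h2, h3, h4⟩ := hx n
      exact ⟨s, h2, h1, (if_neg h4).trans h3⟩
    · intro s h
      dsimp only at h
      split_ifs at h
      exact h
    · intro s h h'
      simp [h'] at h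
  have hex : ∀ x, ∃ w : ℕ, ∀ s < 2 ^ (w.unpair.1 + 1), 2 ^ w.unpair.1 ≤ s → T s = 0 →
      φ (s, x) = w.unpair.2 + 1 := fun x => by
    obtain ⟨n, hn⟩ := hfin x
    exact ⟨Nat.pair n (K x), by simpa using hn⟩
  -- A node of T above both levels extends a node on each of them, and persistence carries both
  -- values to it. So any value found by the search is K(x); infinity of T is essential here.
  have huniq : ∀ x w : ℕ, (∀ s < 2 ^ (w.unpair.1 + 1), 2 ^ w.unpair.1 ≤ s → T s = 0 →
      φ (s, x) = w.unpair.2 + 1) → w.unpair.2 = K x := by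
    intro x w hw
    obtain ⟨n, hn⟩ := hfin x
    obtain ⟨s, h1, h2, h3⟩ := hi (max n w.unpair.1)
    obtain ⟨a1, a2⟩ := level_div h1 h2 (le_max_left n w.unpair.1)
    obtain ⟨b1, b2⟩ := level_div h1 h2 (le_max_right n w.unpair.1)
    have a3 := hφ.div (hn _ a2 a1 (hT.div ((Nat.two_pow_pos _).trans_le a1) h3))
    have b3 := hφ.div (hw _ b2 b1 (hT.div ((Nat.two_pow_pos _).trans_le b1) h3))
    omega
  refine hK ?_
  have hl : Mem C fun p : ℕ × ℕ => p.2.unpair.1 :=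
    hC.mem_primrec (Primrec.fst.comp (Primrec.unpair.comp Primrec.snd))
  have hw : Mem C fun q : (ℕ × ℕ) × ℕ => q.1.2 := hC.mem_comp hC.mem_snd hC.mem_fst
  have hl' : Mem C fun q : (ℕ × ℕ) × ℕ => q.1.2.unpair.1 :=
    hC.mem_comp (g := fun w : ℕ => w.unpair.1) (hC.mem_primrec (Primrec.fst.comp Primrec.unpair)) hw
  have hr' : Mem C fun q : (ℕ × ℕ) × ℕ => q.1.2.unpair.2 :=
    hC.mem_comp (g := fun w : ℕ => w.unpair.2) (hC.mem_primrec (Primrec.snd.comp Primrec.unpair)) hw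
  have hf : Mem C fun x => Nat.find (hex x) := by
    refine hC.mem_find hex (hC.mem_ball (hC.mem_imp (hC.mem_le (hC.mem_comp hC.mem_two_pow hl')
      hC.mem_snd) (hC.mem_imp (hC.mem_eq (hC.mem_comp (mem_iff.2 hTC) hC.mem_snd)
      (hC.mem_const 0)) (hC.mem_eq (hC.mem_comp hφC (hC.mem_pair hC.mem_snd
      (hC.mem_comp hC.mem_fst hC.mem_fst))) (hC.mem_add hr' (hC.mem_const 1))))) (hC.mem_comp hC.mem_two_pow (hC.mem_add hl (hC.mem_const 1))))
  have hf' : Mem C fun x => (Nat.find (hex x)).unpair.2 :=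
    hC.mem_comp (g := fun w : ℕ => w.unpair.2) (hC.mem_primrec (Primrec.snd.comp Primrec.unpair)) hf
  have hK' : (fun x => (Nat.find (hex x)).unpair.2) = K :=
    funext fun x => huniq x _ (Nat.find_spec (hex x))
  rw [← hK']
  exact mem_iff.1 hf'

/-- König's lemma for the intersection of a decreasing sequence of infinite binary trees. -/
theorem exists_path {T : ℕ → ℕ → ℕ} (hT : ∀ k, IsTree (T k)) (hi : ∀ k, IsInfinite (T k))
    (hle : ∀ k s, T (k + 1) s = 0 → T k s = 0) :
    ∃ P : ℕ → ℕ, (∀ n, P n ≤ 1) ∧ ∀ k n, T k (seg P n) = 0 := by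
  have hle' : ∀ j k, j ≤ k → ∀ s, T k s = 0 → T j s = 0 := by
    intro j k h
    induction k, h using Nat.le_induction with
    | base => exact fun s h => h
    | succ k _ ih => exact fun s h => ih s (hle k s h)
  -- A node is good if in every tree of the sequence it has extensions of every height. Good nodes
  -- need not be recognizable in the ideal; only the path itself matters.
  let Good : ℕ → Prop := fun s => 0 < s ∧ ∀ k m, ∃ t, t / 2 ^ m = s ∧ T k t = 0
  have h1 : Good 1 := by
    refine ⟨one_pos, fun k m => ?_⟩
    obtain ⟨t, h1, h2, h3⟩ := hi k m
    refine ⟨t, ?_, h3⟩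
    have := level_div h1 h2 (Nat.zero_le m)
    simp only [pow_zero, tsub_zero, zero_add, pow_one] at this
    omega
  have hstep : ∀ s, Good s → ∃ b, b ≤ 1 ∧ Good (2 * s + b) := by
    intro s hs
    by_contra hcon
    have key : ∀ b, b ≤ 1 → ∃ k m, ∀ t, t / 2 ^ m = 2 * s + b → T k t ≠ 0 := by
      intro b hb
      by_contra h
      push Not at h
      exact hcon ⟨b, hb, by have := hs.1; omega, h⟩
    obtain ⟨k0, m0, h0⟩ := key 0 (by norm_num)
    obtain ⟨k1, m1, h1⟩ := key 1 le_rfl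
    -- If both extensions failed, with witnesses (k0, m0) and (k1, m1), an extension of s in the
    -- smaller tree that is one level above the larger height passes through one of them and
    -- contradicts its failure.
    obtain ⟨t, ht, hT0⟩ := hs.2 (max k0 k1) (max m0 m1 + 1)
    have hpos := hs.1
    rw [pow_succ, ← Nat.div_div_eq_div_mul] at ht
    have close : ∀ b k m, k ≤ max k0 k1 → m ≤ max m0 m1 → t / 2 ^ max m0 m1 = 2 * s + b →
        (∀ u, u / 2 ^ m = 2 * s + b → T k u ≠ 0) → False := by
      intro b k m hk hm hb h
      have hd : t / 2 ^ (max m0 m1 - m) / 2 ^ m = 2 * s + b := by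
        rw [Nat.div_div_eq_div_mul, ← pow_add, Nat.sub_add_cancel hm, hb]
      refine h _ hd ((hT k).div (Nat.pos_of_ne_zero fun h0 => ?_) (hle' _ _ hk _ hT0))
      rw [h0, Nat.zero_div] at hd
      omega
    rcases Nat.mod_two_eq_zero_or_one (t / 2 ^ max m0 m1) with hmod | hmod
    · exact close 0 k0 m0 (le_max_left _ _) (le_max_left _ _) (by omega) h0
    · exact close 1 k1 m1 (le_max_right _ _) (le_max_right _ _) (by omega) h1
  choose! b hb hb' using hstep
  let Q : ℕ → ℕ := fun n => Nat.rec 1 (fun _ s => 2 * s + b s) n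
  have hQ : ∀ n, Good (Q n) := fun n => by
    induction n with
    | zero => exact h1
    | succ n ih => exact hb' _ ih
  have hseg : ∀ n, seg (fun n => b (Q n)) n = Q n := fun n => by
    induction n with
    | zero => rfl
    | succ n ih => rw [seg, ih]
  refine ⟨fun n => b (Q n), fun n => hb _ (hQ n), fun k n => ?_⟩
  rw [hseg]
  obtain ⟨t, ht, h⟩ := (hQ n).2 k 0
  rw [pow_zero, Nat.div_one] at ht
  rwa [← ht]

/-- C is countable, so its members, read as functionals, can be enumerated. The k-th thinning of the
tree keeps the k-th persistent functional from computing K, and a path through the intersection of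
the trees defeats all of them. -/
theorem exists_path_avoiding {C : Set (ℕ → ℕ)} (hC : IsIdeal C) (hcount : C.Countable)
    {K : ℕ → ℕ} (hK : K ∉ C) {T : ℕ → ℕ} (hTC : T ∈ C) (hT : IsTree T) (hi : IsInfinite T) :
    ∃ P : ℕ → ℕ, (∀ n, P n ≤ 1) ∧ (∀ n, T (seg P n) = 0) ∧ K ∉ adjoin C P := by
  obtain ⟨e, he⟩ := hcount.exists_eq_range ⟨T, hTC⟩
  let Tree := {T : ℕ → ℕ // T ∈ C ∧ IsTree T ∧ IsInfinite T}
  let φ : ℕ → ℕ × ℕ → ℕ := fun k p => e k (Encodable.encode p)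
  have hφ : ∀ k, Mem C (φ k) := fun k => by
    have : e k ∈ C := he ▸ Set.mem_range_self k
    unfold Mem
    convert this using 2 with n
    exact congrArg (e k) (Denumerable.encode_ofNat n)
  have hstep : ∀ (k : ℕ) (T : Tree), ∃ T' : Tree, (∀ s, T'.1 s = 0 → T.1 s = 0) ∧
      (Persistent (φ k) → ∃ x, ∀ s, T'.1 s = 0 → φ k (s, x) ≠ K x + 1) := by
    rintro k ⟨T, h1, h2, h3⟩
    by_cases hp : Persistent (φ k)
    · obtain ⟨T', a1, a2, a3, a4, a5⟩ := exists_subtree hC hK h1 h2 h3 (hφ k) hp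
      exact ⟨⟨T', a1, a2, a3⟩, a4, fun _ => a5⟩
    · exact ⟨⟨T, h1, h2, h3⟩, fun s h => h, fun h => absurd h hp⟩
  choose next hnext havoid using hstep
  let S : ℕ → Tree := fun n => Nat.rec ⟨T, hTC, hT, hi⟩ next n
  obtain ⟨P, hP, hpath⟩ := exists_path (T := fun k => (S k).1) (fun k => (S k).2.2.1)
    (fun k => (S k).2.2.2) fun k s => hnext k (S k) s
  refine ⟨P, hP, hpath 0, ?_⟩
  rintro ⟨ψ, hψ, mψ, cψ⟩
  have hmem : (fun n => Encodable.encode (ψ (Denumerable.ofNat (ℕ × ℕ) n))) ∈ Set.range e := he ▸ hψ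
  obtain ⟨k, hk⟩ := hmem
  have hk' : φ k = ψ := by
    funext p
    simp only [φ, hk, Denumerable.ofNat_encode]
    rfl
  obtain ⟨x, hx⟩ := havoid k (S k) (hk' ▸ mψ)
  obtain ⟨n, hn⟩ := cψ x
  exact hx (seg P n) (hpath (k + 1) n) (by rw [hk', hn])

/-! ## Ideals with paths -/

theorem isIdeal_iUnion {D : ℕ → Set (ℕ → ℕ)} (hD : ∀ n, IsIdeal (D n)) (hmono : Monotone D) :
    IsIdeal (⋃ n, D n) where
  prim hf := Set.mem_iUnion.2 ⟨0, (hD 0).prim hf⟩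
  comp hf hg := by
    obtain ⟨n, hn⟩ := Set.mem_iUnion.1 hf
    obtain ⟨m, hm⟩ := Set.mem_iUnion.1 hg
    exact Set.mem_iUnion.2 ⟨max n m, (hD _).comp (hmono (le_max_left n m) hn)
      (hmono (le_max_right n m) hm)⟩
  pair hf hg := by
    obtain ⟨n, hn⟩ := Set.mem_iUnion.1 hf
    obtain ⟨m, hm⟩ := Set.mem_iUnion.1 hg
    exact Set.mem_iUnion.2 ⟨max n m, (hD _).pair (hmono (le_max_left n m) hn)
      (hmono (le_max_right n m) hm)⟩
  prec hf hg := by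
    obtain ⟨n, hn⟩ := Set.mem_iUnion.1 hf
    obtain ⟨m, hm⟩ := Set.mem_iUnion.1 hg
    exact Set.mem_iUnion.2 ⟨max n m, (hD _).prec (hmono (le_max_left n m) hn)
      (hmono (le_max_right n m) hm)⟩
  find h hf := by
    obtain ⟨n, hn⟩ := Set.mem_iUnion.1 hf
    exact Set.mem_iUnion.2 ⟨n, (hD n).find h hn⟩

/-- Countable ideals that do not contain `K`. -/
structure Avoiding (K : ℕ → ℕ) where
  carrier : Set (ℕ → ℕ)
  ideal : IsIdeal carrier
  countable : carrier.Countable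
  notMem : K ∉ carrier

/-- The tree `T` has a path in `C`. -/
def HasPath (C : Set (ℕ → ℕ)) (T : ℕ → ℕ) : Prop :=
  ∃ P ∈ C, (∀ n, P n ≤ 1) ∧ ∀ n, T (seg P n) = 0

namespace Avoiding

variable {K : ℕ → ℕ}

theorem exists_adjoin (C : Avoiding K) (T : ℕ → ℕ) : ∃ D : Avoiding K, C.carrier ⊆ D.carrier ∧
    (T ∈ C.carrier → IsTree T → IsInfinite T → HasPath D.carrier T) := by
  by_cases h : T ∈ C.carrier ∧ IsTree T ∧ IsInfinite T
  · obtain ⟨P, hP, hpath, hK⟩ := exists_path_avoiding C.ideal C.countable C.notMem h.1 h.2.1 h.2.2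
    exact ⟨⟨adjoin C.carrier P, isIdeal_adjoin C.ideal hP, countable_adjoin C.countable hP, hK⟩,
      subset_adjoin C.ideal P, fun _ _ _ => ⟨P, self_mem_adjoin C.ideal hP, hP, hpath⟩⟩
  · exact ⟨C, subset_rfl, fun h1 h2 h3 => absurd ⟨h1, h2, h3⟩ h⟩

/-- The union of an increasing sequence. -/
def iUnion (D : ℕ → Avoiding K) (hmono : Monotone fun n => (D n).carrier) : Avoiding K where
  carrier := ⋃ n, (D n).carrier
  ideal := isIdeal_iUnion (fun n => (D n).ideal) hmono
  countable := Set.countable_iUnion fun n => (D n).countable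
  notMem h := by
    obtain ⟨n, hn⟩ := Set.mem_iUnion.1 h
    exact (D n).notMem hn

/-- The trees of C are treated one after the other; those that first appear in the extensions are
left to later rounds. -/
theorem exists_adjoin_all (C : Avoiding K) : ∃ D : Avoiding K, C.carrier ⊆ D.carrier ∧
    ∀ T ∈ C.carrier, IsTree T → IsInfinite T → HasPath D.carrier T := by
  obtain ⟨e, he⟩ := C.countable.exists_eq_range ⟨_, C.ideal.prim Nat.Primrec.zero⟩
  choose next hsub hpath using fun (D : Avoiding K) (T : ℕ → ℕ) => D.exists_adjoin T
  let D : ℕ → Avoiding K := fun n => Nat.rec C (fun k D => next D (e k)) n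
  have hmono : Monotone fun n => (D n).carrier := monotone_nat_of_le_succ fun n => hsub (D n) (e n)
  refine ⟨iUnion D hmono, Set.subset_iUnion (fun n => (D n).carrier) 0, fun T hT h1 h2 => ?_⟩
  obtain ⟨k, rfl⟩ : T ∈ Set.range e := he ▸ hT
  obtain ⟨P, hP, h⟩ := hpath (D k) (e k) (hmono (Nat.zero_le k) hT) h1 h2
  exact ⟨P, Set.mem_iUnion.2 ⟨k + 1, hP⟩, h⟩

/-- After ω rounds nothing is left over: a tree in the union appears in some round and receives a
path in the next one. -/
theorem exists_closed (C : Avoiding K) : ∃ D : Avoiding K, C.carrier ⊆ D.carrier ∧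
    ∀ T ∈ D.carrier, IsTree T → IsInfinite T → HasPath D.carrier T := by
  choose next hsub hpath using fun D : Avoiding K => D.exists_adjoin_all
  let D : ℕ → Avoiding K := fun n => Nat.rec C (fun _ D => next D) n
  have hmono : Monotone fun n => (D n).carrier := monotone_nat_of_le_succ fun n => hsub (D n)
  refine ⟨iUnion D hmono, Set.subset_iUnion (fun n => (D n).carrier) 0, fun T hT h1 h2 => ?_⟩
  obtain ⟨k, hk⟩ := Set.mem_iUnion.1 hT
  obtain ⟨P, hP, h⟩ := hpath (D k) T hk h1 h2
  exact ⟨P, Set.mem_iUnion.2 ⟨k + 1, hP⟩, h⟩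

end Avoiding

/-- There is an ideal with paths through all of its infinite binary trees that does not contain
the range of each of its functions. -/
theorem exists_ideal_hasPath : ∃ C : Set (ℕ → ℕ), IsIdeal C ∧
    (∀ T ∈ C, IsTree T → IsInfinite T → HasPath C T) ∧
    ∃ h ∈ C, ¬ ∃ g ∈ C, ∀ n, g n = 0 ↔ n ∈ Set.range h := by
  classical
  obtain ⟨h, hh, hrange⟩ := exists_range_not_computable
  let K : ℕ → ℕ := fun n => if n ∈ Set.range h then 0 else 1
  have hK : ∀ n, K n = 0 ↔ n ∈ Set.range h := fun n => by simp [K]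
  obtain ⟨D, hD, hpath⟩ := Avoiding.exists_closed (K := K)
    ⟨_, isIdeal_computable, countable_computable, hrange K hK⟩
  refine ⟨D.carrier, D.ideal, hpath, h, hD hh, ?_⟩
  rintro ⟨g, hg, hgr⟩
  refine D.notMem ?_
  -- Any g with this zero set computes K by a definition by cases, so omitting K excludes every such
  -- g.
  have := D.ideal.mem_ite (p := fun n => g n = 0) (D.ideal.mem_eq (mem_iff.2 hg)
    (D.ideal.mem_const 0)) (D.ideal.mem_const 0) (D.ideal.mem_const 1)
  convert mem_iff.1 this using 1
  funext n
  simp only [K, hgr]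

end TuringIdeal

namespace HOA

open TuringIdeal

/-! ## The hereditary functionals over an ideal

A functional belongs to the model if it maps the sequences that are given by the ideal to sequences
that are given by the ideal. -/

/-- A type with a distinguished set of sequences. -/
structure SeqSpace where
  X : Type
  seqs : Set (ℕ → X)

/-- The hereditary functionals of a finite type over `C`. -/
def seqSpace (C : Set (ℕ → ℕ)) : Ty → SeqSpace
  | .nat => ⟨ℕ, C⟩
  | .arr σ τ =>
    { X := {F : (seqSpace C σ).X → (seqSpace C τ).X //
        ∀ p ∈ (seqSpace C σ).seqs, (fun n => F (p n)) ∈ (seqSpace C τ).seqs}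
      seqs := {q | ∀ r ∈ C, ∀ p ∈ (seqSpace C σ).seqs,
        (fun n => (q (r n)).1 (p n)) ∈ (seqSpace C τ).seqs} }

/-- The hereditary functionals of type `σ` over `C`. -/
abbrev Her (C : Set (ℕ → ℕ)) (σ : Ty) : Type := (seqSpace C σ).X

/-- The distinguished sequences of hereditary functionals. -/
def IsSeq {C : Set (ℕ → ℕ)} {σ : Ty} (p : ℕ → Her C σ) : Prop := p ∈ (seqSpace C σ).seqs

/-! ### Closure properties and the axioms for hereditary functionals -/

section

variable {C : Set (ℕ → ℕ)} {ρ σ τ υ : Ty}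

/-- Application of hereditary functionals. -/
def Her.app (F : Her C (.arr σ τ)) (x : Her C σ) : Her C τ := F.1 x

/-- The function that is given by a hereditary functional of type `1`. -/
def Her.toFun (F : Her C .one) (n : ℕ) : ℕ := F.1 n

theorem Her.ext {F G : Her C (.arr σ τ)} (h : ∀ x, F.app x = G.app x) : F = G :=
  Subtype.ext (funext h)

variable (hC : IsIdeal C)

include hC

/-- At arrow types this is exactly the condition that a single functional preserves distinguished
sequences. -/
theorem IsSeq.const : ∀ {σ : Ty} (x : Her C σ), IsSeq fun _ => x
  | .nat, x => hC.mem_const (α := ℕ) (β := ℕ) x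
  | .arr _ _, F => fun _ _ p hp => F.2 p hp

/-- Reparametrization by members of C is built into the distinguished sequences of functionals for
this purpose; `Her.curry₂` and `Her.curry₃` rely on it. -/
theorem IsSeq.comp : ∀ {σ : Ty} {p : ℕ → Her C σ} {r : ℕ → ℕ}, IsSeq p → r ∈ C →
    IsSeq fun n => p (r n)
  | .nat, _, _, hp, hr => hC.comp hp hr
  | .arr _ _, _, _, hq, hr => fun _ hr' p hp => hq _ (hC.comp hr hr') p hp

theorem IsSeq.app {q : ℕ → Her C (.arr σ τ)} {p : ℕ → Her C σ} (hq : IsSeq q) (hp : IsSeq p) :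
    IsSeq fun n => (q n).app (p n) :=
  hq (fun n => n) (hC.mem_id (α := ℕ)) p hp

/-- The hereditary functional of two arguments that is given by `F`. -/
def Her.curry₂ (F : Her C σ → Her C τ → Her C υ)
    (hF : ∀ p q, IsSeq p → IsSeq q → IsSeq fun n => F (p n) (q n)) :
    Her C (.arr σ (.arr τ υ)) :=
  ⟨fun x => ⟨F x, fun q hq => hF _ q (IsSeq.const hC x) hq⟩,
    fun _ hp _ hr q hq => hF _ q (IsSeq.comp hC hp hr) hq⟩

/-- The hereditary functional of three arguments that is given by `F`. -/
def Her.curry₃ (F : Her C ρ → Her C σ → Her C τ → Her C υ)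
    (hF : ∀ o p q, IsSeq o → IsSeq p → IsSeq q → IsSeq fun n => F (o n) (p n) (q n)) :
    Her C (.arr ρ (.arr σ (.arr τ υ))) :=
  ⟨fun x => Her.curry₂ hC (F x) fun p q hp hq => hF _ p q (IsSeq.const hC x) hp hq,
    fun _ ho _ hr _ hp _ hr' q hq =>
      hF _ _ q (IsSeq.comp hC ho (hC.comp hr hr')) (IsSeq.comp hC hp hr') hq⟩

/-- Every type has an element. -/
def Her.default : (σ : Ty) → Her C σ
  | .nat => (0 : ℕ)
  | .arr _ τ => ⟨fun _ => Her.default τ, fun _ _ => IsSeq.const hC _⟩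

/-- The interpretation of the recursors; those of higher type are arbitrary. -/
def Her.recursor : (σ : Ty) → Her C (.arr (.arr .nat (.arr σ σ)) (.arr σ (.arr .nat σ)))
  | .nat => Her.curry₃ (ρ := .arr .nat .one) (σ := .nat) (τ := .nat) (υ := .nat) hC
      (fun f m n => (Nat.rec m (fun y i => (f.app (σ := .nat) y).app (σ := .nat) i) n : ℕ))
      fun f m n hf hm hn => by
        have hl : (fun p : ℕ => p.unpair.1) ∈ C :=
          hC.prim (Primrec.nat_iff.1 (Primrec.fst.comp Primrec.unpair))
        have hr : (fun p : ℕ => p.unpair.2) ∈ C :=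
          hC.prim (Primrec.nat_iff.1 (Primrec.snd.comp Primrec.unpair))
        have hg := IsSeq.app (σ := .nat) (τ := .nat) hC
          (IsSeq.app (σ := .nat) (τ := .one) hC (IsSeq.comp hC hf hl)
            (hC.comp hl hr)) (hC.comp hr hr)
        have hg' : Mem (β := ℕ) C fun x : ℕ × ℕ × ℕ =>
            ((f x.1).app (σ := .nat) x.2.1).app (σ := .nat) x.2.2 := by
          unfold Mem
          simp only [Denumerable.prod_ofNat_val]
          exact hg
        exact hC.mem_rec (α := ℕ) hm hg' hn
  | .arr _ _ => Her.default hC _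

/-- The interpretation of the constants. -/
def Her.con : {σ : Ty} → Con σ → Her C σ
  | _, .zero => (0 : ℕ)
  | _, .one => (1 : ℕ)
  | _, .add => Her.curry₂ (σ := .nat) (τ := .nat) (υ := .nat) hC Nat.add
      fun _ _ hp hq => hC.mem_add (α := ℕ) hp hq
  | _, .mul => Her.curry₂ (σ := .nat) (τ := .nat) (υ := .nat) hC Nat.mul
      fun _ _ hp hq => hC.mem_mul (α := ℕ) hp hq
  | _, .k _ _ => Her.curry₂ hC (fun a _ => a) fun _ _ hp _ => hp
  | _, .s _ _ _ => Her.curry₃ hC (fun x y z => (x.app z).app (y.app z)) fun _ _ _ ho hp hq =>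
      IsSeq.app hC (IsSeq.app hC ho hq) (IsSeq.app hC hp hq)
  | _, .recursor σ => Her.recursor hC σ

/-- The structure of the hereditary functionals over an ideal. -/
def herStr : Str where
  D := Her C
  app := Her.app
  con := Her.con hC
  eq a b := a = b
  lt a b := Nat.lt a b

theorem herStr_normal : (herStr hC).Normal where
  eq_iff _ _ := Iff.rfl
  ext _ _ h := Her.ext h

theorem isSeq_eval {Γ : Ctx} {e : ℕ → Env (herStr hC) Γ}
    (he : ∀ σ x, IsSeq (C := C) (σ := σ) fun n => e n σ x) {σ : Ty} (t : Tm Γ σ) :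
    IsSeq (C := C) fun n => t.eval (e n) := by
  induction t with
  | var x => exact he _ x
  | con c => exact IsSeq.const hC _
  | app s t hs ht => exact IsSeq.app hC hs ht

-- Atomic formulas compare numbers whose values along e lie in C, and implication is arithmetic on
-- truth values. So quantifier-free formulas are decidable in C even with variables of high type.
open Classical in
theorem mem_sat {Γ : Ctx} {e : ℕ → Env (herStr hC) Γ}
    (he : ∀ σ x, IsSeq (C := C) (σ := σ) fun n => e n σ x) {φ : Fm Γ} (hφ : φ.QF) :
    Mem C fun n => if φ.sat (e n) then 0 else 1 := by
  induction φ with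
  | bot => simpa using hC.mem_const (α := ℕ) 1
  | eq s t =>
    have hs : Mem (α := ℕ) (β := ℕ) C fun n => s.eval (e n) := isSeq_eval hC he s
    have ht : Mem (α := ℕ) (β := ℕ) C fun n => t.eval (e n) := isSeq_eval hC he t
    convert hC.mem_eq hs ht using 2 with n
    split_ifs with h1 h2 h2 <;> first | rfl | exact absurd h1 h2 | exact absurd h2 h1
  | lt s t =>
    have hs : Mem (α := ℕ) (β := ℕ) C fun n => s.eval (e n) := isSeq_eval hC he s
    have ht : Mem (α := ℕ) (β := ℕ) C fun n => t.eval (e n) := isSeq_eval hC he t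
    convert hC.mem_lt hs ht using 2 with n
    split_ifs with h1 h2 h2 <;> first | rfl | exact absurd h1 h2 | exact absurd h2 h1
  | imp φ ψ h1 h2 =>
    convert hC.mem_imp (h1 he hφ.1) (h2 he hφ.2) using 2 with n
    exact if_congr Iff.rfl rfl rfl
  | all σ φ => exact hφ.elim

/-- Y(x) is the least witness. Along a distinguished sequence of arguments its values come from
minimization of a predicate that is decidable in C, so Y preserves distinguished sequences and
belongs to the model. -/
theorem herStr_choice {Γ : Ctx} {φ : Fm (.nat :: .one :: Γ)} (hφ : φ.QF)
    (e : Env (herStr hC) Γ) (h : ∀ x, ∃ y, φ.sat (Env.cons y (Env.cons x e))) :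
    ∃ Y : Her C .two, ∀ x, φ.sat (M := herStr hC) (Env.cons (τ := .nat) (Y.app x) (Env.cons (τ := .one) x e)) := by
  classical
  have h' : ∀ x : Her C .one, ∃ n : ℕ, φ.sat (M := herStr hC) (Env.cons (τ := .nat) n (Env.cons (τ := .one) x e)) := h
  refine ⟨⟨fun x => Nat.find (h' x), fun p hp => ?_⟩, fun x => Nat.find_spec (h' x)⟩
  refine hC.mem_find (α := ℕ) (fun n => h' (p n)) ?_
  have hl : (fun p : ℕ => p.unpair.1) ∈ C :=
    hC.prim (Primrec.nat_iff.1 (Primrec.fst.comp Primrec.unpair))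
  have hr : (fun p : ℕ => p.unpair.2) ∈ C :=
    hC.prim (Primrec.nat_iff.1 (Primrec.snd.comp Primrec.unpair))
  have hm := mem_sat hC (φ := φ) (e := fun w : ℕ =>
    Env.cons (M := herStr hC) (τ := .nat) w.unpair.2 (Env.cons (τ := .one) (p w.unpair.1) e)) (fun σ x => by
      match x with
      | .vz => exact hr
      | .vs .vz => exact IsSeq.comp hC (σ := .one) hp hl
      | .vs (.vs x) => exact IsSeq.const hC _) hφ
  unfold Mem at hm ⊢
  simp only [Denumerable.prod_ofNat_val]
  exact hm

theorem herStr_rca : ∀ φ ∈ RCA, (herStr hC).Models φ := by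
  intro φ hφ
  have N := herStr_normal hC
  cases hφ <;> refine (Fm.models_close _).2 fun e => ?_
  case k σ τ => exact (N.sat_eqT _ _ _).2 rfl
  case s ρ σ τ => exact (N.sat_eqT _ _ _).2 rfl
  case ext ρ τ =>
    intro h
    rw [N.sat_eqT] at h
    rw [N.sat_eqT, Tm.eval_app, Tm.eval_app, h]
  case ind Γ A hA =>
    intro h0 hs n
    rw [Fm.sat_inst] at h0
    induction n using Nat.rec with
    | zero => exact h0
    | succ n ih =>
      have := hs n ih
      rw [Fm.sat_subst] at this
      refine (iff_of_eq (congrArg (fun e => A.sat e) ?_)).1 this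
      funext σ x
      cases x <;> rfl
  case qfac Γ A hA =>
    intro h
    simp only [Fm.sat_all, Fm.sat_ex] at h
    obtain ⟨Y, hY⟩ := herStr_choice hC hA e h
    refine (Fm.sat_ex _ _ _).2 ⟨Y, fun x => ?_⟩
    rw [Fm.sat_subst]
    refine (iff_of_eq (congrArg (fun e => A.sat e) ?_)).1 (hY x)
    funext σ x
    match x with
    | .vz => rfl
    | .vs .vz => rfl
    | .vs (.vs x) => rfl
  case lt_succ =>
    simp only [Fm.sat_iff, Fm.sat_or]
    exact Nat.lt_succ_iff_lt_or_eq
  case lt_total =>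
    simp only [Fm.sat_or]
    exact lt_trichotomy (α := ℕ) _ _
  case eq_refl => rfl
  case eq_symm => exact Eq.symm
  case eq_trans => exact Eq.trans
  case lt_congr_left => exact fun h h' => lt_of_eq_of_lt (α := ℕ) (Eq.symm h) h'
  case lt_congr_right => exact fun h h' => lt_of_lt_of_eq (α := ℕ) h' h
  case add_zero => exact Nat.add_zero _
  case add_comm => exact Nat.add_comm _ _
  case add_assoc => exact Nat.add_assoc _ _ _
  case mul_zero => exact Nat.mul_zero _
  case mul_one => exact Nat.mul_one _
  case mul_comm => exact Nat.mul_comm _ _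
  case mul_assoc => exact Nat.mul_assoc _ _ _
  case mul_add => exact Nat.mul_add _ _ _
  case lt_irrefl => exact Nat.lt_irrefl _
  case lt_trans => exact Nat.lt_trans
  case add_lt_add => exact fun h => Nat.add_lt_add_right h _
  case mul_lt_mul => exact fun h h' => Nat.mul_lt_mul_of_pos_right h' h
  case not_lt_zero => exact Nat.not_lt_zero _
  case rec_zero => rfl
  case rec_succ => rfl

end

end HOA

namespace HOA

open TuringIdeal

/-! ## Weak König's lemma without arithmetical comprehension -/

section

variable {C : Set (ℕ → ℕ)} (hC : IsIdeal C)

/-- The model of the hereditary functionals over an ideal. -/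
def herModel : Model := ⟨herStr hC, herStr_normal hC, herStr_rca hC⟩

/-- The functions of the ideal as objects of type `1`. -/
def Her.ofMem {f : ℕ → ℕ} (hf : f ∈ C) : (herModel hC).D .one :=
  ⟨f, fun _ hp => hC.comp hf hp⟩

include hC in
/-- The objects of type `1` belong to the ideal. -/
theorem Her.toFun_mem (F : Her C .one) : F.toFun ∈ C := F.2 _ (hC.mem_id (α := ℕ))

theorem herModel_twoPow (n : (herModel hC).D .nat) : Model.twoPow n = Nat.pow 2 n := by
  change ℕ at n
  induction n with
  | zero => rfl
  | succ n ih =>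
    refine (Model.twoPow_succ (M := herModel hC) _).trans ?_
    rw [two_mul, Nat.pow_eq, pow_succ, mul_two]
    exact congrArg₂ Nat.add ih ih

theorem herModel_initSeg {Γ : Ctx} (ρ : Env (herModel hC).toStr Γ) (b : Tm Γ .one)
    (n : Tm Γ .nat) :
    (initSeg b n).eval ρ = seg (Her.toFun (b.eval ρ)) (n.eval ρ) := by
  rw [initSeg, Model.eval_primRec]
  have key : ∀ k : (herModel hC).D .nat,
      Model.recur (one.eval ρ) ((add (mul two v0) (.app b.wk.wk v1)).lam.lam.eval ρ) (k + 1) =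
        Model.recur (one.eval ρ) ((add (mul two v0) (.app b.wk.wk v1)).lam.lam.eval ρ) k +
          Model.recur (one.eval ρ) ((add (mul two v0) (.app b.wk.wk v1)).lam.lam.eval ρ) k +
            (herModel hC).app (b.eval ρ) k := fun k => by
    rw [Model.recur_step ρ (fun _ _ => rfl) rfl]
    simp [two_mul]
  generalize n.eval ρ = m
  change ℕ at m
  induction m with
  | zero => rfl
  | succ m ih =>
    refine (key m).trans ?_
    rw [ih, seg, two_mul]
    rfl

/-- The numbers are standard and the objects of type 1 are exactly the members of C, so the axiom in
the model says just what is assumed about C. -/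
theorem herModel_wkl (h : ∀ T ∈ C, IsTree T → IsInfinite T → HasPath C T) :
    (herModel hC).Models WKL := by
  intro T hT hi
  have hT' : IsTree (Her.toFun T) := by
    intro s b hs hb hb'
    have := hT s hs
    simp only [Fm.sat_imp, Fm.sat_or, Model.sat_eq, Tm.eval_app, Model.eval_mul, Model.eval_two,
      Model.eval_succ, two_mul] at this
    refine this ?_
    rw [two_mul] at hb'
    obtain rfl | rfl : b = 0 ∨ b = 1 := by omega
    · exact .inl hb'
    · exact .inr hb'
  have hi' : IsInfinite (Her.toFun T) := by
    intro n
    obtain ⟨s, hs⟩ := (Fm.sat_ex _ _ _).1 (hi n)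
    simp only [Fm.sat_and, Model.sat_le, Model.sat_lt, Model.sat_eq, Model.eval_pow2,
      herModel_twoPow] at hs
    exact ⟨s, Nat.not_lt.1 fun h => not_lt.2 hs.1 h, hs.2⟩
  obtain ⟨P, hP, hle, hpath⟩ := h _ (Her.toFun_mem hC T) hT' hi'
  refine (Fm.sat_ex _ _ _).2 ⟨Her.ofMem hC hP, fun n => (Fm.sat_and _ _ _).2 ⟨?_, ?_⟩⟩
  · exact (Model.sat_le _ _ _).2 (not_lt.1 (Nat.not_lt.2 (hle n)))
  · rw [Model.sat_eq, Tm.eval_app, herModel_initSeg]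
    exact hpath n

/-- The range of the last function variable. -/
def inRange : Fm [.nat, .one] := .ex .nat (.eq (.app v2 v0) v1)

theorem arith_inRange : Arith inRange :=
  .imp (.all (.imp (.eq (.app _ (.var _)) (.var _)) .bot)) .bot

theorem exists_aca_not_models {h : ℕ → ℕ} (hh : h ∈ C)
    (hr : ¬ ∃ g ∈ C, ∀ n, g n = 0 ↔ n ∈ Set.range h) :
    ∃ φ, ACA φ ∧ ¬ (herModel hC).Models φ := by
  refine ⟨_, .compr inRange arith_inRange, fun hm => hr ?_⟩
  have := (Fm.models_close _).1 hm (Env.cons (Her.ofMem hC hh) Env.nil)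
  obtain ⟨g, hg⟩ := (Fm.sat_ex _ _ _).1 this
  refine ⟨Her.toFun g, Her.toFun_mem hC g, fun n => ?_⟩
  have hn := hg n
  rw [Fm.sat_iff, Fm.sat_rename, inRange, Fm.sat_ex] at hn
  exact hn

end

/-- Weak König's lemma does not prove arithmetical comprehension. -/
theorem exists_aca_not_proves : ∃ φ, ACA φ ∧ ¬ Proves RCAWKL φ := by
  obtain ⟨C, hC, hpath, h, hh, hr⟩ := exists_ideal_hasPath
  obtain ⟨φ, hφ, hm⟩ := exists_aca_not_models hC hh hr
  refine ⟨φ, hφ, fun hp => hm (hp.sound fun ψ hψ => ?_)⟩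
  rcases hψ with hψ | rfl
  · exact (herModel hC).rca ψ hψ
  · exact herModel_wkl hC hpath

end HOA

theorem theorem4p2 (A : HOA.Fm [.arr .one .one])
    (ha : HOA.Proves HOA.ACAomega (HOA.forallFunctions A))
    (hb : HOA.Proves HOA.RCAWKL (HOA.forallContinuous A)) :
    HOA.Proves HOA.RCAWKL (HOA.forallFunctions A) ∧
      ¬ ∀ φ : HOA.Sentence, HOA.ACA φ →
        HOA.Proves HOA.RCAWKL (.imp (HOA.forallFunctions A) φ) := by
  have h := HOA.proves_forallFunctions ha hb
  obtain ⟨φ, hφ, hn⟩ := HOA.exists_aca_not_proves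
  -- The principle is already provable, so by modus ponens its consequences are theorems of the same
  -- theory, including the unprovable instance.
  exact ⟨h, fun hall => hn (.impE (hall φ hφ) h)⟩
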